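/- Let $k$ be a field, $(A,\Delta,\varepsilon,\Phi,S,\alpha,\beta)$ a quasi-Hopf algebra over $k$, $\mathrm{Rep}(A)$ the tensor category of finite-dimensional left $A$-modules (associativity isomorphism given by the action of $\Phi$), $G$ an abelian group and $F\subseteq G$ a subgroup. *Crossed systems.* Let $(\sigma_*,\theta_{\sigma,\tau},J_\sigma)_{\sigma,\tau\in G}$ be a $G$-crossed system over $A$: algebra automorphisms $\sigma_*$ of $A$, and $\theta_{\sigma,\tau}\in A^\times$, $J_\sigma\in (A\otimes A)^\times$ such that, for all $a\in A$ and $\sigma,\tau,\rho\in G$, $$\Phi(\Delta\otimes\mathrm{id})(J_\sigma)(J_\sigma\otimes1)=(\mathrm{id}\otimes\Delta)(J_\sigma)(1\otimes J_\sigma)\,\sigma_*^{\otimes3}(\Phi),\quad(\varepsilon\otimes\mathrm{id})(J_\sigma)=1=(\mathrm{id}\otimes\varepsilon)(J_\sigma),$$ $$\varepsilon(\sigma_*(a))=\varepsilon(a),\quad\Delta(\sigma_*(a))J_\sigma=J_\sigma\,\sigma_*^{\otimes2}(\Delta(a)),\quad\varepsilon(\theta_{\sigma,\tau})=1,\quad(1_*,J_1)=(\mathrm{id},1\otimes1),\quad\theta_{1,\sigma}=\theta_{\sigma,1}=1,$$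 $$\theta_{\sigma,\tau}(\sigma\tau)_*(a)=\sigma_*(\tau_*(a))\theta_{\sigma,\tau},\quad\theta_{\sigma,\tau}\theta_{\sigma\tau,\rho}=\sigma_*(\theta_{\tau,\rho})\theta_{\sigma,\tau\rho},\quad\Delta(\theta_{\sigma,\tau})J_{\sigma\tau}=J_\sigma\,\sigma_*^{\otimes2}(J_\tau)(\theta_{\sigma,\tau}\otimes\theta_{\sigma,\tau}).$$ Let $(K,\lambda,\Phi_\lambda)$ be a left $A$-comodule algebra: an algebra $K$, an algebra map $\lambda:K\to A\otimes K$ and $\Phi_\lambda\in(A\otimes A\otimes K)^\times$ with $$(1\otimes\Phi_\lambda)(\mathrm{id}\otimes\Delta\otimes\mathrm{id})(\Phi_\lambda)(\Phi\otimes1)=(\mathrm{id}\otimes\mathrm{id}\otimes\lambda)(\Phi_\lambda)(\Delta\otimes\mathrm{id}\otimes\mathrm{id})(\Phi_\lambda),$$ $$\Phi_\lambda(\Delta\otimes\mathrm{id})\lambda(x)=(\mathrm{id}\otimes\lambda)\lambda(x)\,\Phi_\lambda,\quad(\mathrm{id}\otimes\varepsilon\otimes\mathrm{id})(\Phi_\lambda)=1,\quad(\varepsilon\otimes\mathrm{id})\lambda(x)=x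 .$$ Let $(\bar\sigma,\bar\theta_{\sigma,\tau},\bar J_\sigma)_{\sigma,\tau\in F}$ be a compatible $F$-crossed system for $K$: algebra automorphisms $\bar\sigma$ of $K$, $\bar\theta_{\sigma,\tau}\in K^\times$ and $\bar J_\sigma\in(A\otimes K)^\times$ with $$\Phi_\lambda(\Delta\otimes\mathrm{id})(\bar J_\sigma)(J_\sigma\otimes1)=(\mathrm{id}\otimes\lambda)(\bar J_\sigma)(1\otimes\bar J_\sigma)(\sigma_*\otimes\sigma_*\otimes\bar\sigma)(\Phi_\lambda),\quad(\varepsilon\otimes\mathrm{id})(\bar J_\sigma)=1,$$ $$\lambda(\bar\sigma(x))\bar J_\sigma=\bar J_\sigma(\sigma_*\otimes\bar\sigma)(\lambda(x)),\quad(\bar1,\bar J_1)=(\mathrm{id},1\otimes1),\quad\bar\theta_{1,\sigma}=\bar\theta_{\sigma,1}=1,$$ $$\bar\theta_{\sigma,\tau}\overline{\sigma\tau}(x)=\bar\sigma(\bar\tau(x))\bar\theta_{\sigma,\tau},\quad\bar\theta_{\sigma,\tau}\bar\theta_{\sigma\tau,\rho}=\bar\sigma(\bar\theta_{\tau,\rho})\bar\theta_{\sigma,\tau\rho},\quad\lambda(\bar\theta_{\sigma,\tau})\bar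 J_{\sigma\tau}=\bar J_\sigma(\sigma_*\otimes\bar\sigma)(\bar J_\tau)(\theta_{\sigma,\tau}\otimes\bar\theta_{\sigma,\tau}).$$ Assume that $\theta_{\sigma,\tau}=\theta_{\tau,\sigma}$ for all $\sigma,\tau\in G$ and $\bar\theta_{\sigma,\tau}=\bar\theta_{\tau,\sigma}$ for all $\sigma,\tau\in F$. *Categories.* Let $G$ act on $\mathrm{Rep}(A)$ by the tensor functors $F_\sigma(V)=V$ with $a\cdot v=\sigma_*(a)v$, the tensor structure $F_\sigma(V)\otimes F_\sigma(W)\to F_\sigma(V\otimes W)$ being the action of $J_\sigma$, and by $\gamma_{\sigma,\tau}=\theta_{\sigma,\tau}^{-1}\cdot:F_\sigma F_\tau\to F_{\sigma\tau}$. Let ${}_K\mathcal M$ be the category of left $K$-modules, with $X\in\mathrm{Rep}(A)$ acting by $X\otimes M$ (via $\lambda$) and associativity isomorphism given by $\Phi_\lambda$; the same letter $\mathcal M$ stands either for finite-dimensional modules throughout or for all modules throughout. A module category is a $k$-linear abelian category with a $k$-bilinear biexact action, associative and unital up to coherent isomorphism. Let $A\#G$ be $A\otimes kG$ with $(x\#\sigma)(y\#\tau)=x\sigma_*(y)\theta_{\sigma,\tau}\#\sigma\tau$,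 $\Delta(x\#\sigma)=x_{(1)}J^1_\sigma\#\sigma\otimes x_{(2)}J^2_\sigma\#\sigma$, $\varepsilon(x\#\sigma)=\varepsilon(x)$ and associator $\Phi^1\#1\otimes\Phi^2\#1\otimes\Phi^3\#1$ (a quasi-bialgebra), and let $K\#F$ be the left $A\#G$-comodule algebra $K\otimes kF$ with $(x\#\sigma)(y\#\tau)=x\bar\sigma(y)\bar\theta_{\sigma,\tau}\#\sigma\tau$, coaction $x\#\sigma\mapsto x_{(-1)}\bar J^1_\sigma\#\sigma\otimes x_{(0)}\bar J^2_\sigma\#\sigma$ and associator $\Phi^1_\lambda\#1\otimes\Phi^2_\lambda\#1\otimes\Phi^3_\lambda\#1$. An object of $\mathrm{Rep}(A)^G$ is $(X,u)$ with isomorphisms $u_\sigma:F_\sigma(X)\to X$ such that $u_{\sigma\tau}\gamma_{\sigma,\tau}=u_\sigma F_\sigma(u_\tau)$. It is a representation of $A\#G$ through $(a\#\sigma)x=a\,u_\sigma^{-1}(x)$; this is a monoidal functor $\mathrm{Rep}(A)^G\to\mathrm{Rep}(A\#G)$, through which $\mathrm{Rep}(A)^G$ acts on ${}_{K\#F}\mathcal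 M$. Then: 1. ${}_K\mathcal M$ is a $\mathrm{Rep}(A)$-module category, and it is $F$-equivariant, as follows. Let $U_\rho(M)=M$ with $x\cdot m=\bar\rho(x)m$. The maps $c^\rho_{X,M}=\bar J_\rho^{-1}\cdot:U_\rho(X\otimes M)\to F_\rho(X)\otimes U_\rho(M)$ make $U_\rho$ a module functor from ${}_K\mathcal M$ to its twist by $F_\rho$, and with the isomorphisms of module functors $\mu_{\sigma,\tau}=\bar\theta_{\sigma,\tau}^{-1}\cdot:U_\sigma U_\tau\to U_{\sigma\tau}$ (and a unit isomorphism $\mathrm{id}\cong U_1$) the family $U$ is monoidal. 2. Let $({}_K\mathcal M)^F$ be the category of pairs $(M,v)$ with isomorphisms $v_\sigma:U_\sigma(M)\to M$, $\sigma\in F$, such that $v_{\sigma\tau}\mu_{\sigma,\tau}=v_\sigma U_\sigma(v_\tau)$, on which $(X,u)\in\mathrm{Rep}(A)^G$ acts by $X\otimes M$ with the isomorphisms $(u_\sigma\otimes v_\sigma)c^\sigma_{X,M}$. Then $({}_K\mathcal M)^F$ and ${}_{K\#F}\mathcal M$ are $\mathrm{Rep}(A)^G$-module categories, and they are equivalent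 as $\mathrm{Rep}(A)^G$-module categories. -/

import Mathlib

open CategoryTheory MonoidalCategory
open scoped TensorProduct MonoidalLeftAction

universe u

namespace QuasiHopf

/-! ### Quasi-Hopf algebras and their comodule algebras -/

section TensorMaps

variable {k : Type*} [Field k] {A B C R M N P : Type*}
  [Ring A] [Algebra k A] [Ring B] [Algebra k B] [Ring C] [Algebra k C] [Ring R] [Algebra k R]
  [AddCommGroup M] [Module k M] [AddCommGroup N] [Module k N] [AddCommGroup P] [Module k P]

/-- `f ⊗ id`, read in right-bracketed tensor products: for `f : A → B ⊗ C` this is the algebra map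
`A ⊗ R → B ⊗ (C ⊗ R)`. -/
noncomputable def splitLeft (f : A →ₐ[k] B ⊗[k] C) : A ⊗[k] R →ₐ[k] B ⊗[k] (C ⊗[k] R) :=
  (Algebra.TensorProduct.assoc k k k B C R).toAlgHom.comp
    (Algebra.TensorProduct.map f (AlgHom.id k R))

/-- `f ⊗ id : A ⊗ R → k ⊗ R = R`. -/
noncomputable def evalLeft (f : A →ₐ[k] k) : A ⊗[k] R →ₐ[k] R :=
  (Algebra.TensorProduct.lid k R).toAlgHom.comp (Algebra.TensorProduct.map f (AlgHom.id k R))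

/-- `id ⊗ f : R ⊗ A → R ⊗ k = R`. -/
noncomputable def evalRight (f : A →ₐ[k] k) : R ⊗[k] A →ₐ[k] R :=
  (Algebra.TensorProduct.rid k k R).toAlgHom.comp (Algebra.TensorProduct.map (AlgHom.id k R) f)

/-- `id ⊗ f : R ⊗ A → R ⊗ B`. -/
noncomputable abbrev onRight (f : A →ₐ[k] B) : R ⊗[k] A →ₐ[k] R ⊗[k] B :=
  Algebra.TensorProduct.map (AlgHom.id k R) f

/-- The linear map `a ⊗ b ↦ f a * x * g b`. -/
noncomputable def sandwich {Q : Type*} [AddCommGroup Q] [Module k Q] (f : M →ₗ[k] A) (x : A)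
    (g : Q →ₗ[k] A) : M ⊗[k] Q →ₗ[k] A :=
  LinearMap.mul' k A ∘ₗ TensorProduct.map (LinearMap.mulRight k x ∘ₗ f) g

end TensorMaps

/-- A quasi-bialgebra over `k`: an algebra `A` with algebra maps `Δ`, `ε` and an invertible
associator `Φ ∈ A ⊗ A ⊗ A`. -/
class QuasiBialgebra (k A : Type*) [Field k] [Ring A] [Algebra k A] where
  Δ : A →ₐ[k] A ⊗[k] A
  ε : A →ₐ[k] k
  Φ : (A ⊗[k] (A ⊗[k] A))ˣ
  /-- `Φ (Δ ⊗ id)(Δ h) = (id ⊗ Δ)(Δ h) Φ` -/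
  quasi_coassoc (h : A) : (Φ : A ⊗[k] (A ⊗[k] A)) * splitLeft Δ (Δ h) = onRight Δ (Δ h) * Φ
  counit_right (h : A) : evalRight ε (Δ h) = h
  counit_left (h : A) : evalLeft ε (Δ h) = h
  /-- `(1 ⊗ Φ) (id ⊗ Δ ⊗ id)(Φ) (Φ ⊗ 1) = (id ⊗ id ⊗ Δ)(Φ) (Δ ⊗ id ⊗ id)(Φ)` -/
  pentagon : (1 : A) ⊗ₜ[k] (Φ : A ⊗[k] (A ⊗[k] A)) * onRight (splitLeft Δ) (Φ : A ⊗[k] (A ⊗[k] A)) *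
      onRight (onRight Algebra.TensorProduct.includeLeft) (Φ : A ⊗[k] (A ⊗[k] A)) =
    onRight (onRight Δ) (Φ : A ⊗[k] (A ⊗[k] A)) * splitLeft Δ (Φ : A ⊗[k] (A ⊗[k] A))
  /-- `(id ⊗ ε ⊗ id)(Φ) = 1` -/
  counit_middle : onRight (evalLeft ε) (Φ : A ⊗[k] (A ⊗[k] A)) = 1

/-- A quasi-Hopf algebra: a quasi-bialgebra with an antipode `(S, α, β)`. -/
class QuasiHopfAlgebra (k A : Type*) [Field k] [Ring A] [Algebra k A] extends
    QuasiBialgebra k A where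
  S : A →ₐ[k] Aᵐᵒᵖ
  α : A
  β : A
  /-- `S(h₁) α h₂ = ε(h) α` -/
  antipode_left (h : A) :
    sandwich ((MulOpposite.opLinearEquiv k).symm.toLinearMap ∘ₗ S.toLinearMap) α LinearMap.id
      (Δ h) = ε h • α
  /-- `h₁ β S(h₂) = ε(h) β` -/
  antipode_right (h : A) :
    sandwich LinearMap.id β ((MulOpposite.opLinearEquiv k).symm.toLinearMap ∘ₗ S.toLinearMap)
      (Δ h) = ε h • β
  /-- `Φ¹ β S(Φ²) α Φ³ = 1` -/
  antipode_associator :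
    sandwich LinearMap.id β
      (sandwich ((MulOpposite.opLinearEquiv k).symm.toLinearMap ∘ₗ S.toLinearMap) α LinearMap.id)
      (Φ : A ⊗[k] (A ⊗[k] A)) = 1
  /-- `S(Φ⁻¹) α Φ⁻² β S(Φ⁻³) = 1` -/
  antipode_associator_inv :
    sandwich ((MulOpposite.opLinearEquiv k).symm.toLinearMap ∘ₗ S.toLinearMap) α
      (sandwich LinearMap.id β
        ((MulOpposite.opLinearEquiv k).symm.toLinearMap ∘ₗ S.toLinearMap))
      (↑Φ⁻¹ : A ⊗[k] (A ⊗[k] A)) = 1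

open QuasiBialgebra (Δ ε Φ)

/-- A left comodule algebra `(K, λ, Φ_λ)` over a quasi-bialgebra `A`. -/
class ComoduleAlgebra (k A K : Type*) [Field k] [Ring A] [Algebra k A] [QuasiBialgebra k A]
    [Ring K] [Algebra k K] where
  coact : K →ₐ[k] A ⊗[k] K
  assoc : (A ⊗[k] (A ⊗[k] K))ˣ
  /-- `(1 ⊗ Φ_λ) (id ⊗ Δ ⊗ id)(Φ_λ) (Φ ⊗ 1) = (id ⊗ id ⊗ λ)(Φ_λ) (Δ ⊗ id ⊗ id)(Φ_λ)` -/
  pentagon : (1 : A) ⊗ₜ[k] (assoc : A ⊗[k] (A ⊗[k] K)) *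
        onRight (splitLeft Δ) (assoc : A ⊗[k] (A ⊗[k] K)) *
      onRight (onRight Algebra.TensorProduct.includeLeft) (Φ : (A ⊗[k] (A ⊗[k] A))ˣ).val =
    onRight (onRight coact) (assoc : A ⊗[k] (A ⊗[k] K)) *
      splitLeft Δ (assoc : A ⊗[k] (A ⊗[k] K))
  /-- `(id ⊗ ε ⊗ id)(Φ_λ) = 1` -/
  counit_middle : onRight (evalLeft (ε : A →ₐ[k] k)) (assoc : A ⊗[k] (A ⊗[k] K)) = 1
  /-- `Φ_λ (Δ ⊗ id)(λ x) = (id ⊗ λ)(λ x) Φ_λ` -/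
  quasi_coassoc (x : K) :
    (assoc : A ⊗[k] (A ⊗[k] K)) * splitLeft Δ (coact x) = onRight coact (coact x) * assoc
  /-- `(ε ⊗ id)(λ x) = x` -/
  counit (x : K) : evalLeft (ε : A →ₐ[k] k) (coact x) = x

/-! ### Crossed systems and crossed products -/

/-- Data `(σ_*, θ_{σ,τ})` of a crossed product of an algebra `R` with a group `S`: automorphisms
`σ_*` of `R`, composing up to the invertible elements `θ_{σ,τ}`. -/
structure FactorSystem (k R S : Type*) [Field k] [Ring R] [Algebra k R] [Group S] where
  act : S → R →ₐ[k] R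
  act_bijective (σ : S) : Function.Bijective (act σ)
  θ : S → S → Rˣ
  act_one : act 1 = AlgHom.id k R
  θ_mul_act (σ τ : S) (x : R) : (θ σ τ : R) * act (σ * τ) x = act σ (act τ x) * θ σ τ
  cocycle (σ τ ρ : S) : (θ σ τ : R) * θ (σ * τ) ρ = act σ (θ τ ρ) * θ σ (τ * ρ)
  θ_one_left (σ : S) : θ 1 σ = 1
  θ_one_right (σ : S) : θ σ 1 = 1

namespace FactorSystem

variable {k R S : Type*} [Field k] [Ring R] [Algebra k R] [Group S] (c : FactorSystem k R S)

/-- The condition `θ_{σ,τ} = θ_{τ,σ}`. -/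
def Symmetric : Prop := ∀ σ τ, c.θ σ τ = c.θ τ σ

/-- The product `(x # σ)(y # τ) = x σ_*(y) θ_{σ,τ} # στ` on `R ⊗ kS`, where `x # σ` is the finitely
supported function with value `x` at `σ`. -/
noncomputable def mulHom : (S →₀ R) →ₗ[k] (S →₀ R) →ₗ[k] (S →₀ R) :=
  Finsupp.lsum k fun σ => LinearMap.flip <| Finsupp.lsum k fun τ =>
    LinearMap.mk₂ k (fun y x => Finsupp.single (σ * τ) (x * c.act σ y * c.θ σ τ))
      (by intros; simp [mul_add, add_mul])
      (by intros; simp only [map_smul, mul_smul_comm, smul_mul_assoc, Finsupp.smul_single])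
      (by intros; simp [add_mul])
      (by intros; simp only [smul_mul_assoc, Finsupp.smul_single])

theorem mulHom_single (σ τ : S) (x y : R) :
    c.mulHom (Finsupp.single σ x) (Finsupp.single τ y) =
      Finsupp.single (σ * τ) (x * c.act σ y * c.θ σ τ) := by
  simp [mulHom]

theorem mulHom_assoc (x y z : S →₀ R) :
    c.mulHom (c.mulHom x y) z = c.mulHom x (c.mulHom y z) := by
  induction x using Finsupp.induction_linear with
  | zero => simp
  | add a b ha hb => simp only [map_add, LinearMap.add_apply, ha, hb]
  | single σ x =>
  induction y using Finsupp.induction_linear with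
  | zero => simp
  | add a b ha hb => simp only [map_add, LinearMap.add_apply, ha, hb]
  | single τ y =>
  induction z using Finsupp.induction_linear with
  | zero => simp
  | add a b ha hb => simp only [map_add, ha, hb]
  | single ρ z =>
  simp only [mulHom_single, mul_assoc, map_mul]
  congr 3
  rw [← c.cocycle, ← mul_assoc, c.θ_mul_act, mul_assoc]

/-- The crossed product `R # S`: the vector space `R ⊗ kS` with the product
`(x # σ)(y # τ) = x σ_*(y) θ_{σ,τ} # στ`. -/
def Crossed (_ : FactorSystem k R S) : Type _ := S →₀ R

noncomputable instance : Ring c.Crossed where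
  __ := (inferInstanceAs (AddCommGroup (S →₀ R)) : AddCommGroup c.Crossed)
  mul x y := c.mulHom x y
  one := (Finsupp.single 1 1 : S →₀ R)
  left_distrib x y z := map_add (c.mulHom x) y z
  right_distrib x y z := LinearMap.map_add₂ c.mulHom x y z
  zero_mul a := LinearMap.map_zero₂ c.mulHom a
  mul_zero a := map_zero (c.mulHom a)
  mul_assoc := c.mulHom_assoc
  one_mul x := by
    change c.mulHom (Finsupp.single 1 1) x = x
    induction x using Finsupp.induction_linear with
    | zero => simp
    | single σ x => simp [mulHom_single, c.act_one, c.θ_one_left]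
    | add a b ha hb => rw [map_add, ha, hb]
  mul_one x := by
    change c.mulHom x (Finsupp.single 1 1) = x
    induction x using Finsupp.induction_linear with
    | zero => simp
    | single σ x => simp [mulHom_single, c.θ_one_right]
    | add a b ha hb => rw [map_add, LinearMap.add_apply, ha, hb]

noncomputable instance : Algebra k c.Crossed :=
  letI : Module k c.Crossed := inferInstanceAs (Module k (S →₀ R))
  Algebra.ofModule (fun r x y => LinearMap.map_smul₂ c.mulHom r x y)
    (fun r x y => map_smul (c.mulHom x) r y)

/-- `c.incl σ x` is the element `x # σ`. -/
noncomputable def incl (σ : S) : R →ₗ[k] c.Crossed where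
  toFun x := (Finsupp.single σ x : S →₀ R)
  map_add' x y := Finsupp.single_add σ x y
  map_smul' r x := (Finsupp.smul_single r σ x).symm

/-- The linear map `∑ x_σ # σ ↦ ∑ f_σ(x_σ)`. -/
noncomputable def sum {M : Type*} [AddCommGroup M] [Module k M] (f : S → R →ₗ[k] M) :
    c.Crossed →ₗ[k] M where
  toFun := Finsupp.lsum k f
  map_add' := (Finsupp.lsum k f).map_add
  map_smul' := (Finsupp.lsum k f).map_smul

@[simp] theorem sum_incl {M : Type*} [AddCommGroup M] [Module k M] (f : S → R →ₗ[k] M) (σ : S)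
    (x : R) : c.sum f (c.incl σ x) = f σ x :=
  Finsupp.sum_single_index (map_zero (f σ))

variable {c} in
@[elab_as_elim]
theorem induction {p : c.Crossed → Prop} (z : c.Crossed) (h0 : p 0)
    (h1 : ∀ σ x, p (c.incl σ x)) (h2 : ∀ a b, p a → p b → p (a + b)) : p z :=
  Finsupp.induction_linear z h0 h2 h1

variable {c} in
theorem hom_ext {M : Type*} [AddCommGroup M] [Module k M] {f g : c.Crossed →ₗ[k] M}
    (h : ∀ σ x, f (c.incl σ x) = g (c.incl σ x)) : f = g := by
  ext z
  induction z using induction with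
  | h0 => simp
  | h1 σ x => exact h σ x
  | h2 a b ha hb => simp only [map_add, ha, hb]

theorem one_def : (1 : c.Crossed) = c.incl 1 1 := rfl

theorem incl_mul_incl (σ τ : S) (x y : R) :
    c.incl σ x * c.incl τ y = c.incl (σ * τ) (x * c.act σ y * c.θ σ τ) :=
  c.mulHom_single σ τ x y

/-- The algebra map `x ↦ x # 1`. -/
noncomputable def inclOne : R →ₐ[k] c.Crossed :=
  AlgHom.ofLinearMap (c.incl 1) rfl fun x y => by
    simp [incl_mul_incl, c.act_one, c.θ_one_left]

theorem inclOne_apply (x : R) : c.inclOne x = c.incl 1 x := rfl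

theorem inclOne_mul_incl (σ : S) (x y : R) : c.inclOne x * c.incl σ y = c.incl σ (x * y) := by
  simp [inclOne_apply, incl_mul_incl, c.act_one, c.θ_one_left]

/-- The algebra map `x # σ ↦ f(x) u_σ`. -/
noncomputable def lift {B : Type*} [Ring B] [Algebra k B] (f : R →ₐ[k] B) (u : S → B)
    (h1 : u 1 = 1) (h2 : ∀ σ y, u σ * f y = f (c.act σ y) * u σ)
    (h3 : ∀ σ τ, u σ * u τ = f (c.θ σ τ) * u (σ * τ)) : c.Crossed →ₐ[k] B :=
  AlgHom.ofLinearMap (c.sum fun σ => LinearMap.mulRight k (u σ) ∘ₗ f.toLinearMap)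
    (by simp [one_def, h1]) fun x y => by
    induction x using induction with
    | h0 => simp
    | h2 a b ha hb => simp only [add_mul, map_add, ha, hb]
    | h1 σ x =>
    induction y using induction with
    | h0 => simp
    | h2 a b ha hb => simp only [mul_add, map_add, ha, hb]
    | h1 τ y =>
    simp only [incl_mul_incl, sum_incl, LinearMap.comp_apply, AlgHom.toLinearMap_apply,
      LinearMap.mulRight_apply, map_mul, mul_assoc]
    rw [← h3, ← mul_assoc (u σ), h2]
    simp only [mul_assoc]

@[simp] theorem lift_incl {B : Type*} [Ring B] [Algebra k B] (f : R →ₐ[k] B) (u : S → B)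
    (h1 h2 h3) (σ : S) (x : R) : c.lift f u h1 h2 h3 (c.incl σ x) = f x * u σ := by
  simp [lift]

variable {c} in
theorem algHom_ext {B : Type*} [Ring B] [Algebra k B] {f g : c.Crossed →ₐ[k] B}
    (h : ∀ σ x, f (c.incl σ x) = g (c.incl σ x)) : f = g :=
  AlgHom.toLinearMap_injective (hom_ext h)

end FactorSystem

/-- A `G`-crossed system `(σ_*, J_σ, θ_{σ,τ})` over a quasi-bialgebra `A`: each `(σ_*, J_σ)` is a
twisted automorphism of `A`. -/
structure CrossedSystem (k A G : Type*) [Field k] [Ring A] [Algebra k A] [QuasiBialgebra k A]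
    [Group G] extends FactorSystem k A G where
  J : G → (A ⊗[k] A)ˣ
  /-- `Φ (Δ ⊗ id)(J_σ) (J_σ ⊗ 1) = (id ⊗ Δ)(J_σ) (1 ⊗ J_σ) (σ_* ⊗ σ_* ⊗ σ_*)(Φ)` -/
  twist (σ : G) : (Φ : (A ⊗[k] (A ⊗[k] A))ˣ).val * splitLeft Δ (J σ : A ⊗[k] A) *
      onRight Algebra.TensorProduct.includeLeft (J σ : A ⊗[k] A) =
    onRight Δ (J σ : A ⊗[k] A) * (1 : A) ⊗ₜ[k] (J σ : A ⊗[k] A) *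
      Algebra.TensorProduct.map (act σ) (Algebra.TensorProduct.map (act σ) (act σ))
        (Φ : (A ⊗[k] (A ⊗[k] A))ˣ).val
  counit_left (σ : G) : evalLeft ε (J σ : A ⊗[k] A) = 1
  counit_right (σ : G) : evalRight ε (J σ : A ⊗[k] A) = 1
  counit_act (σ : G) (a : A) : (ε (act σ a) : k) = ε a
  /-- `Δ(σ_*(a)) J_σ = J_σ (σ_* ⊗ σ_*)(Δ(a))` -/
  comul_act (σ : G) (a : A) : Δ (act σ a) * (J σ : A ⊗[k] A) =
    (J σ).val * Algebra.TensorProduct.map (act σ) (act σ) (Δ a)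
  counit_θ (σ τ : G) : (ε (θ σ τ : A) : k) = 1
  J_one : J 1 = 1
  /-- `Δ(θ_{σ,τ}) J_{στ} = J_σ (σ_* ⊗ σ_*)(J_τ) (θ_{σ,τ} ⊗ θ_{σ,τ})` -/
  comul_θ (σ τ : G) : Δ (θ σ τ : A) * (J (σ * τ) : A ⊗[k] A) =
    (J σ).val * Algebra.TensorProduct.map (act σ) (act σ) (J τ : A ⊗[k] A) *
      (θ σ τ : A) ⊗ₜ[k] (θ σ τ : A)

/-- An `F`-crossed system `(σ̄, J̄_σ, θ̄_{σ,τ})` for a left `A`-comodule algebra `K`, compatible with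
the `G`-crossed system `T` over `A`, where `F` is a subgroup of `G`: each `(σ̄, J̄_σ)` is a
`(σ_*, J_σ)`-twisted automorphism of `K`. -/
structure ComoduleCrossedSystem {k A G : Type*} [Field k] [Ring A] [Algebra k A]
    [QuasiBialgebra k A] [Group G] (T : CrossedSystem k A G)
    (K : Type*) [Ring K] [Algebra k K] [ComoduleAlgebra k A K] (F : Subgroup G)
    extends FactorSystem k K F where
  J : F → (A ⊗[k] K)ˣ
  counit_left (σ : F) : evalLeft ε (J σ : A ⊗[k] K) = 1
  /-- `Φ_λ (Δ ⊗ id)(J̄_σ) (J_σ ⊗ 1) = (id ⊗ λ)(J̄_σ) (1 ⊗ J̄_σ) (σ_* ⊗ σ_* ⊗ σ̄)(Φ_λ)` -/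
  twist (σ : F) : (ComoduleAlgebra.assoc : (A ⊗[k] (A ⊗[k] K))ˣ).val *
        splitLeft Δ (J σ : A ⊗[k] K) *
      onRight Algebra.TensorProduct.includeLeft (T.J σ : A ⊗[k] A) =
    onRight ComoduleAlgebra.coact (J σ : A ⊗[k] K) * (1 : A) ⊗ₜ[k] (J σ : A ⊗[k] K) *
      Algebra.TensorProduct.map (T.act σ) (Algebra.TensorProduct.map (T.act σ) (act σ))
        (ComoduleAlgebra.assoc : (A ⊗[k] (A ⊗[k] K))ˣ).val
  /-- `λ(σ̄(x)) J̄_σ = J̄_σ (σ_* ⊗ σ̄)(λ(x))` -/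
  coact_act (σ : F) (x : K) : ComoduleAlgebra.coact (act σ x) * (J σ : A ⊗[k] K) =
    (J σ).val * Algebra.TensorProduct.map (T.act σ) (act σ) (ComoduleAlgebra.coact x)
  J_one : J 1 = 1
  /-- `λ(θ̄_{σ,τ}) J̄_{στ} = J̄_σ (σ_* ⊗ σ̄)(J̄_τ) (θ_{σ,τ} ⊗ θ̄_{σ,τ})` -/
  coact_θ (σ τ : F) : ComoduleAlgebra.coact (θ σ τ : K) * (J (σ * τ) : A ⊗[k] K) =
    (J σ).val * Algebra.TensorProduct.map (T.act σ) (act σ) (J τ : A ⊗[k] K) *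
      (T.θ σ τ : A) ⊗ₜ[k] (θ σ τ : K)

/-! ### The quasi-bialgebra `A # G` and the comodule algebra `K # F` -/

section Crossed

variable {k A K G F : Type*} [Field k] [Ring A] [Algebra k A] [Ring K] [Algebra k K]
  [Group G] [Group F]

/-- The conditions which make `x # σ ↦ x₍₋₁₎ J_σ¹ # σ ⊗ x₍₀₎ J_σ² # σ` an algebra map. -/
structure IsCoactionDatum (c : FactorSystem k A G) (d : FactorSystem k K F) (j : F →* G)
    (coact : K →ₐ[k] A ⊗[k] K) (J : F → (A ⊗[k] K)ˣ) : Prop where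
  J_one : J 1 = 1
  coact_act (σ : F) (x : K) : coact (d.act σ x) * (J σ : A ⊗[k] K) =
    (J σ).val * Algebra.TensorProduct.map (c.act (j σ)) (d.act σ) (coact x)
  coact_θ (σ τ : F) : coact (d.θ σ τ : K) * (J (σ * τ) : A ⊗[k] K) =
    (J σ).val * Algebra.TensorProduct.map (c.act (j σ)) (d.act σ) (J τ : A ⊗[k] K) *
      (c.θ (j σ) (j τ) : A) ⊗ₜ[k] (d.θ σ τ : K)

variable (c : FactorSystem k A G) (d : FactorSystem k K F) (j : F →* G)

/-- `a ⊗ x ↦ (a # σ) ⊗ (x # σ)` -/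
noncomputable def incl₂ (σ : F) : A ⊗[k] K →ₗ[k] c.Crossed ⊗[k] d.Crossed :=
  TensorProduct.map (c.incl (j σ)) (d.incl σ)

/-- `a ⊗ b ⊗ x ↦ (a # σ) ⊗ (b # σ) ⊗ (x # σ)` -/
noncomputable def incl₃ (σ : F) :
    A ⊗[k] (A ⊗[k] K) →ₗ[k] c.Crossed ⊗[k] (c.Crossed ⊗[k] d.Crossed) :=
  TensorProduct.map (c.incl (j σ)) (incl₂ c d j σ)

/-- `a ⊗ x ↦ (a # 1) ⊗ (x # 1)` as an algebra map -/
noncomputable def inclOne₂ : A ⊗[k] K →ₐ[k] c.Crossed ⊗[k] d.Crossed :=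
  Algebra.TensorProduct.map c.inclOne d.inclOne

/-- `a ⊗ b ⊗ x ↦ (a # 1) ⊗ (b # 1) ⊗ (x # 1)` as an algebra map -/
noncomputable def inclOne₃ :
    A ⊗[k] (A ⊗[k] K) →ₐ[k] c.Crossed ⊗[k] (c.Crossed ⊗[k] d.Crossed) :=
  Algebra.TensorProduct.map c.inclOne (inclOne₂ c d)

theorem incl₂_mul (σ τ : F) (s t : A ⊗[k] K) :
    incl₂ c d j σ s * incl₂ c d j τ t = incl₂ c d j (σ * τ)
      (s * Algebra.TensorProduct.map (c.act (j σ)) (d.act σ) t *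
        (c.θ (j σ) (j τ) : A) ⊗ₜ[k] (d.θ σ τ : K)) := by
  induction s with
  | zero => simp
  | add a b ha hb => simp only [add_mul, map_add, ha, hb]
  | tmul a x =>
  induction t with
  | zero => simp
  | add a b ha hb => simp only [add_mul, mul_add, map_add, ha, hb]
  | tmul b y => simp [incl₂, FactorSystem.incl_mul_incl]

theorem inclOne₂_mul (σ : F) (s t : A ⊗[k] K) :
    inclOne₂ c d s * incl₂ c d j σ t = incl₂ c d j σ (s * t) := by
  induction s with
  | zero => simp
  | add a b ha hb => simp only [add_mul, map_add, ha, hb]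
  | tmul a x =>
  induction t with
  | zero => simp
  | add a b ha hb => simp only [mul_add, map_add, ha, hb]
  | tmul b y => simp [incl₂, inclOne₂, FactorSystem.inclOne_mul_incl]

theorem FactorSystem.incl_mul_inclOne (σ : F) (x y : K) :
    d.incl σ x * d.inclOne y = d.incl σ (x * d.act σ y) := by
  simp [FactorSystem.inclOne_apply, FactorSystem.incl_mul_incl, d.θ_one_right]

theorem incl₂_mul_inclOne₂ (σ : F) (s t : A ⊗[k] K) :
    incl₂ c d j σ s * inclOne₂ c d t =
      incl₂ c d j σ (s * Algebra.TensorProduct.map (c.act (j σ)) (d.act σ) t) := by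
  induction s with
  | zero => simp
  | add a b ha hb => simp only [add_mul, map_add, ha, hb]
  | tmul a x =>
  induction t with
  | zero => simp
  | add a b ha hb => simp only [mul_add, map_add, ha, hb]
  | tmul b y => simp [incl₂, inclOne₂, FactorSystem.incl_mul_inclOne]

theorem inclOne₃_mul (σ : F) (s t : A ⊗[k] (A ⊗[k] K)) :
    inclOne₃ c d s * incl₃ c d j σ t = incl₃ c d j σ (s * t) := by
  induction s with
  | zero => simp
  | add a b ha hb => simp only [add_mul, map_add, ha, hb]
  | tmul a x =>
  induction t with
  | zero => simp
  | add a b ha hb => simp only [mul_add, map_add, ha, hb]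
  | tmul b y => simp [incl₃, inclOne₃, FactorSystem.inclOne_mul_incl, inclOne₂_mul]

theorem incl₃_mul_inclOne₃ (σ : F) (s t : A ⊗[k] (A ⊗[k] K)) :
    incl₃ c d j σ s * inclOne₃ c d t =
      incl₃ c d j σ (s * Algebra.TensorProduct.map (c.act (j σ))
        (Algebra.TensorProduct.map (c.act (j σ)) (d.act σ)) t) := by
  induction s with
  | zero => simp
  | add a b ha hb => simp only [add_mul, map_add, ha, hb]
  | tmul a x =>
  induction t with
  | zero => simp
  | add a b ha hb => simp only [mul_add, map_add, ha, hb]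
  | tmul b y => simp [incl₃, inclOne₃, FactorSystem.incl_mul_inclOne, incl₂_mul_inclOne₂]

variable {c d j}

/-- The algebra map `x # σ ↦ x₍₋₁₎ J_σ¹ # σ ⊗ x₍₀₎ J_σ² # σ`. -/
noncomputable def crossedCoact {coact : K →ₐ[k] A ⊗[k] K} {J : F → (A ⊗[k] K)ˣ}
    (h : IsCoactionDatum c d j coact J) : d.Crossed →ₐ[k] c.Crossed ⊗[k] d.Crossed :=
  d.lift ((inclOne₂ c d).comp coact) (fun σ => incl₂ c d j σ (J σ))
    (by
      rw [h.J_one, Units.val_one, Algebra.TensorProduct.one_def]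
      simp only [incl₂, TensorProduct.map_tmul, map_one]
      rfl)
    (fun σ y => by
      rw [AlgHom.comp_apply, incl₂_mul_inclOne₂, AlgHom.comp_apply, inclOne₂_mul, h.coact_act])
    (fun σ τ => by
      rw [incl₂_mul, AlgHom.comp_apply, inclOne₂_mul, h.coact_θ])

theorem crossedCoact_incl {coact : K →ₐ[k] A ⊗[k] K} {J : F → (A ⊗[k] K)ˣ}
    (h : IsCoactionDatum c d j coact J) (σ : F) (x : K) :
    crossedCoact h (d.incl σ x) = incl₂ c d j σ (coact x * J σ) := by
  rw [crossedCoact, FactorSystem.lift_incl, AlgHom.comp_apply, inclOne₂_mul]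

theorem crossedCoact_inclOne {coact : K →ₐ[k] A ⊗[k] K} {J : F → (A ⊗[k] K)ˣ}
    (h : IsCoactionDatum c d j coact J) (x : K) :
    crossedCoact h (d.inclOne x) = inclOne₂ c d (coact x) := by
  rw [FactorSystem.inclOne_apply, crossedCoact_incl, h.J_one, Units.val_one, mul_one]
  simp only [incl₂, map_one]
  rfl

theorem onRight_crossedCoact_incl₂ {coact : K →ₐ[k] A ⊗[k] K} {J : F → (A ⊗[k] K)ˣ}
    (h : IsCoactionDatum c d j coact J) (σ : F) (s : A ⊗[k] K) :
    onRight (crossedCoact h) (incl₂ c d j σ s) =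
      incl₃ c d j σ (onRight coact s * (1 : A) ⊗ₜ[k] (J σ : A ⊗[k] K)) := by
  induction s with
  | zero => simp
  | add a b ha hb => simp only [add_mul, map_add, ha, hb]
  | tmul a x => simp [incl₃, incl₂, crossedCoact_incl h]

theorem onRight_crossedCoact_inclOne₂ {coact : K →ₐ[k] A ⊗[k] K} {J : F → (A ⊗[k] K)ˣ}
    (h : IsCoactionDatum c d j coact J) (s : A ⊗[k] K) :
    onRight (crossedCoact h) (inclOne₂ c d s) = inclOne₃ c d (onRight coact s) := by
  induction s with
  | zero => simp
  | add a b ha hb => simp only [map_add, ha, hb]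
  | tmul a x => simp [inclOne₃, inclOne₂, crossedCoact_inclOne h]

theorem assoc_incl₂ (σ : F) (s : A ⊗[k] A) (x : K) :
    Algebra.TensorProduct.assoc k k k c.Crossed c.Crossed d.Crossed
        (incl₂ c c (MonoidHom.id G) (j σ) s ⊗ₜ[k] d.incl σ x) =
      incl₃ c d j σ (Algebra.TensorProduct.assoc k k k A A K (s ⊗ₜ x)) := by
  induction s with
  | zero => simp
  | add a b ha hb => simp only [TensorProduct.add_tmul, map_add, ha, hb]
  | tmul a b => simp [incl₃, incl₂]

theorem assoc_inclOne₂ (s : A ⊗[k] A) (x : K) :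
    Algebra.TensorProduct.assoc k k k c.Crossed c.Crossed d.Crossed
        (inclOne₂ c c s ⊗ₜ[k] d.inclOne x) =
      inclOne₃ c d (Algebra.TensorProduct.assoc k k k A A K (s ⊗ₜ x)) := by
  induction s with
  | zero => simp
  | add a b ha hb => simp only [TensorProduct.add_tmul, map_add, ha, hb]
  | tmul a b => simp [inclOne₃, inclOne₂]

theorem assoc_mul_tmul_one (s t : A ⊗[k] A) (x : K) :
    Algebra.TensorProduct.assoc k k k A A K ((s * t) ⊗ₜ x) =
      Algebra.TensorProduct.assoc k k k A A K (s ⊗ₜ x) *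
        onRight (Algebra.TensorProduct.includeLeft : A →ₐ[k] A ⊗[k] K) t := by
  have : (s * t) ⊗ₜ[k] x = (s ⊗ₜ[k] x) * (t ⊗ₜ[k] (1 : K)) := by simp
  rw [this, map_mul]
  congr 1
  induction t with
  | zero => simp
  | add a b ha hb =>
    have ha' := ha (by simp)
    have hb' := hb (by simp)
    simp only [TensorProduct.add_tmul, map_add, ha', hb']
  | tmul a b => simp

theorem splitLeft_crossedCoact_incl₂ {comul : A →ₐ[k] A ⊗[k] A} {J : G → (A ⊗[k] A)ˣ}
    (h : IsCoactionDatum c c (MonoidHom.id G) comul J) (σ : F) (s : A ⊗[k] K) :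
    splitLeft (crossedCoact h) (incl₂ c d j σ s) =
      incl₃ c d j σ (splitLeft comul s *
        onRight Algebra.TensorProduct.includeLeft (J (j σ) : A ⊗[k] A)) := by
  induction s with
  | zero => simp
  | add a b ha hb => simp only [add_mul, map_add, ha, hb]
  | tmul a x =>
    have e : splitLeft comul (a ⊗ₜ[k] x) =
      Algebra.TensorProduct.assoc k k k A A K (comul a ⊗ₜ x) := by simp [splitLeft]
    rw [e, ← assoc_mul_tmul_one, ← assoc_incl₂, ← crossedCoact_incl h]
    simp [splitLeft, incl₂]

theorem splitLeft_crossedCoact_inclOne₂ {comul : A →ₐ[k] A ⊗[k] A} {J : G → (A ⊗[k] A)ˣ}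
    (h : IsCoactionDatum c c (MonoidHom.id G) comul J) (s : A ⊗[k] K) :
    splitLeft (crossedCoact h) (inclOne₂ c d s) = inclOne₃ c d (splitLeft comul s) := by
  induction s with
  | zero => simp
  | add a b ha hb => simp only [map_add, ha, hb]
  | tmul a x =>
    have e : splitLeft comul (a ⊗ₜ[k] x) =
      Algebra.TensorProduct.assoc k k k A A K (comul a ⊗ₜ x) := by simp [splitLeft]
    rw [e, ← assoc_inclOne₂, ← crossedCoact_inclOne h]
    simp [splitLeft, inclOne₂]

theorem crossed_quasi_coassoc {comul : A →ₐ[k] A ⊗[k] A} {coact : K →ₐ[k] A ⊗[k] K}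
    {J : G → (A ⊗[k] A)ˣ} {J' : F → (A ⊗[k] K)ˣ}
    (h : IsCoactionDatum c c (MonoidHom.id G) comul J) (h' : IsCoactionDatum c d j coact J')
    (φ : A ⊗[k] (A ⊗[k] K))
    (hφ : ∀ x, φ * splitLeft comul (coact x) = onRight coact (coact x) * φ)
    (twist : ∀ σ, φ * splitLeft comul (J' σ : A ⊗[k] K) *
      onRight Algebra.TensorProduct.includeLeft (J (j σ) : A ⊗[k] A) =
      onRight coact (J' σ : A ⊗[k] K) * (1 : A) ⊗ₜ[k] (J' σ : A ⊗[k] K) *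
        Algebra.TensorProduct.map (c.act (j σ)) (Algebra.TensorProduct.map (c.act (j σ))
          (d.act σ)) φ)
    (z : d.Crossed) :
    inclOne₃ c d φ * splitLeft (crossedCoact h) (crossedCoact h' z) =
      onRight (crossedCoact h') (crossedCoact h' z) * inclOne₃ c d φ := by
  induction z using FactorSystem.induction with
  | h0 => simp
  | h2 a b ha hb => simp only [add_mul, mul_add, map_add, ha, hb]
  | h1 σ x =>
    rw [crossedCoact_incl, splitLeft_crossedCoact_incl₂, inclOne₃_mul,
      onRight_crossedCoact_incl₂, incl₃_mul_inclOne₃]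
    congr 1
    rw [map_mul, map_mul, ← mul_assoc, ← mul_assoc, hφ, mul_assoc (onRight coact (coact x)),
      mul_assoc (onRight coact (coact x)), twist]
    simp only [mul_assoc]

theorem evalLeft_crossed {e : A →ₐ[k] k} {e' : c.Crossed →ₐ[k] k} (he : ∀ σ a, e' (c.incl σ a) = e a)
    (σ : F) (s : A ⊗[k] K) : evalLeft e' (incl₂ c d j σ s) = d.incl σ (evalLeft e s) := by
  induction s with
  | zero => simp
  | add a b ha hb => simp only [map_add, ha, hb]
  | tmul a x => simp [evalLeft, incl₂, he]

theorem evalLeft_inclOne₂ {e : A →ₐ[k] k} {e' : c.Crossed →ₐ[k] k} (he : ∀ σ a, e' (c.incl σ a) = e a)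
    (s : A ⊗[k] K) : evalLeft e' (inclOne₂ c d s) = d.inclOne (evalLeft e s) := by
  induction s with
  | zero => simp
  | add a b ha hb => simp only [map_add, ha, hb]
  | tmul a x => simp [evalLeft, inclOne₂, FactorSystem.inclOne_apply, he]

theorem evalRight_crossed {e : A →ₐ[k] k} {e' : c.Crossed →ₐ[k] k} (he : ∀ σ a, e' (c.incl σ a) = e a)
    (σ : G) (s : A ⊗[k] A) : evalRight e' (incl₂ c c (MonoidHom.id G) σ s) =
      c.incl σ (evalRight e s) := by
  induction s with
  | zero => simp
  | add a b ha hb => simp only [map_add, ha, hb]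
  | tmul a x => simp [evalRight, incl₂, he]

theorem crossed_counit_middle {e : A →ₐ[k] k} {e' : c.Crossed →ₐ[k] k}
    (he : ∀ σ a, e' (c.incl σ a) = e a) (s : A ⊗[k] (A ⊗[k] K)) :
    onRight (evalLeft e') (inclOne₃ c d s) = inclOne₂ c d (onRight (evalLeft e) s) := by
  induction s with
  | zero => simp
  | add a b ha hb => simp only [map_add, ha, hb]
  | tmul a x => simp [inclOne₃, inclOne₂, ← evalLeft_inclOne₂ he]

set_option maxHeartbeats 1000000 in
set_option synthInstance.maxHeartbeats 400000 in
theorem crossed_pentagon {comul : A →ₐ[k] A ⊗[k] A} {coact : K →ₐ[k] A ⊗[k] K}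
    {J : G → (A ⊗[k] A)ˣ} {J' : F → (A ⊗[k] K)ˣ}
    (h : IsCoactionDatum c c (MonoidHom.id G) comul J) (h' : IsCoactionDatum c d j coact J')
    (φ : A ⊗[k] (A ⊗[k] K)) (φ₀ : A ⊗[k] (A ⊗[k] A))
    (hφ : (1 : A) ⊗ₜ[k] φ * onRight (splitLeft comul) φ *
        onRight (onRight Algebra.TensorProduct.includeLeft) φ₀ =
      onRight (onRight coact) φ * splitLeft comul φ) :
    (1 : c.Crossed) ⊗ₜ[k] inclOne₃ c d φ * onRight (splitLeft (crossedCoact h)) (inclOne₃ c d φ) *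
        onRight (onRight Algebra.TensorProduct.includeLeft) (inclOne₃ c c φ₀) =
      onRight (onRight (crossedCoact h')) (inclOne₃ c d φ) *
        splitLeft (crossedCoact h) (inclOne₃ c d φ) := by
  have key := congrArg (Algebra.TensorProduct.map c.inclOne (inclOne₃ c d)) hφ
  simp only [map_mul] at key
  convert key using 2
  · congr 1
    generalize φ = s
    induction s with
    | zero => simp
    | add a b ha hb => simp only [map_add, ha, hb]
    | tmul a x => simp [inclOne₃, splitLeft_crossedCoact_inclOne₂ h]
  · generalize φ₀ = s
    induction s with
    | zero => simp
    | add a b ha hb => simp only [map_add, ha, hb]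
    | tmul a t =>
      induction t with
      | zero => simp
      | add a b ha hb => simp only [TensorProduct.tmul_add, map_add, ha, hb]
      | tmul x y => simp [inclOne₃, inclOne₂]
  · generalize φ = s
    induction s with
    | zero => simp
    | add a b ha hb => simp only [map_add, ha, hb]
    | tmul a x => 
      simp only [inclOne₃, Algebra.TensorProduct.map_tmul, AlgHom.coe_id, id_eq,
        onRight_crossedCoact_inclOne₂ h']
  · generalize φ = s
    induction s with
    | zero => simp
    | add a b ha hb => simp only [map_add, ha, hb]
    | tmul a x =>
      have e1 : splitLeft (crossedCoact h) (inclOne₃ c d (a ⊗ₜ x)) =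
        Algebra.TensorProduct.assoc k k k _ _ _ (inclOne₂ c c (comul a) ⊗ₜ inclOne₂ c d x) := by
        simp [splitLeft, inclOne₃, crossedCoact_inclOne h]
      have e2 : splitLeft comul (a ⊗ₜ[k] x) =
        Algebra.TensorProduct.assoc k k k _ _ _ (comul a ⊗ₜ x) := by simp [splitLeft]
      rw [e1, e2]
      generalize comul a = t
      induction t with
      | zero => simp
      | add a b ha hb => simp only [TensorProduct.add_tmul, map_add, ha, hb]
      | tmul b y => simp [inclOne₃, inclOne₂]

end Crossed

namespace CrossedSystem

variable {k A G : Type*} [Field k] [Ring A] [Algebra k A] [QuasiBialgebra k A] [Group G]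
  (T : CrossedSystem k A G)

/-- The algebra `A # G`. -/
abbrev Smash : Type _ := T.toFactorSystem.Crossed

theorem isCoactionDatum :
    IsCoactionDatum T.toFactorSystem T.toFactorSystem (MonoidHom.id G) Δ T.J where
  J_one := T.J_one
  coact_act := T.comul_act
  coact_θ := T.comul_θ

/-- The counit `ε(x # σ) = ε(x)` of `A # G`. -/
noncomputable def counit : T.toFactorSystem.Crossed →ₐ[k] k :=
  T.lift ε (fun _ => 1) rfl (fun σ y => by simp [T.counit_act])
    (fun σ τ => by simp [T.counit_θ])

theorem counit_incl (σ : G) (a : A) : T.counit (T.incl σ a) = ε a := by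
  simp [counit]

end CrossedSystem

namespace CrossedSystem

variable {k A G : Type*} [Field k] [Ring A] [Algebra k A] [QuasiBialgebra k A] [Group G]
  (T : CrossedSystem k A G)

set_option maxHeartbeats 1000000 in
set_option synthInstance.maxHeartbeats 400000 in
/-- The quasi-bialgebra `A # G`, with `Δ(x # σ) = x₍₁₎ J_σ¹ # σ ⊗ x₍₂₎ J_σ² # σ`,
`ε(x # σ) = ε(x)` and associator `Φ¹ # 1 ⊗ Φ² # 1 ⊗ Φ³ # 1`. -/
noncomputable instance : QuasiBialgebra k T.toFactorSystem.Crossed where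
  Δ := crossedCoact T.isCoactionDatum
  ε := T.counit
  Φ := Units.map (inclOne₃ T.toFactorSystem T.toFactorSystem).toMonoidHom Φ
  quasi_coassoc := crossed_quasi_coassoc T.isCoactionDatum T.isCoactionDatum _
    QuasiBialgebra.quasi_coassoc T.twist
  counit_right z := by
    induction z using FactorSystem.induction with
    | h0 => simp
    | h2 a b ha hb => simp only [map_add, ha, hb]
    | h1 σ a =>
      rw [crossedCoact_incl, evalRight_crossed T.counit_incl, map_mul, T.counit_right, mul_one,
        QuasiBialgebra.counit_right]
  counit_left z := by
    induction z using FactorSystem.induction with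
    | h0 => simp
    | h2 a b ha hb => simp only [map_add, ha, hb]
    | h1 σ a =>
      rw [crossedCoact_incl, evalLeft_crossed T.counit_incl, map_mul, T.counit_left, mul_one,
        QuasiBialgebra.counit_left]
  pentagon := crossed_pentagon T.isCoactionDatum T.isCoactionDatum _ _ QuasiBialgebra.pentagon
  counit_middle :=
    (crossed_counit_middle T.counit_incl _).trans (by rw [QuasiBialgebra.counit_middle, map_one])

end CrossedSystem

namespace ComoduleCrossedSystem

variable {k A K G : Type*} [Field k] [Ring A] [Algebra k A] [QuasiBialgebra k A] [Ring K]
  [Algebra k K] [ComoduleAlgebra k A K] [Group G] {T : CrossedSystem k A G} {F : Subgroup G}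
  (U : ComoduleCrossedSystem T K F)

/-- The algebra `K # F`. -/
abbrev Smash : Type _ := U.toFactorSystem.Crossed

theorem isCoactionDatum : IsCoactionDatum T.toFactorSystem U.toFactorSystem F.subtype
    ComoduleAlgebra.coact U.J where
  J_one := U.J_one
  coact_act := U.coact_act
  coact_θ := U.coact_θ

set_option maxHeartbeats 1000000 in
set_option synthInstance.maxHeartbeats 400000 in
/-- The left `A # G`-comodule algebra `K # F`, with coaction
`x # σ ↦ x₍₋₁₎ J̄_σ¹ # σ ⊗ x₍₀₎ J̄_σ² # σ` and associator `Φ_λ¹ # 1 ⊗ Φ_λ² # 1 ⊗ Φ_λ³ # 1`. -/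
noncomputable instance : ComoduleAlgebra k T.toFactorSystem.Crossed U.toFactorSystem.Crossed where
  coact := crossedCoact U.isCoactionDatum
  assoc := Units.map (inclOne₃ T.toFactorSystem U.toFactorSystem).toMonoidHom
    ComoduleAlgebra.assoc
  pentagon := crossed_pentagon T.isCoactionDatum U.isCoactionDatum _ _ ComoduleAlgebra.pentagon
  counit_middle :=
    (crossed_counit_middle T.counit_incl _).trans (by rw [ComoduleAlgebra.counit_middle, map_one])
  quasi_coassoc := crossed_quasi_coassoc T.isCoactionDatum U.isCoactionDatum _
    ComoduleAlgebra.quasi_coassoc U.twist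
  counit z := by
    induction z using FactorSystem.induction with
    | h0 => simp
    | h2 a b ha hb => simp only [map_add, ha, hb]
    | h1 σ a =>
      rw [crossedCoact_incl]
      refine (evalLeft_crossed (e := ε) T.counit_incl σ _).trans ?_
      rw [map_mul, U.counit_left, mul_one, ComoduleAlgebra.counit]

end ComoduleCrossedSystem

/-! ### Categories of modules -/

/-- Which modules are considered: the finite-dimensional ones, or all of them. -/
inductive ModuleSize
  | finite
  | all

/-- The condition on the dimension of a module. -/
def ModuleSize.Admits (s : ModuleSize) (k V : Type*) [Field k] [AddCommGroup V] [Module k V] :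
    Prop :=
  match s with
  | .finite => FiniteDimensional k V
  | .all => True

/-- The category of left `R`-modules of the given size. Such a module is a vector space `V` with an
algebra map `ρ : R → End V`. -/
structure RepCat (s : ModuleSize) (k R : Type u) [Field k] [Ring R] [Algebra k R] where
  V : Type u
  [addCommGroup : AddCommGroup V]
  [module : Module k V]
  ρ : R →ₐ[k] Module.End k V
  admits : s.Admits k V

/-- The category of finite-dimensional representations. -/
abbrev FdRep (k R : Type u) [Field k] [Ring R] [Algebra k R] := RepCat .finite k R

namespace RepCat

attribute [instance] addCommGroup module

section Basic

variable {s : ModuleSize} {k R : Type u} [Field k] [Ring R] [Algebra k R]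

/-- The space of module maps. -/
def hom (X Y : RepCat s k R) : Submodule k (X.V →ₗ[k] Y.V) where
  carrier := {f | ∀ a, f ∘ₗ X.ρ a = Y.ρ a ∘ₗ f}
  add_mem' hf hg a := by rw [LinearMap.add_comp, LinearMap.comp_add, hf, hg]
  zero_mem' a := by simp
  smul_mem' r f hf a := by rw [LinearMap.smul_comp, LinearMap.comp_smul, hf]

instance : Category (RepCat s k R) where
  Hom X Y := X.hom Y
  id X := ⟨LinearMap.id, fun _ => rfl⟩
  comp f g := ⟨g.1 ∘ₗ f.1, fun a => by
    rw [LinearMap.comp_assoc, f.2, ← LinearMap.comp_assoc, g.2, LinearMap.comp_assoc]⟩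

@[ext]
theorem hom_ext {X Y : RepCat s k R} {f g : X ⟶ Y} (h : f.1 = g.1) : f = g := Subtype.ext h

@[simp] theorem id_val (X : RepCat s k R) : (𝟙 X : X ⟶ X).1 = LinearMap.id := rfl

@[simp] theorem comp_val {X Y Z : RepCat s k R} (f : X ⟶ Y) (g : Y ⟶ Z) :
    (f ≫ g).1 = g.1 ∘ₗ f.1 := rfl

instance : Preadditive (RepCat s k R) where
  homGroup X Y := inferInstanceAs (AddCommGroup (X.hom Y))
  add_comp _ _ _ f f' g := Subtype.ext (LinearMap.comp_add f.1 f'.1 g.1)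
  comp_add _ _ _ f g g' := Subtype.ext (LinearMap.add_comp f.1 g'.1 g.1)

instance : Linear k (RepCat s k R) where
  homModule X Y := inferInstanceAs (Module k (X.hom Y))
  smul_comp _ _ _ r f g := Subtype.ext (LinearMap.comp_smul g.1 r f.1)
  comp_smul _ _ _ f r g := Subtype.ext (LinearMap.smul_comp r g.1 f.1)

@[simp] theorem add_val {X Y : RepCat s k R} (f g : X ⟶ Y) : (f + g).1 = f.1 + g.1 := rfl

@[simp] theorem smul_val {X Y : RepCat s k R} (r : k) (f : X ⟶ Y) : (r • f).1 = r • f.1 := rfl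

/-- The isomorphism given by a linear equivalence which is a module map. -/
@[simps] def mkIso {X Y : RepCat s k R} (e : X.V ≃ₗ[k] Y.V)
    (h : ∀ a, e.toLinearMap ∘ₗ X.ρ a = Y.ρ a ∘ₗ e.toLinearMap) : X ≅ Y where
  hom := ⟨e.toLinearMap, h⟩
  inv := ⟨e.symm.toLinearMap, fun a => by
    rw [LinearEquiv.toLinearMap_symm_comp_eq, ← LinearMap.comp_assoc, h, LinearMap.comp_assoc,
      LinearEquiv.comp_symm, LinearMap.comp_id]⟩
  hom_inv_id := Subtype.ext e.symm_comp
  inv_hom_id := Subtype.ext e.comp_symm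

/-- The linear automorphism given by the action of an invertible element. -/
def unitEquiv {V : Type*} [AddCommGroup V] [Module k V] (ρ : R →ₐ[k] Module.End k V) (x : Rˣ) :
    V ≃ₗ[k] V :=
  LinearEquiv.ofLinearMap (ρ x) (ρ ↑x⁻¹)
    (by rw [← Module.End.mul_eq_comp, ← map_mul, Units.mul_inv, map_one]; rfl)
    (by rw [← Module.End.mul_eq_comp, ← map_mul, Units.inv_mul, map_one]; rfl)

@[simp] theorem unitEquiv_toLinearMap {V : Type*} [AddCommGroup V] [Module k V]
    (ρ : R →ₐ[k] Module.End k V) (x : Rˣ) : (unitEquiv ρ x).toLinearMap = ρ x := rfl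

/-- Restriction along an algebra map `f : R → R'`: the space of the module is kept, and `x ∈ R` acts
through `f(x)`. -/
abbrev restrict {R' : Type u} [Ring R'] [Algebra k R'] (f : R →ₐ[k] R') :
    RepCat s k R' ⥤ RepCat s k R where
  obj M := ⟨M.V, M.ρ.comp f, M.admits⟩
  map g := ⟨g.1, fun a => g.2 (f a)⟩

end Basic

section Tensor

variable {k A B C A' B' V W U V' W' : Type*} [Field k]
  [Ring A] [Algebra k A] [Ring B] [Algebra k B] [Ring C] [Algebra k C]
  [Ring A'] [Algebra k A'] [Ring B'] [Algebra k B']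
  [AddCommGroup V] [Module k V] [AddCommGroup W] [Module k W] [AddCommGroup U] [Module k U]
  [AddCommGroup V'] [Module k V'] [AddCommGroup W'] [Module k W']

/-- The action of `A ⊗ B` on `V ⊗ W`, for an `A`-module `V` and a `B`-module `W`. -/
noncomputable def op (f : A →ₐ[k] Module.End k V) (g : B →ₐ[k] Module.End k W) :
    A ⊗[k] B →ₐ[k] Module.End k (V ⊗[k] W) :=
  (Module.endTensorEndAlgHom (R := k) (S := k) (A := k)).comp (Algebra.TensorProduct.map f g)

@[simp] theorem op_tmul (f : A →ₐ[k] Module.End k V) (g : B →ₐ[k] Module.End k W) (a : A) (b : B) :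
    op f g (a ⊗ₜ b) = TensorProduct.map (f a) (g b) := rfl

theorem map_comp_op {f : A →ₐ[k] Module.End k V} {g : B →ₐ[k] Module.End k W}
    {f' : A' →ₐ[k] Module.End k V'} {g' : B' →ₐ[k] Module.End k W'}
    {p : V →ₗ[k] V'} {q : W →ₗ[k] W'} {φ : A →ₐ[k] A'} {ψ : B →ₐ[k] B'}
    (hp : ∀ a, p ∘ₗ f a = f' (φ a) ∘ₗ p) (hq : ∀ b, q ∘ₗ g b = g' (ψ b) ∘ₗ q) (s : A ⊗[k] B) :
    TensorProduct.map p q ∘ₗ op f g s =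
      op f' g' (Algebra.TensorProduct.map φ ψ s) ∘ₗ TensorProduct.map p q := by
  induction s with
  | zero => simp
  | add a b ha hb => simp only [map_add, LinearMap.comp_add, LinearMap.add_comp, ha, hb]
  | tmul a b =>
    simp only [op_tmul, Algebra.TensorProduct.map_tmul, ← TensorProduct.map_comp, hp, hq]

theorem op_comp (f : A →ₐ[k] Module.End k V) (g : B →ₐ[k] Module.End k W) (φ : A' →ₐ[k] A)
    (ψ : B' →ₐ[k] B) (s : A' ⊗[k] B') :
    op (f.comp φ) (g.comp ψ) s = op f g (Algebra.TensorProduct.map φ ψ s) := by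
  have := map_comp_op (f := f.comp φ) (g := g.comp ψ) (f' := f) (g' := g) (p := LinearMap.id)
    (q := LinearMap.id) (φ := φ) (ψ := ψ) (fun _ => rfl) (fun _ => rfl) s
  simpa using this

theorem assoc_comp_op (f : A →ₐ[k] Module.End k V) (g : B →ₐ[k] Module.End k W)
    (h : C →ₐ[k] Module.End k U) (s : (A ⊗[k] B) ⊗[k] C) :
    (TensorProduct.assoc k V W U).toLinearMap ∘ₗ op (op f g) h s =
      op f (op g h) (Algebra.TensorProduct.assoc k k k A B C s) ∘ₗ
        (TensorProduct.assoc k V W U).toLinearMap := by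
  induction s with
  | zero => simp
  | add a b ha hb => simp only [map_add, LinearMap.comp_add, LinearMap.add_comp, ha, hb]
  | tmul t c =>
    induction t with
    | zero => simp
    | add a b ha hb =>
      simp only [TensorProduct.add_tmul, map_add, LinearMap.comp_add, LinearMap.add_comp, ha, hb]
    | tmul a b => ext; simp

/-- The one-dimensional module on which `A` acts through an algebra map `A → k`. -/
abbrev scalarAction (e : A →ₐ[k] k) : A →ₐ[k] Module.End k k := (Algebra.lmul k k).comp e

theorem lid_comp_op (e : A →ₐ[k] k) (g : B →ₐ[k] Module.End k W) (s : A ⊗[k] B) :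
    (TensorProduct.lid k W).toLinearMap ∘ₗ op (scalarAction e) g s =
      g (evalLeft e s) ∘ₗ (TensorProduct.lid k W).toLinearMap := by
  induction s with
  | zero => simp
  | add a b ha hb => simp only [map_add, LinearMap.comp_add, LinearMap.add_comp, ha, hb]
  | tmul a b => ext; simp [evalLeft]

theorem rid_comp_op (e : A →ₐ[k] k) (g : B →ₐ[k] Module.End k W) (s : B ⊗[k] A) :
    (TensorProduct.rid k W).toLinearMap ∘ₗ op g (scalarAction e) s =
      g (evalRight e s) ∘ₗ (TensorProduct.rid k W).toLinearMap := by
  induction s with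
  | zero => simp
  | add a b ha hb => simp only [map_add, LinearMap.comp_add, LinearMap.add_comp, ha, hb]
  | tmul a b => ext; simp [evalRight]

end Tensor

end RepCat

/-! ### The tensor category `Rep(A)` and the module category of a comodule algebra -/

/-- A quasi-bialgebra is a comodule algebra over itself. -/
noncomputable instance ComoduleAlgebra.regular (k A : Type*) [Field k] [Ring A] [Algebra k A]
    [QuasiBialgebra k A] : ComoduleAlgebra k A A where
  coact := Δ
  assoc := Φ
  pentagon := QuasiBialgebra.pentagon
  counit_middle := QuasiBialgebra.counit_middle
  quasi_coassoc := QuasiBialgebra.quasi_coassoc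
  counit := QuasiBialgebra.counit_left

section Counit

variable {k A K : Type*} [Field k] [Ring A] [Algebra k A] [QuasiBialgebra k A] [Ring K]
  [Algebra k K] [ComoduleAlgebra k A K]

/-- Apply `ε` to the first two factors. -/
noncomputable def counit₂ : A ⊗[k] (A ⊗[k] (A ⊗[k] K)) →ₐ[k] A ⊗[k] K :=
  (evalLeft ε).comp (evalLeft ε)

/-- `(ε ⊗ id ⊗ id)(Φ_λ) = 1` -/
theorem ComoduleAlgebra.counit_assoc :
    evalLeft ε (ComoduleAlgebra.assoc : (A ⊗[k] (A ⊗[k] K))ˣ).val = 1 := by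
  have h := congrArg counit₂ (ComoduleAlgebra.pentagon (k := k) (A := A) (K := K))
  simp only [map_mul] at h
  set φ : A ⊗[k] (A ⊗[k] K) := (ComoduleAlgebra.assoc : (A ⊗[k] (A ⊗[k] K))ˣ).val with hφ
  have e1 : counit₂ ((1 : A) ⊗ₜ[k] φ) = evalLeft ε φ := by
    simp [counit₂, evalLeft]
  have e2 : counit₂ (onRight (splitLeft Δ) φ) = evalLeft ε φ := by
    generalize φ = s
    induction s with
    | zero => simp
    | add a b ha hb => simp only [map_add, ha, hb]
    | tmul a t =>
      have : evalLeft ε (splitLeft (R := K) (Δ : A →ₐ[k] A ⊗[k] A) t) = t := by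
        induction t with
        | zero => simp
        | add a b ha hb => simp only [map_add, ha, hb]
        | tmul b x =>
          have e : splitLeft Δ (b ⊗ₜ[k] x) =
            Algebra.TensorProduct.assoc k k k A A K (Δ b ⊗ₜ x) := by simp [splitLeft]
          have e' (t : A ⊗[k] A) : evalLeft (R := A ⊗[k] K) ε
              (Algebra.TensorProduct.assoc k k k A A K (t ⊗ₜ x)) = evalLeft (ε : A →ₐ[k] k) t ⊗ₜ x := by
            induction t with
            | zero => simp
            | add a b ha hb => simp only [TensorProduct.add_tmul, map_add, ha, hb]
            | tmul a b => simp [evalLeft, TensorProduct.smul_tmul']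
          rw [e, e', QuasiBialgebra.counit_left]
      have e3 : counit₂ (onRight (splitLeft Δ) (a ⊗ₜ[k] t)) =
          (ε a : k) • evalLeft ε (splitLeft (R := K) (Δ : A →ₐ[k] A ⊗[k] A) t) := by
        simp [counit₂, evalLeft]
      rw [e3, this]
      simp [evalLeft]
  have e3 : counit₂ (K := K) (onRight (onRight Algebra.TensorProduct.includeLeft)
      (Φ : (A ⊗[k] (A ⊗[k] A))ˣ).val) = 1 := by
    have e (t : A ⊗[k] (A ⊗[k] A)) : counit₂ (K := K)
        (onRight (onRight Algebra.TensorProduct.includeLeft) t) =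
        evalLeft ε (onRight (evalLeft ε) t) ⊗ₜ 1 := by
      induction t with
      | zero => simp
      | add a b ha hb => simp only [map_add, ha, hb, TensorProduct.add_tmul]
      | tmul a t =>
        induction t with
        | zero => simp
        | add a b ha hb => simp only [map_add, ha, hb, TensorProduct.add_tmul, TensorProduct.tmul_add]
        | tmul b c => simp [counit₂, evalLeft, TensorProduct.smul_tmul', mul_comm]
    rw [e, QuasiBialgebra.counit_middle, map_one, Algebra.TensorProduct.one_def]
  have e4 : counit₂ (onRight (onRight ComoduleAlgebra.coact) φ) = 1 := by
    have e (t : A ⊗[k] (A ⊗[k] K)) : counit₂ (onRight (onRight ComoduleAlgebra.coact) t) =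
        ComoduleAlgebra.coact (evalLeft ε (onRight (evalLeft (ε : A →ₐ[k] k)) t)) := by
      induction t with
      | zero => simp
      | add a b ha hb => simp only [map_add, ha, hb]
      | tmul a t =>
        induction t with
        | zero => simp
        | add a b ha hb => simp only [map_add, ha, hb, TensorProduct.tmul_add]
        | tmul b c => simp [counit₂, evalLeft, smul_smul, mul_comm]
    rw [e, ComoduleAlgebra.counit_middle, map_one, map_one]
  have e5 : counit₂ (splitLeft Δ φ) = evalLeft ε φ := by
    generalize φ = s
    induction s with
    | zero => simp
    | add a b ha hb => simp only [map_add, ha, hb]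
    | tmul a t =>
      have e : splitLeft Δ (a ⊗ₜ[k] t) =
        Algebra.TensorProduct.assoc k k k A A _ (Δ a ⊗ₜ t) := by simp [splitLeft]
      have e' (w : A ⊗[k] A) : counit₂
          (Algebra.TensorProduct.assoc k k k A A _ (w ⊗ₜ t)) = (ε (evalLeft (ε : A →ₐ[k] k) w) : k) • t := by
        induction w with
        | zero => simp
        | add a b ha hb => simp only [TensorProduct.add_tmul, map_add, ha, hb, add_smul]
        | tmul a b => simp [counit₂, evalLeft, smul_smul]
      rw [e, e', QuasiBialgebra.counit_left]
      simp [evalLeft]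
  rw [e1, e2, e3, e4, e5, mul_one, one_mul] at h
  have hu : IsUnit (evalLeft ε φ) := (ComoduleAlgebra.assoc : (A ⊗[k] (A ⊗[k] K))ˣ).isUnit.map _
  exact hu.mul_left_cancel (h.trans (mul_one _).symm)

end Counit

namespace RepCat

theorem admits_tensor {s : ModuleSize} {k V W : Type*} [Field k] [AddCommGroup V] [Module k V]
    [AddCommGroup W] [Module k W] (hV : ModuleSize.finite.Admits k V) (hW : s.Admits k W) :
    s.Admits k (V ⊗[k] W) := by
  cases s with
  | all => trivial
  | finite =>
    have : FiniteDimensional k V := hV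
    have : FiniteDimensional k W := hW
    exact (inferInstance : FiniteDimensional k (V ⊗[k] W))

variable {s : ModuleSize} {k A K : Type u} [Field k] [Ring A] [Algebra k A] [QuasiBialgebra k A]
  [Ring K] [Algebra k K] [ComoduleAlgebra k A K]

/-- The `K`-module `X ⊗ M`, with `x ∈ K` acting as `λ(x)`. -/
noncomputable abbrev tensor (X : FdRep k A) (M : RepCat s k K) : RepCat s k K where
  V := X.V ⊗[k] M.V
  ρ := (op X.ρ M.ρ).comp ComoduleAlgebra.coact
  admits := admits_tensor X.admits M.admits

/-- The trivial representation `k`. -/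
noncomputable abbrev unit : FdRep k A where
  V := k
  ρ := scalarAction ε
  admits := (inferInstance : FiniteDimensional k k)

/-- The morphism `f ⊗ g`. -/
noncomputable abbrev tensorMap {X Y : FdRep k A} {M N : RepCat s k K} (f : X ⟶ Y) (g : M ⟶ N) :
    tensor X M ⟶ tensor Y N :=
  ⟨TensorProduct.map f.1 g.1, fun x =>
    (map_comp_op (φ := AlgHom.id k A) (ψ := AlgHom.id k K) f.2 g.2 _).trans (by
      rw [Algebra.TensorProduct.map_id]; rfl)⟩

/-- The isomorphism `(X ⊗ Y) ⊗ M ≅ X ⊗ (Y ⊗ M)`, `x ⊗ y ⊗ m ↦ Φ_λ (x ⊗ y ⊗ m)`. -/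
noncomputable abbrev associator (X Y : FdRep k A) (M : RepCat s k K) :
    tensor (tensor X Y) M ≅ tensor X (tensor Y M) :=
  mkIso (TensorProduct.assoc k X.V Y.V M.V ≪≫ₗ
      unitEquiv (op X.ρ (op Y.ρ M.ρ)) ComoduleAlgebra.assoc) (fun x => by
    have h1 : (tensor (tensor X Y) M).ρ x = op (op X.ρ Y.ρ) M.ρ
        (Algebra.TensorProduct.map Δ (AlgHom.id k K) (ComoduleAlgebra.coact x)) :=
      op_comp (op X.ρ Y.ρ) M.ρ Δ (AlgHom.id k K) _
    have h2 : (tensor X (tensor Y M)).ρ x = op X.ρ (op Y.ρ M.ρ)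
        (onRight ComoduleAlgebra.coact (ComoduleAlgebra.coact x)) :=
      op_comp X.ρ (op Y.ρ M.ρ) (AlgHom.id k A) ComoduleAlgebra.coact _
    rw [h1, h2, LinearEquiv.coe_trans, unitEquiv_toLinearMap, LinearMap.comp_assoc, assoc_comp_op,
      ← LinearMap.comp_assoc, ← LinearMap.comp_assoc, ← Module.End.mul_eq_comp,
      ← Module.End.mul_eq_comp, ← map_mul, ← map_mul]
    exact congrArg (fun z => op X.ρ (op Y.ρ M.ρ) z ∘ₗ
      (TensorProduct.assoc k X.V Y.V M.V).toLinearMap) (ComoduleAlgebra.quasi_coassoc x))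

theorem associator_val (X Y : FdRep k A) (M : RepCat s k K) :
    (associator X Y M).hom.1 = op X.ρ (op Y.ρ M.ρ)
        (ComoduleAlgebra.assoc : (A ⊗[k] (A ⊗[k] K))ˣ).val ∘ₗ
      (TensorProduct.assoc k X.V Y.V M.V).toLinearMap := rfl

/-- The isomorphism `k ⊗ M ≅ M`. -/
noncomputable abbrev leftUnitor (M : RepCat s k K) : tensor (unit : FdRep k A) M ≅ M :=
  mkIso (TensorProduct.lid k M.V) (fun x => by
    refine (lid_comp_op _ _ _).trans ?_
    exact congrArg (fun z => M.ρ z ∘ₗ (TensorProduct.lid k M.V).toLinearMap)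
      (ComoduleAlgebra.counit x))

/-- The isomorphism `X ⊗ k ≅ X`. -/
noncomputable abbrev rightUnitor (X : FdRep k A) : tensor X (unit : FdRep k A) ≅ X :=
  mkIso (TensorProduct.rid k X.V) (fun x => by
    refine (rid_comp_op _ _ _).trans ?_
    exact congrArg (fun z => X.ρ z ∘ₗ (TensorProduct.rid k X.V).toLinearMap)
      (QuasiBialgebra.counit_right x))

theorem associator_naturality {X X' Y Y' : FdRep k A} {M M' : RepCat s k K} (f : X ⟶ X')
    (g : Y ⟶ Y') (h : M ⟶ M') :
    tensorMap (tensorMap f g) h ≫ (associator X' Y' M').hom =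
      (associator X Y M).hom ≫ tensorMap f (tensorMap g h) := by
  ext : 1
  simp only [comp_val, associator_val]
  rw [← LinearMap.comp_assoc, map_comp_op (φ := AlgHom.id k A) (ψ := AlgHom.id k (A ⊗[k] K))
    f.2 (f' := X'.ρ) (g' := op Y'.ρ M'.ρ) (fun t => by
      refine (map_comp_op (φ := AlgHom.id k A) (ψ := AlgHom.id k K) g.2 h.2 _).trans ?_
      rw [Algebra.TensorProduct.map_id])]
  rw [Algebra.TensorProduct.map_id, LinearMap.comp_assoc, LinearMap.comp_assoc]
  congr 1
  exact TensorProduct.ext_threefold fun _ _ _ => rfl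

theorem triangle_left (X : FdRep k A) (M : RepCat s k K) :
    tensorMap (leftUnitor X).hom (𝟙 M) =
      (associator unit X M).hom ≫ (leftUnitor (tensor X M)).hom := by
  ext : 1
  simp only [comp_val, associator_val]
  have h := lid_comp_op (ε : A →ₐ[k] k) (op X.ρ M.ρ)
    (ComoduleAlgebra.assoc : (A ⊗[k] (A ⊗[k] K))ˣ).val
  rw [ComoduleAlgebra.counit_assoc, map_one] at h
  refine Eq.trans ?_ (congrArg (· ∘ₗ (TensorProduct.assoc k k X.V M.V).toLinearMap) h.symm)
  refine TensorProduct.ext_threefold fun r x m => ?_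
  exact TensorProduct.smul_tmul' r x m

theorem triangle_right (X : FdRep k A) (M : RepCat s k K) :
    tensorMap (rightUnitor X).hom (𝟙 M) =
      (associator X unit M).hom ≫ tensorMap (𝟙 X) (leftUnitor M).hom := by
  ext : 1
  simp only [comp_val, associator_val]
  have h := map_comp_op (f := X.ρ) (g := op (scalarAction (ε : A →ₐ[k] k)) M.ρ) (f' := X.ρ)
    (g' := M.ρ) (p := LinearMap.id) (q := (TensorProduct.lid k M.V).toLinearMap)
    (φ := AlgHom.id k A) (ψ := evalLeft ε) (fun _ => rfl) (fun t => lid_comp_op _ _ t)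
    (ComoduleAlgebra.assoc : (A ⊗[k] (A ⊗[k] K))ˣ).val
  rw [ComoduleAlgebra.counit_middle, map_one] at h
  refine Eq.trans ?_ (congrArg (· ∘ₗ (TensorProduct.assoc k X.V k M.V).toLinearMap) h.symm)
  refine TensorProduct.ext_threefold fun r x m => ?_
  exact TensorProduct.smul_tmul x r m

theorem pentagon (X Y Z : FdRep k A) (M : RepCat s k K) :
    tensorMap (associator X Y Z).hom (𝟙 M) ≫ (associator X (tensor Y Z) M).hom ≫
        tensorMap (𝟙 X) (associator Y Z M).hom =
      (associator (tensor X Y) Z M).hom ≫ (associator X Y (tensor Z M)).hom := by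
  ext : 1
  set φ := (ComoduleAlgebra.assoc : (A ⊗[k] (A ⊗[k] K))ˣ).val
  set φ₀ := (Φ : (A ⊗[k] (A ⊗[k] A))ˣ).val
  set O := op X.ρ (op Y.ρ (op Z.ρ M.ρ))
  -- the four steps, read in `X ⊗ (Y ⊗ (Z ⊗ M))`
  have h1 : (TensorProduct.assoc k X.V (Y.V ⊗[k] Z.V) M.V).toLinearMap ∘ₗ
      (tensorMap (associator X Y Z).hom (𝟙 M)).1 =
      op X.ρ (op (op Y.ρ Z.ρ) M.ρ) (Algebra.TensorProduct.assoc k k k _ _ _ (φ₀ ⊗ₜ 1)) ∘ₗ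
        (TensorProduct.assoc k X.V (Y.V ⊗[k] Z.V) M.V).toLinearMap ∘ₗ
        TensorProduct.map (TensorProduct.assoc k X.V Y.V Z.V).toLinearMap LinearMap.id := by
    rw [← LinearMap.comp_assoc, ← assoc_comp_op, LinearMap.comp_assoc]
    congr 1
    rw [op_tmul, map_one, ← TensorProduct.map_comp]
    rfl
  have h2 (t : A ⊗[k] ((A ⊗[k] A) ⊗[k] K)) :
      TensorProduct.map LinearMap.id (TensorProduct.assoc k Y.V Z.V M.V).toLinearMap ∘ₗ
        op X.ρ (op (op Y.ρ Z.ρ) M.ρ) t =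
      O (onRight (Algebra.TensorProduct.assoc k k k A A K).toAlgHom t) ∘ₗ
        TensorProduct.map LinearMap.id (TensorProduct.assoc k Y.V Z.V M.V).toLinearMap :=
    map_comp_op (φ := AlgHom.id k A) (fun _ => rfl) (fun b => assoc_comp_op _ _ _ b) t
  have h3 : (associator X (tensor Y Z) M).hom.1 = op X.ρ (op (op Y.ρ Z.ρ) M.ρ)
      (onRight (Algebra.TensorProduct.map Δ (AlgHom.id k K)) φ) ∘ₗ
      (TensorProduct.assoc k X.V (Y.V ⊗[k] Z.V) M.V).toLinearMap := by
    rw [associator_val]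
    congr 1
    rw [← op_comp]
    congr 2
    exact AlgHom.ext fun t => op_comp (op Y.ρ Z.ρ) M.ρ Δ (AlgHom.id k K) t
  have h4 : (tensorMap (𝟙 X) (associator Y Z M).hom).1 = O (1 ⊗ₜ φ) ∘ₗ
      TensorProduct.map LinearMap.id (TensorProduct.assoc k Y.V Z.V M.V).toLinearMap := by
    rw [op_tmul, map_one, ← TensorProduct.map_comp]
    rfl
  have h5 : (associator (tensor X Y) Z M).hom.1 = op (op X.ρ Y.ρ) (op Z.ρ M.ρ)
      (Algebra.TensorProduct.map Δ (AlgHom.id k (A ⊗[k] K)) φ) ∘ₗ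
      (TensorProduct.assoc k (X.V ⊗[k] Y.V) Z.V M.V).toLinearMap := by
    rw [associator_val, ← op_comp]
    rfl
  have h6 : (associator X Y (tensor Z M)).hom.1 = O (onRight (onRight ComoduleAlgebra.coact) φ) ∘ₗ
      (TensorProduct.assoc k X.V Y.V (Z.V ⊗[k] M.V)).toLinearMap := by
    rw [associator_val]
    congr 1
    rw [← op_comp]
    congr 2
    exact AlgHom.ext fun t => op_comp Y.ρ (op Z.ρ M.ρ) (AlgHom.id k A) ComoduleAlgebra.coact t
  have e1 : onRight (Algebra.TensorProduct.assoc k k k A A K).toAlgHom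
      (Algebra.TensorProduct.assoc k k k A (A ⊗[k] A) K (φ₀ ⊗ₜ 1)) =
      onRight (onRight Algebra.TensorProduct.includeLeft) φ₀ := by
    generalize φ₀ = t
    induction t with
    | zero => simp
    | add a b ha hb => simp only [TensorProduct.add_tmul, map_add, ha, hb]
    | tmul a t =>
      induction t with
      | zero => simp
      | add a b ha hb =>
        simp only [TensorProduct.tmul_add, TensorProduct.add_tmul, map_add, ha, hb]
      | tmul b c => simp
  have e2 : onRight (Algebra.TensorProduct.assoc k k k A A K).toAlgHom
      (onRight (Algebra.TensorProduct.map Δ (AlgHom.id k K)) φ) = onRight (splitLeft Δ) φ := by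
    rw [← AlgHom.comp_apply, ← Algebra.TensorProduct.map_comp, AlgHom.id_comp]
    rfl
  have key := congrArg O (ComoduleAlgebra.pentagon (k := k) (A := A) (K := K))
  simp only [map_mul, Module.End.mul_eq_comp] at key
  rw [comp_val, comp_val, comp_val, h3, h4, h5, h6]
  calc _ = O (1 ⊗ₜ φ) ∘ₗ
        (TensorProduct.map LinearMap.id (TensorProduct.assoc k Y.V Z.V M.V).toLinearMap ∘ₗ
        op X.ρ (op (op Y.ρ Z.ρ) M.ρ) (onRight (Algebra.TensorProduct.map Δ (AlgHom.id k K)) φ)) ∘ₗ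
        ((TensorProduct.assoc k X.V (Y.V ⊗[k] Z.V) M.V).toLinearMap ∘ₗ
        (tensorMap (associator X Y Z).hom (𝟙 M)).1) := rfl
    _ = O (1 ⊗ₜ φ) ∘ₗ O (onRight (splitLeft Δ) φ) ∘ₗ
        (TensorProduct.map LinearMap.id (TensorProduct.assoc k Y.V Z.V M.V).toLinearMap ∘ₗ
        op X.ρ (op (op Y.ρ Z.ρ) M.ρ) (Algebra.TensorProduct.assoc k k k _ _ _ (φ₀ ⊗ₜ 1))) ∘ₗ
        (TensorProduct.assoc k X.V (Y.V ⊗[k] Z.V) M.V).toLinearMap ∘ₗ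
        TensorProduct.map (TensorProduct.assoc k X.V Y.V Z.V).toLinearMap LinearMap.id := by
      rw [h1, h2, e2]; rfl
    _ = (O (1 ⊗ₜ φ) ∘ₗ O (onRight (splitLeft Δ) φ) ∘ₗ
        O (onRight (onRight Algebra.TensorProduct.includeLeft) φ₀)) ∘ₗ
        (TensorProduct.map LinearMap.id (TensorProduct.assoc k Y.V Z.V M.V).toLinearMap ∘ₗ
        (TensorProduct.assoc k X.V (Y.V ⊗[k] Z.V) M.V).toLinearMap ∘ₗ
        TensorProduct.map (TensorProduct.assoc k X.V Y.V Z.V).toLinearMap LinearMap.id) := by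
      rw [h2, e1]; rfl
    _ = (O (onRight (onRight ComoduleAlgebra.coact) φ) ∘ₗ O (splitLeft Δ φ)) ∘ₗ
        ((TensorProduct.assoc k X.V Y.V (Z.V ⊗[k] M.V)).toLinearMap ∘ₗ
          (TensorProduct.assoc k (X.V ⊗[k] Y.V) Z.V M.V).toLinearMap) := by
      rw [← key]
      congr 1
      exact TensorProduct.ext_fourfold fun _ _ _ _ => rfl
    _ = O (onRight (onRight ComoduleAlgebra.coact) φ) ∘ₗ
        ((TensorProduct.assoc k X.V Y.V (Z.V ⊗[k] M.V)).toLinearMap ∘ₗ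
        op (op X.ρ Y.ρ) (op Z.ρ M.ρ)
          (Algebra.TensorProduct.map Δ (AlgHom.id k (A ⊗[k] K)) φ)) ∘ₗ
          (TensorProduct.assoc k (X.V ⊗[k] Y.V) Z.V M.V).toLinearMap := by
      rw [assoc_comp_op]; rfl
    _ = _ := rfl

end RepCat

namespace RepCat

variable {s : ModuleSize} {k A K : Type u} [Field k] [Ring A] [Algebra k A] [QuasiBialgebra k A]
  [Ring K] [Algebra k K] [ComoduleAlgebra k A K]

theorem tensorMap_id (X : FdRep k A) (M : RepCat s k K) :
    tensorMap (𝟙 X) (𝟙 M) = 𝟙 (tensor X M) :=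
  Subtype.ext TensorProduct.map_id

theorem tensorMap_comp {X Y Z : FdRep k A} {M N P : RepCat s k K} (f : X ⟶ Y) (f' : Y ⟶ Z)
    (g : M ⟶ N) (g' : N ⟶ P) :
    tensorMap (f ≫ f') (g ≫ g') = tensorMap f g ≫ tensorMap f' g' :=
  Subtype.ext (TensorProduct.map_comp f'.1 g'.1 f.1 g.1)

theorem leftUnitor_naturality {M N : RepCat s k K} (f : M ⟶ N) :
    tensorMap (𝟙 (unit : FdRep k A)) f ≫ (leftUnitor N).hom = (leftUnitor M).hom ≫ f :=
  Subtype.ext (TensorProduct.ext' fun r m => (map_smul f.1 r m).symm)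

theorem rightUnitor_naturality {X Y : FdRep k A} (f : X ⟶ Y) :
    tensorMap f (𝟙 (unit : FdRep k A)) ≫ (rightUnitor Y).hom = (rightUnitor X).hom ≫ f :=
  Subtype.ext (TensorProduct.ext' fun x r => (map_smul f.1 r x).symm)

/-- The tensor category `Rep(A)`. -/
noncomputable instance : MonoidalCategory (FdRep k A) where
  tensorObj X Y := tensor X Y
  tensorHom f g := tensorMap f g
  whiskerLeft X _ _ f := tensorMap (𝟙 X) f
  whiskerRight f Y := tensorMap f (𝟙 Y)
  tensorUnit := unit
  associator X Y Z := associator X Y Z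
  leftUnitor X := leftUnitor X
  rightUnitor X := rightUnitor X
  tensorHom_def f g := by rw [← tensorMap_comp, Category.comp_id, Category.id_comp]
  id_tensorHom_id X Y := tensorMap_id X Y
  tensorHom_comp_tensorHom f g f' g' := (tensorMap_comp f f' g g').symm
  whiskerLeft_id X Y := tensorMap_id X Y
  id_whiskerRight X Y := tensorMap_id X Y
  associator_naturality f g h := associator_naturality f g h
  leftUnitor_naturality f := leftUnitor_naturality f
  rightUnitor_naturality f := rightUnitor_naturality f
  pentagon X Y Z W := pentagon X Y Z W
  triangle X Y := (triangle_right X Y).symm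

/-- The action of `Rep(A)` on the category of `K`-modules: `X` acts on `M` by `X ⊗ M`. -/
noncomputable instance : MonoidalLeftAction (FdRep k A) (RepCat s k K) where
  actionObj X M := tensor X M
  actionHom f g := tensorMap f g
  actionHomRight X _ _ f := tensorMap (𝟙 X) f
  actionHomLeft f M := tensorMap f (𝟙 M)
  actionAssocIso X Y M := associator X Y M
  actionUnitIso M := leftUnitor M
  actionHom_def f g := by rw [← tensorMap_comp, Category.comp_id, Category.id_comp]
  actionHomRight_id X Y := tensorMap_id X Y
  id_actionHomLeft X Y := tensorMap_id X Y
  actionHom_comp f f' g g' := tensorMap_comp f f' g g'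
  actionAssocIso_hom_naturality f g h := associator_naturality f g h
  actionUnitIso_hom_naturality f := (leftUnitor_naturality f).symm
  whiskerLeft_actionHomLeft X Y Z f M := by
    rw [← Category.assoc, Iso.eq_comp_inv]
    exact associator_naturality (𝟙 X) f (𝟙 M)
  whiskerRight_actionHomLeft {X Y} Z f M := by
    rw [← Category.assoc, Iso.eq_comp_inv]
    refine (associator_naturality f (𝟙 Z) (𝟙 M)).trans ?_
    rw [tensorMap_id]
  associator_actionHom X Y Z M := pentagon X Y Z M
  leftUnitor_actionHom X M := triangle_left X M
  rightUnitor_actionHom X M := triangle_right X M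

end RepCat

/-! ### Group actions and equivariant objects -/

section Equivariant

/-- An equivariant object for a family of endofunctors `U σ` with natural isomorphisms
`μ σ τ : U_σ U_τ ≅ U_{στ}`: an object `M` with isomorphisms `v_σ : U_σ(M) ≅ M` such that
`v_{στ} ∘ μ_{σ,τ} = v_σ ∘ U_σ(v_τ)`. -/
structure Equivariant {S D : Type*} [Group S] [Category* D] (U : S → D ⥤ D)
    (μ : ∀ σ τ, U τ ⋙ U σ ≅ U (σ * τ)) where
  obj : D
  v (σ : S) : (U σ).obj obj ≅ obj
  comm (σ τ : S) : (μ σ τ).hom.app obj ≫ (v (σ * τ)).hom = (U σ).map (v τ).hom ≫ (v σ).hom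

variable {S D : Type*} [Group S] [Category* D] {U : S → D ⥤ D}
  {μ : ∀ σ τ, U τ ⋙ U σ ≅ U (σ * τ)}

namespace Equivariant

/-- A morphism of equivariant objects: `f ∘ v_σ = v'_σ ∘ U_σ(f)`. -/
@[ext] structure Hom (M N : Equivariant U μ) where
  hom : M.obj ⟶ N.obj
  comm (σ : S) : (M.v σ).hom ≫ hom = (U σ).map hom ≫ (N.v σ).hom

instance : Category (Equivariant U μ) where
  Hom := Hom
  id M := ⟨𝟙 M.obj, fun σ => by simp⟩
  comp f g := ⟨f.hom ≫ g.hom, fun σ => by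
    rw [← Category.assoc, f.comm, Category.assoc, g.comm, Functor.map_comp, Category.assoc]⟩
  id_comp _ := Hom.ext (Category.id_comp _)
  comp_id _ := Hom.ext (Category.comp_id _)
  assoc _ _ _ := Hom.ext (Category.assoc _ _ _)

@[ext]
theorem hom_ext {M N : Equivariant U μ} {f g : M ⟶ N} (h : f.hom = g.hom) : f = g := Hom.ext h

@[simp] theorem id_hom (M : Equivariant U μ) : (𝟙 M : M ⟶ M).hom = 𝟙 M.obj := rfl

@[simp] theorem comp_hom {M N P : Equivariant U μ} (f : M ⟶ N) (g : N ⟶ P) :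
    (f ≫ g).hom = f.hom ≫ g.hom := rfl

/-- The isomorphism given by an isomorphism compatible with the structures. -/
@[simps] def mkIso {M N : Equivariant U μ} (e : M.obj ≅ N.obj)
    (h : ∀ σ, (M.v σ).hom ≫ e.hom = (U σ).map e.hom ≫ (N.v σ).hom) : M ≅ N where
  hom := ⟨e.hom, h⟩
  inv := ⟨e.inv, fun σ => by
    rw [Iso.comp_inv_eq, Category.assoc, h, ← Category.assoc, ← Functor.map_comp, e.inv_hom_id,
      CategoryTheory.Functor.map_id, Category.id_comp]⟩
  hom_inv_id := Hom.ext e.hom_inv_id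
  inv_hom_id := Hom.ext e.inv_hom_id

section Preadditive

variable [Preadditive D] [∀ σ, (U σ).Additive]

instance (M N : Equivariant U μ) : Zero (M ⟶ N) := ⟨⟨0, fun σ => by simp⟩⟩

instance (M N : Equivariant U μ) : Add (M ⟶ N) :=
  ⟨fun f g => ⟨f.hom + g.hom, fun σ => by simp [f.comm, g.comm]⟩⟩

instance (M N : Equivariant U μ) : Neg (M ⟶ N) :=
  ⟨fun f => ⟨-f.hom, fun σ => by simp [f.comm]⟩⟩

instance (M N : Equivariant U μ) : AddCommGroup (M ⟶ N) where
  add_assoc _ _ _ := Hom.ext (add_assoc _ _ _)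
  zero_add _ := Hom.ext (zero_add _)
  add_zero _ := Hom.ext (add_zero _)
  neg_add_cancel _ := Hom.ext (neg_add_cancel _)
  add_comm _ _ := Hom.ext (add_comm _ _)
  nsmul := nsmulRec
  zsmul := zsmulRec

@[simp] theorem add_hom {M N : Equivariant U μ} (f g : M ⟶ N) : (f + g).hom = f.hom + g.hom := rfl

instance : Preadditive (Equivariant U μ) where
  add_comp _ _ _ _ _ _ := Hom.ext (Preadditive.add_comp _ _ _ _ _ _)
  comp_add _ _ _ _ _ _ := Hom.ext (Preadditive.comp_add _ _ _ _ _ _)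

variable {k : Type*} [Field k] [Linear k D] [∀ σ, (U σ).Linear k]

instance {M N : Equivariant U μ} : SMul k (M ⟶ N) :=
  ⟨fun r f => ⟨r • f.hom, fun σ => by simp [f.comm, Functor.map_smul]⟩⟩

instance : Linear k (Equivariant U μ) where
  homModule _ _ :=
    { one_smul _ := Hom.ext (one_smul _ _)
      mul_smul _ _ _ := Hom.ext (mul_smul _ _ _)
      smul_zero _ := Hom.ext (smul_zero _)
      smul_add _ _ _ := Hom.ext (smul_add _ _ _)
      add_smul _ _ _ := Hom.ext (add_smul _ _ _)
      zero_smul _ := Hom.ext (zero_smul _ _) }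
  smul_comp _ _ _ _ _ _ := Hom.ext (Linear.smul_comp _ _ _ _ _ _)
  comp_smul _ _ _ _ _ _ := Hom.ext (Linear.comp_smul _ _ _ _ _ _)

end Preadditive

end Equivariant

end Equivariant

section

open Functor.OplaxMonoidal (δ)

variable {C : Type*} [Category* C] [MonoidalCategory C]

theorem tensorMap_comm (F : C ⥤ C) [F.Monoidal] {X X' Y Y' : C} (f : X ⟶ X') (g : Y ⟶ Y')
    {u : F.obj X ⟶ X} {u' : F.obj X' ⟶ X'} {v : F.obj Y ⟶ Y} {v' : F.obj Y' ⟶ Y'}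
    (hf : u ≫ f = F.map f ≫ u') (hg : v ≫ g = F.map g ≫ v') :
    (δ F X Y ≫ (u ⊗ₘ v)) ≫ (f ⊗ₘ g) = F.map (f ⊗ₘ g) ≫ δ F X' Y' ≫ (u' ⊗ₘ v') := by
  rw [Category.assoc, tensorHom_comp_tensorHom, hf, hg, ← tensorHom_comp_tensorHom,
    ← Functor.OplaxMonoidal.δ_natural_assoc]

theorem associator_comm (F : C ⥤ C) [F.Monoidal] {X Y Z : C} (u : F.obj X ⟶ X)
    (v : F.obj Y ⟶ Y) (w : F.obj Z ⟶ Z) :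
    (δ F (X ⊗ Y) Z ≫ ((δ F X Y ≫ (u ⊗ₘ v)) ⊗ₘ w)) ≫ (α_ X Y Z).hom =
      F.map (α_ X Y Z).hom ≫ δ F X (Y ⊗ Z) ≫ (u ⊗ₘ (δ F Y Z ≫ (v ⊗ₘ w))) := by
  have h1 : (δ F X Y ≫ (u ⊗ₘ v)) ⊗ₘ w = δ F X Y ▷ F.obj Z ≫ ((u ⊗ₘ v) ⊗ₘ w) := by
    rw [← tensorHom_id, tensorHom_comp_tensorHom, Category.id_comp]
  have h2 : u ⊗ₘ (δ F Y Z ≫ (v ⊗ₘ w)) = F.obj X ◁ δ F Y Z ≫ (u ⊗ₘ (v ⊗ₘ w)) := by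
    rw [← id_tensorHom, tensorHom_comp_tensorHom, Category.id_comp]
  rw [h1, h2, Category.assoc, Category.assoc, associator_naturality,
    Functor.OplaxMonoidal.associativity_assoc]

theorem leftUnitor_comm (F : C ⥤ C) [F.Monoidal] {X : C} (u : F.obj X ⟶ X) :
    (δ F (𝟙_ C) X ≫ (Functor.OplaxMonoidal.η F ⊗ₘ u)) ≫ (λ_ X).hom = F.map (λ_ X).hom ≫ u := by
  rw [MonoidalCategory.tensorHom_def, Category.assoc, Category.assoc, leftUnitor_naturality,
    ← Functor.OplaxMonoidal.left_unitality_hom_assoc]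

theorem rightUnitor_comm (F : C ⥤ C) [F.Monoidal] {X : C} (u : F.obj X ⟶ X) :
    (δ F X (𝟙_ C) ≫ (u ⊗ₘ Functor.OplaxMonoidal.η F)) ≫ (ρ_ X).hom = F.map (ρ_ X).hom ≫ u := by
  rw [MonoidalCategory.tensorHom_def', Category.assoc, Category.assoc, rightUnitor_naturality,
    ← Functor.OplaxMonoidal.right_unitality_hom_assoc]

end

/-- An action of a group `G` on a `k`-linear monoidal category `C`: `k`-linear tensor functors `F_σ`
and tensor isomorphisms `γ_{σ,τ} : F_σ F_τ ≅ F_{στ}` and `id ≅ F_1` which make `σ ↦ F_σ` a monoidal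
functor. -/
structure TensorAction (k G C : Type*) [Field k] [Group G] [Category* C] [MonoidalCategory C]
    [Preadditive C] [Linear k C] where
  F : G → C ⥤ C
  [monoidal (σ : G) : (F σ).Monoidal]
  [additive (σ : G) : (F σ).Additive]
  [linear (σ : G) : (F σ).Linear k]
  γ (σ τ : G) : F τ ⋙ F σ ≅ F (σ * τ)
  γ_monoidal (σ τ : G) : NatTrans.IsMonoidal (γ σ τ).hom
  η : 𝟭 C ≅ F 1
  η_monoidal : NatTrans.IsMonoidal η.hom
  assoc (σ τ ν : G) (X : C) :
    (F σ).map ((γ τ ν).hom.app X) ≫ (γ σ (τ * ν)).hom.app X =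
      (γ σ τ).hom.app ((F ν).obj X) ≫ (γ (σ * τ) ν).hom.app X ≫
        eqToHom (congrArg (fun g => (F g).obj X) (mul_assoc σ τ ν))
  unit_left (σ : G) (X : C) : η.hom.app ((F σ).obj X) ≫ (γ 1 σ).hom.app X =
    eqToHom (congrArg (fun g => (F g).obj X) (one_mul σ).symm)
  unit_right (σ : G) (X : C) : (F σ).map (η.hom.app X) ≫ (γ σ 1).hom.app X =
    eqToHom (congrArg (fun g => (F g).obj X) (mul_one σ).symm)

namespace TensorAction

attribute [instance] monoidal additive linear γ_monoidal η_monoidal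

variable {k G C : Type*} [Field k] [Group G] [Category* C] [MonoidalCategory C]
  [Preadditive C] [Linear k C] (T : TensorAction k G C)

/-- The category `C^G` of equivariant objects. -/
abbrev Equivariantization := Equivariant T.F T.γ

open Functor.LaxMonoidal Functor.OplaxMonoidal

theorem γ_δ (σ τ : G) (X Y : C) :
    (T.γ σ τ).hom.app (X ⊗ Y) ≫ δ (T.F (σ * τ)) X Y =
      (T.F σ).map (δ (T.F τ) X Y) ≫ δ (T.F σ) _ _ ≫
        ((T.γ σ τ).hom.app X ⊗ₘ (T.γ σ τ).hom.app Y) := by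
  have h := NatTrans.IsMonoidal.tensor (τ := (T.γ σ τ).hom) X Y
  have h' := congrArg (fun f => δ (T.F τ ⋙ T.F σ) X Y ≫ f ≫ δ (T.F (σ * τ)) X Y) h
  simpa using h'

/-- The tensor product of equivariant objects: `X ⊗ Y` with `(u_σ ⊗ u'_σ) ∘ ζ_σ⁻¹`. -/
@[simps] def tensor (X Y : T.Equivariantization) : T.Equivariantization where
  obj := X.obj ⊗ Y.obj
  v σ := (Functor.Monoidal.μIso (T.F σ) X.obj Y.obj).symm ≪≫ (X.v σ ⊗ᵢ Y.v σ)
  comm σ τ := by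
    simp only [Iso.trans_hom, Iso.symm_hom, Functor.Monoidal.μIso_inv, tensorIso_hom,
      Functor.map_comp, Category.assoc]
    rw [← Category.assoc, γ_δ]
    simp only [Category.assoc]
    rw [tensorHom_comp_tensorHom, X.comm, Y.comm, ← tensorHom_comp_tensorHom,
      ← Functor.OplaxMonoidal.δ_natural_assoc]

/-- The unit object with the canonical isomorphisms `F_σ(1) ≅ 1`. -/
@[simps] def unit : T.Equivariantization where
  obj := 𝟙_ C
  v σ := (Functor.Monoidal.εIso (T.F σ)).symm
  comm σ τ := by
    have h := NatTrans.IsMonoidal.unit (τ := (T.γ σ τ).hom)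
    have h' := congrArg (fun f => Functor.OplaxMonoidal.η (T.F τ ⋙ T.F σ) ≫ f ≫
      Functor.OplaxMonoidal.η (T.F (σ * τ))) h
    simpa using h'

/-- The tensor product of equivariant morphisms. -/
@[simps] def tensorMap {X X' Y Y' : T.Equivariantization} (f : X ⟶ X') (g : Y ⟶ Y') :
    T.tensor X Y ⟶ T.tensor X' Y' where
  hom := f.hom ⊗ₘ g.hom
  comm σ := tensorMap_comm (T.F σ) f.hom g.hom (f.comm σ) (g.comm σ)

/-- The equivariantization `C^G` as a monoidal category. -/
instance : MonoidalCategory T.Equivariantization where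
  tensorObj := T.tensor
  tensorHom := T.tensorMap
  whiskerLeft X _ _ f := T.tensorMap (𝟙 X) f
  whiskerRight f Y := T.tensorMap f (𝟙 Y)
  tensorUnit := T.unit
  associator X Y Z := Equivariant.mkIso (α_ X.obj Y.obj Z.obj) fun σ =>
    associator_comm (T.F σ) _ _ _
  leftUnitor X := Equivariant.mkIso (λ_ X.obj) fun σ => leftUnitor_comm (T.F σ) _
  rightUnitor X := Equivariant.mkIso (ρ_ X.obj) fun σ => rightUnitor_comm (T.F σ) _
  tensorHom_def f g := by
    ext
    change f.hom ⊗ₘ g.hom = (f.hom ⊗ₘ 𝟙 _) ≫ (𝟙 _ ⊗ₘ g.hom)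
    rw [tensorHom_id, id_tensorHom, MonoidalCategory.tensorHom_def]
  id_tensorHom_id X Y := Equivariant.hom_ext (id_tensorHom_id X.obj Y.obj)
  tensorHom_comp_tensorHom f g f' g' :=
    Equivariant.hom_ext (tensorHom_comp_tensorHom f.hom g.hom f'.hom g'.hom)
  whiskerLeft_id X Y := Equivariant.hom_ext (id_tensorHom_id X.obj Y.obj)
  id_whiskerRight X Y := Equivariant.hom_ext (id_tensorHom_id X.obj Y.obj)
  associator_naturality f g h :=
    Equivariant.hom_ext (associator_naturality f.hom g.hom h.hom)
  leftUnitor_naturality f := by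
    ext
    change (𝟙 _ ⊗ₘ f.hom) ≫ (λ_ _).hom = (λ_ _).hom ≫ f.hom
    simp
  rightUnitor_naturality f := by
    ext
    change (f.hom ⊗ₘ 𝟙 _) ≫ (ρ_ _).hom = (ρ_ _).hom ≫ f.hom
    simp
  pentagon X Y Z W := by
    ext
    change ((α_ X.obj Y.obj Z.obj).hom ⊗ₘ 𝟙 _) ≫ (α_ _ _ _).hom ≫
      (𝟙 _ ⊗ₘ (α_ Y.obj Z.obj W.obj).hom) = (α_ _ _ _).hom ≫ (α_ _ _ _).hom
    simp
  triangle X Y := by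
    ext
    change (α_ X.obj (𝟙_ C) Y.obj).hom ≫ (𝟙 _ ⊗ₘ (λ_ Y.obj).hom) = (ρ_ X.obj).hom ⊗ₘ 𝟙 _
    simp

end TensorAction

/-! ### Module categories -/

section ModuleCategory

variable (k C D E : Type*) [Field k] [Category* C] [MonoidalCategory C] [Preadditive C] [Linear k C]
  [Category* D] [Preadditive D] [Linear k D] [MonoidalLeftAction C D]
  [Category* E] [Preadditive E] [Linear k E] [MonoidalLeftAction C E]

/-- A left action of `C` on `D` makes `D` a `k`-linear module category: `D` is abelian and the
action is a bilinear bifunctor which is exact in each variable. -/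
structure IsModuleCategory : Prop where
  abelian : ∃ h : Abelian D, h.toPreadditive = ‹Preadditive D›
  add_left {X Y : C} (f g : X ⟶ Y) (M : D) : (f + g) ⊵ₗ M = f ⊵ₗ M + g ⊵ₗ M
  smul_left {X Y : C} (r : k) (f : X ⟶ Y) (M : D) : (r • f) ⊵ₗ M = r • (f ⊵ₗ M)
  add_right (X : C) {M N : D} (f g : M ⟶ N) : X ⊴ₗ (f + g) = X ⊴ₗ f + X ⊴ₗ g
  smul_right (X : C) {M N : D} (r : k) (f : M ⟶ N) : X ⊴ₗ (r • f) = r • (X ⊴ₗ f)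
  exact_left (M : D) : Limits.PreservesFiniteLimits (MonoidalLeftAction.actionRight C M) ∧
    Limits.PreservesFiniteColimits (MonoidalLeftAction.actionRight C M)
  exact_right (X : C) : Limits.PreservesFiniteLimits (MonoidalLeftAction.actionLeft D X) ∧
    Limits.PreservesFiniteColimits (MonoidalLeftAction.actionLeft D X)

open Functor.OplaxLeftLinear in
/-- An equivalence of `C`-module categories: `k`-linear module functors `T : D ⥤ E` and `S : E ⥤ D`,
with natural isomorphisms `id ≅ S T` and `id ≅ T S` of module functors. -/
structure ModuleEquivalence where
  T : D ⥤ E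
  S : E ⥤ D
  [additive_T : T.Additive]
  [additive_S : S.Additive]
  [linear_T : T.Linear k]
  [linear_S : S.Linear k]
  [leftLinear_T : T.LeftLinear C]
  [leftLinear_S : S.LeftLinear C]
  isoD : 𝟭 D ≅ T ⋙ S
  isoE : 𝟭 E ≅ S ⋙ T
  isoD_linear (X : C) (M : D) :
    isoD.hom.app (X ⊙ₗ M) ≫ S.map (δₗ T X M) ≫ δₗ S X (T.obj M) = X ⊴ₗ isoD.hom.app M
  isoE_linear (X : C) (M : E) :
    isoE.hom.app (X ⊙ₗ M) ≫ T.map (δₗ S X M) ≫ δₗ T X (S.obj M) = X ⊴ₗ isoE.hom.app M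

end ModuleCategory

open Functor.OplaxMonoidal (δ η)

section Pullback

open MonoidalLeftAction

variable {C C' D : Type*} [Category* C] [MonoidalCategory C] [Category* C']
    [MonoidalCategory C'] [Category* D] [MonoidalLeftAction C' D] (P : C ⥤ C') [P.Monoidal]

/-- The isomorphism `P(X ⊗ Y) ⊗ M ≅ P(X) ⊗ (P(Y) ⊗ M)`. -/
def pullbackAssoc (X Y : C) (M : D) : P.obj (X ⊗ Y) ⊙ₗ M ≅ P.obj X ⊙ₗ (P.obj Y ⊙ₗ M) where
  hom := δ P X Y ⊵ₗ M ≫ (αₗ (P.obj X) (P.obj Y) M).hom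
  inv := (αₗ (P.obj X) (P.obj Y) M).inv ≫ Functor.LaxMonoidal.μ P X Y ⊵ₗ M
  hom_inv_id := by simp [← comp_actionHomLeft]
  inv_hom_id := by simp [← comp_actionHomLeft_assoc]

/-- The isomorphism `P(1) ⊗ M ≅ M`. -/
def pullbackUnit (M : D) : P.obj (𝟙_ C) ⊙ₗ M ≅ M where
  hom := η P ⊵ₗ M ≫ (λₗ M).hom
  inv := (λₗ M).inv ≫ Functor.LaxMonoidal.ε P ⊵ₗ M
  hom_inv_id := by simp [← comp_actionHomLeft]
  inv_hom_id := by simp [← comp_actionHomLeft_assoc]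

theorem pullbackAssoc_hom (X Y : C) (M : D) :
    (pullbackAssoc P X Y M).hom = δ P X Y ⊵ₗ M ≫ (αₗ (P.obj X) (P.obj Y) M).hom := rfl

theorem pullbackUnit_hom (M : D) : (pullbackUnit P M).hom = η P ⊵ₗ M ≫ (λₗ M).hom := rfl

theorem pullbackAssoc_naturality {X X' Y Y' : C} {M M' : D} (f : X ⟶ X') (g : Y ⟶ Y')
    (h : M ⟶ M') : (P.map (f ⊗ₘ g) ⊙ₗₘ h) ≫ (pullbackAssoc P X' Y' M').hom =
      (pullbackAssoc P X Y M).hom ≫ (P.map f ⊙ₗₘ P.map g ⊙ₗₘ h) := by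
  rw [pullbackAssoc_hom, pullbackAssoc_hom, Category.assoc, ← actionAssocIso_hom_naturality,
    ← actionHom_id, ← actionHom_id, ← actionHom_comp_assoc, ← actionHom_comp_assoc,
    Functor.OplaxMonoidal.δ_natural, Category.comp_id, Category.id_comp]

/-- The action of `C` on `D` obtained from an action of `C'` by a monoidal functor `P : C ⥤ C'`: the
object `X` acts as `P(X)`. -/
abbrev pullbackAction : MonoidalLeftAction C D where
  actionObj X M := P.obj X ⊙ₗ M
  actionHomLeft f M := P.map f ⊵ₗ M
  actionHomRight X _ _ g := P.obj X ⊴ₗ g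
  actionHom f g := P.map f ⊙ₗₘ g
  actionAssocIso X Y M := pullbackAssoc P X Y M
  actionUnitIso M := pullbackUnit P M
  actionHom_def f g := actionHom_def _ _
  actionHomRight_id _ _ := actionHomRight_id _ _
  id_actionHomLeft _ _ := by simp
  actionHom_comp _ _ _ _ := by simp
  actionAssocIso_hom_naturality f g h := pullbackAssoc_naturality P f g h
  actionUnitIso_hom_naturality f := by
    rw [pullbackUnit_hom, pullbackUnit_hom, Category.assoc, actionUnitIso_hom_naturality,
      ← action_exchange_assoc]
  whiskerLeft_actionHomLeft X _ _ f M := by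
    rw [← Category.assoc, Iso.eq_comp_inv, ← id_tensorHom, ← actionHom_id, pullbackAssoc_naturality]
    simp
  whiskerRight_actionHomLeft Z f M := by
    rw [← Category.assoc, Iso.eq_comp_inv, ← tensorHom_id, ← actionHom_id, pullbackAssoc_naturality]
    simp
  associator_actionHom X Y Z M := by
    have h := Functor.OplaxMonoidal.associativity P X Y Z
    have h1 : P.map (α_ X Y Z).hom ⊵ₗ M ≫ δ P X (Y ⊗ Z) ⊵ₗ M ≫ (P.obj X ◁ δ P Y Z) ⊵ₗ M =
        δ P (X ⊗ Y) Z ⊵ₗ M ≫ (δ P X Y ▷ P.obj Z) ⊵ₗ M ≫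
          (α_ (P.obj X) (P.obj Y) (P.obj Z)).hom ⊵ₗ M := by
      simp only [← comp_actionHomLeft, h]
    have h2 := MonoidalLeftAction.associator_actionHom (P.obj X) (P.obj Y) (P.obj Z) M
    simp only [pullbackAssoc_hom, Category.assoc, actionHomRight_comp]
    calc _ = P.map (α_ X Y Z).hom ⊵ₗ M ≫ δ P X (Y ⊗ Z) ⊵ₗ M ≫
          ((αₗ _ _ _).hom ≫ P.obj X ⊴ₗ δ P Y Z ⊵ₗ M ≫ (αₗ _ _ _).inv) ≫ (αₗ _ _ _).hom ≫
          P.obj X ⊴ₗ (αₗ (P.obj Y) (P.obj Z) M).hom := by simp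
      _ = (P.map (α_ X Y Z).hom ⊵ₗ M ≫ δ P X (Y ⊗ Z) ⊵ₗ M ≫ (P.obj X ◁ δ P Y Z) ⊵ₗ M) ≫
          (αₗ _ _ _).hom ≫ P.obj X ⊴ₗ (αₗ (P.obj Y) (P.obj Z) M).hom := by
        rw [← MonoidalLeftAction.whiskerLeft_actionHomLeft, Category.assoc, Category.assoc]
      _ = _ := by
        rw [h1, Category.assoc, Category.assoc, h2,
          MonoidalLeftAction.whiskerRight_actionHomLeft]
        simp
  leftUnitor_actionHom X M := by
    have h := congrArg (fun f => f ⊵ₗ M) (Functor.OplaxMonoidal.left_unitality_hom P X)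
    simp only [comp_actionHomLeft] at h
    rw [← h, pullbackAssoc_hom, pullbackUnit_hom]
    simp only [MonoidalLeftAction.leftUnitor_actionHom, Category.assoc, Iso.inv_hom_id_assoc,
      MonoidalLeftAction.whiskerRight_actionHomLeft]
  rightUnitor_actionHom X M := by
    have h := congrArg (fun f => f ⊵ₗ M) (Functor.OplaxMonoidal.right_unitality_hom P X)
    simp only [comp_actionHomLeft] at h
    rw [← h, pullbackAssoc_hom, pullbackUnit_hom]
    simp only [MonoidalLeftAction.rightUnitor_actionHom, Category.assoc, Iso.inv_hom_id_assoc,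
      MonoidalLeftAction.whiskerLeft_actionHomLeft, actionHomRight_comp]

end Pullback

/-- An `F`-equivariant structure on a `C`-module category `D`, for an action of `G` on `C` and a
subgroup `F` of `G`, with underlying endofunctors `U_σ`: the isomorphisms
`c^σ : U_σ(X ⊗ M) ≅ F_σ(X) ⊗ U_σ(M)` make `U_σ` a module functor from `D` to its twist by `F_σ`,
and the isomorphisms `μ_{σ,τ} : U_σ U_τ ≅ U_{στ}` and `id ≅ U_1` of module functors make `U` a
monoidal functor. -/
structure EquivariantStructure {k G C D : Type*} [Field k] [Group G] [Category* C]
    [MonoidalCategory C] [Preadditive C] [Linear k C] (act : TensorAction k G C) (F : Subgroup G)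
    [Category* D] [Preadditive D] [Linear k D] [MonoidalLeftAction C D] (U : F → D ⥤ D)
    [∀ σ, (U σ).Additive] [∀ σ, (U σ).Linear k] where
  c (σ : F) (X : C) (M : D) : (U σ).obj (X ⊙ₗ M) ≅ (act.F σ).obj X ⊙ₗ (U σ).obj M
  c_naturality (σ : F) {X Y : C} {M N : D} (f : X ⟶ Y) (g : M ⟶ N) :
    (U σ).map (f ⊙ₗₘ g) ≫ (c σ Y N).hom = (c σ X M).hom ≫ ((act.F σ).map f ⊙ₗₘ (U σ).map g)
  c_assoc (σ : F) (X Y : C) (M : D) :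
    (U σ).map (αₗ X Y M).hom ≫ (c σ X (Y ⊙ₗ M)).hom ≫ (act.F σ).obj X ⊴ₗ (c σ Y M).hom =
      (c σ (X ⊗ Y) M).hom ≫ δ (act.F σ) X Y ⊵ₗ (U σ).obj M ≫ (αₗ _ _ _).hom
  c_unit (σ : F) (M : D) :
    (c σ (𝟙_ C) M).hom ≫ η (act.F σ) ⊵ₗ (U σ).obj M ≫ (λₗ ((U σ).obj M)).hom =
      (U σ).map (λₗ[C] M).hom
  μ (σ τ : F) : U τ ⋙ U σ ≅ U (σ * τ)
  μ_linear (σ τ : F) (X : C) (M : D) :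
    (μ σ τ).hom.app (X ⊙ₗ M) ≫ (c (σ * τ) X M).hom =
      (U σ).map (c τ X M).hom ≫ (c σ ((act.F τ).obj X) ((U τ).obj M)).hom ≫
        ((act.γ σ τ).hom.app X ⊙ₗₘ (μ σ τ).hom.app M)
  ι : 𝟭 D ≅ U 1
  ι_linear (X : C) (M : D) :
    ι.hom.app (X ⊙ₗ M) ≫ (c 1 X M).hom = act.η.hom.app X ⊙ₗₘ ι.hom.app M
  assoc (σ τ ν : F) (M : D) :
    (U σ).map ((μ τ ν).hom.app M) ≫ (μ σ (τ * ν)).hom.app M =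
      (μ σ τ).hom.app ((U ν).obj M) ≫ (μ (σ * τ) ν).hom.app M ≫
        eqToHom (congrArg (fun g => (U g).obj M) (mul_assoc σ τ ν))
  unit_left (σ : F) (M : D) : ι.hom.app ((U σ).obj M) ≫ (μ 1 σ).hom.app M =
    eqToHom (congrArg (fun g => (U g).obj M) (one_mul σ).symm)
  unit_right (σ : F) (M : D) : (U σ).map (ι.hom.app M) ≫ (μ σ 1).hom.app M =
    eqToHom (congrArg (fun g => (U g).obj M) (mul_one σ).symm)

namespace EquivariantStructure

variable {k G C D : Type*} [Field k] [Group G] [Category* C]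
  [MonoidalCategory C] [Preadditive C] [Linear k C] {act : TensorAction k G C} {F : Subgroup G}
  [Category* D] [Preadditive D] [Linear k D] [MonoidalLeftAction C D] {U : F → D ⥤ D}
  [∀ σ, (U σ).Additive] [∀ σ, (U σ).Linear k] (E : EquivariantStructure act F U)

/-- The category `D^F` of equivariant objects. -/
abbrev Equivariantization := Equivariant U E.μ

open MonoidalLeftAction

/-- The isomorphism `f ⊗ g`. -/
@[simps] def actionIso {X Y : C} {M N : D} (f : X ≅ Y) (g : M ≅ N) : X ⊙ₗ M ≅ Y ⊙ₗ N where
  hom := f.hom ⊙ₗₘ g.hom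
  inv := f.inv ⊙ₗₘ g.inv
  hom_inv_id := by simp [← actionHom_comp]
  inv_hom_id := by simp [← actionHom_comp]

/-- `X ⊗ M` with the isomorphisms `(u_σ ⊗ v_σ) ∘ c^σ`. -/
def actObj (X : act.Equivariantization) (M : E.Equivariantization) : E.Equivariantization where
  obj := X.obj ⊙ₗ M.obj
  v σ := E.c σ X.obj M.obj ≪≫ actionIso (X.v σ) (M.v σ)
  comm σ τ := by
    have h : (act.γ σ τ).hom.app X.obj ≫ (X.v ↑(σ * τ)).hom =
      (act.F σ).map (X.v τ).hom ≫ (X.v σ).hom := X.comm σ τ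
    have h' : ((act.γ σ τ).hom.app X.obj ⊙ₗₘ (E.μ σ τ).hom.app M.obj) ≫
        ((X.v ↑(σ * τ)).hom ⊙ₗₘ (M.v (σ * τ)).hom) =
        ((act.F σ).map (X.v τ).hom ⊙ₗₘ (U σ).map (M.v τ).hom) ≫
          ((X.v σ).hom ⊙ₗₘ (M.v σ).hom) := by
      rw [← actionHom_comp, ← actionHom_comp, ← M.comm]
      exact congrArg (· ⊙ₗₘ _) h
    simp only [Iso.trans_hom, actionIso_hom, Functor.map_comp, Category.assoc]
    rw [← Category.assoc, E.μ_linear, Category.assoc, Category.assoc]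
    refine (congrArg (fun f => (U σ).map (E.c τ X.obj M.obj).hom ≫ (E.c σ _ _).hom ≫ f) h').trans ?_
    rw [← Category.assoc (E.c σ _ _).hom, ← E.c_naturality, Category.assoc]

/-- The action of equivariant morphisms. -/
def actMap {X X' : act.Equivariantization} {M M' : E.Equivariantization} (f : X ⟶ X')
    (g : M ⟶ M') : E.actObj X M ⟶ E.actObj X' M' where
  hom := f.hom ⊙ₗₘ g.hom
  comm σ := by
    change ((E.c σ X.obj M.obj).hom ≫ ((X.v σ).hom ⊙ₗₘ (M.v σ).hom)) ≫ (f.hom ⊙ₗₘ g.hom) =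
      (U σ).map (f.hom ⊙ₗₘ g.hom) ≫ (E.c σ X'.obj M'.obj).hom ≫ ((X'.v σ).hom ⊙ₗₘ (M'.v σ).hom)
    rw [Category.assoc, ← actionHom_comp, f.comm, g.comm, actionHom_comp, ← Category.assoc,
      ← E.c_naturality, Category.assoc]

/-- The action of `C^G` on `D^F`; its associativity and unit isomorphisms are those of `D`. -/
instance : MonoidalLeftAction act.Equivariantization E.Equivariantization where
  actionObj := E.actObj
  actionHom := E.actMap
  actionHomLeft f M := E.actMap f (𝟙 M)
  actionHomRight X _ _ g := E.actMap (𝟙 X) g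
  actionAssocIso X Y M := Equivariant.mkIso (αₗ X.obj Y.obj M.obj) fun σ => by
    change ((E.c σ (X.obj ⊗ Y.obj) M.obj).hom ≫
      ((δ (act.F σ) X.obj Y.obj ≫ ((X.v σ).hom ⊗ₘ (Y.v σ).hom)) ⊙ₗₘ (M.v σ).hom)) ≫
        (αₗ X.obj Y.obj M.obj).hom = (U σ).map (αₗ X.obj Y.obj M.obj).hom ≫
      (E.c σ X.obj (Y.obj ⊙ₗ M.obj)).hom ≫ ((X.v σ).hom ⊙ₗₘ
        ((E.c σ Y.obj M.obj).hom ≫ ((Y.v σ).hom ⊙ₗₘ (M.v σ).hom)))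
    have h1 : (δ (act.F σ) X.obj Y.obj ≫ ((X.v σ).hom ⊗ₘ (Y.v σ).hom)) ⊙ₗₘ (M.v σ).hom =
        δ (act.F σ) X.obj Y.obj ⊵ₗ _ ≫ (((X.v σ).hom ⊗ₘ (Y.v σ).hom) ⊙ₗₘ (M.v σ).hom) := by
      rw [← actionHom_id, ← actionHom_comp, Category.id_comp]
    have h2 : (X.v σ).hom ⊙ₗₘ ((E.c σ Y.obj M.obj).hom ≫ ((Y.v σ).hom ⊙ₗₘ (M.v σ).hom)) =
        (act.F σ).obj X.obj ⊴ₗ (E.c σ Y.obj M.obj).hom ≫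
          ((X.v σ).hom ⊙ₗₘ ((Y.v σ).hom ⊙ₗₘ (M.v σ).hom)) := by
      rw [← id_actionHom, ← actionHom_comp, Category.id_comp]
    rw [h1, h2, Category.assoc, Category.assoc, actionAssocIso_hom_naturality]
    have h3 := congrArg (· ≫ ((X.v σ).hom ⊙ₗₘ ((Y.v σ).hom ⊙ₗₘ (M.v σ).hom)))
      (E.c_assoc σ X.obj Y.obj M.obj)
    simp only [Category.assoc] at h3
    exact h3.symm
  actionUnitIso M := Equivariant.mkIso (λₗ M.obj) fun σ => by
    change ((E.c σ (𝟙_ C) M.obj).hom ≫ (η (act.F σ) ⊙ₗₘ (M.v σ).hom)) ≫ (λₗ M.obj).hom =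
      (U σ).map (λₗ M.obj).hom ≫ (M.v σ).hom
    rw [← E.c_unit, actionHom_def, Category.assoc, Category.assoc, Category.assoc, Category.assoc,
      ← actionUnitIso_hom_naturality]
  actionHom_def f g := by
    ext
    change f.hom ⊙ₗₘ g.hom = (f.hom ⊙ₗₘ 𝟙 _) ≫ (𝟙 _ ⊙ₗₘ g.hom)
    rw [← actionHom_comp, Category.id_comp, Category.comp_id]
  actionHomRight_id X M := Equivariant.hom_ext (by
    change 𝟙 X.obj ⊙ₗₘ 𝟙 M.obj = 𝟙 _
    simp)
  id_actionHomLeft X M := Equivariant.hom_ext (by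
    change 𝟙 X.obj ⊙ₗₘ 𝟙 M.obj = 𝟙 _
    simp)
  actionHom_comp f f' g g' := Equivariant.hom_ext (actionHom_comp f.hom f'.hom g.hom g'.hom)
  actionAssocIso_hom_naturality f g h :=
    Equivariant.hom_ext (actionAssocIso_hom_naturality f.hom g.hom h.hom)
  actionUnitIso_hom_naturality f := by
    ext
    change (λₗ _).hom ≫ f.hom = (𝟙 _ ⊙ₗₘ f.hom) ≫ (λₗ _).hom
    rw [id_actionHom, actionUnitIso_hom_naturality]
  whiskerLeft_actionHomLeft X _ _ f M := by
    ext
    change (𝟙 X.obj ⊗ₘ f.hom) ⊙ₗₘ 𝟙 M.obj =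
      (αₗ _ _ _).hom ≫ (𝟙 X.obj ⊙ₗₘ (f.hom ⊙ₗₘ 𝟙 M.obj)) ≫ (αₗ _ _ _).inv
    simp
  whiskerRight_actionHomLeft Z f M := by
    ext
    change (f.hom ⊗ₘ 𝟙 Z.obj) ⊙ₗₘ 𝟙 M.obj =
      (αₗ _ _ _).hom ≫ (f.hom ⊙ₗₘ 𝟙 (Z.obj ⊙ₗ M.obj)) ≫ (αₗ _ _ _).inv
    simp
  associator_actionHom X Y Z M := by
    ext
    change ((α_ X.obj Y.obj Z.obj).hom ⊙ₗₘ 𝟙 M.obj) ≫ (αₗ _ _ _).hom ≫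
      (𝟙 X.obj ⊙ₗₘ (αₗ Y.obj Z.obj M.obj).hom) = (αₗ _ _ _).hom ≫ (αₗ _ _ _).hom
    simp
  leftUnitor_actionHom X M := by
    ext
    change (λ_ X.obj).hom ⊙ₗₘ 𝟙 M.obj = (αₗ _ _ _).hom ≫ (λₗ _).hom
    simp
  rightUnitor_actionHom X M := by
    ext
    change (ρ_ X.obj).hom ⊙ₗₘ 𝟙 M.obj = (αₗ _ _ _).hom ≫ (𝟙 X.obj ⊙ₗₘ (λₗ _).hom)
    simp

end EquivariantStructure

/-! ### The action of `G` on `Rep(A)`, and the category `Rep(A)^G` -/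

namespace RepCat

section Restrict

variable {s : ModuleSize} {k R R' : Type u} [Field k] [Ring R] [Algebra k R] [Ring R']
  [Algebra k R'] (f : R →ₐ[k] R')

instance : (restrict (s := s) f).Additive where
  map_add := rfl

instance : (restrict (s := s) f).Linear k where
  map_smul _ _ := rfl

theorem eqToHom_val {S : Type*} (f : S → R →ₐ[k] R') {σ τ : S} (h : σ = τ) (X : RepCat s k R') :
    (eqToHom (congrArg (fun g => (restrict (f g)).obj X) h)).1 =
      (LinearMap.id : X.V →ₗ[k] X.V) := by
  subst h
  rfl

end Restrict

end RepCat

namespace CrossedSystem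

open RepCat

variable {k A G : Type u} [Field k] [Ring A] [Algebra k A] [QuasiBialgebra k A]

section Group

variable [Group G] (S : CrossedSystem k A G)

theorem comp_eq_of_key {V W : Type*} [AddCommGroup V] [Module k V] [AddCommGroup W] [Module k W]
    {a : V →ₗ[k] W} {f g : V →ₗ[k] V} {x y z p q r : W →ₗ[k] W} (h1 : a ∘ₗ g = z ∘ₗ a)
    (h2 : a ∘ₗ f = y ∘ₗ a) (key : (x ∘ₗ y) ∘ₗ z = (p ∘ₗ q) ∘ₗ r) :
    ((x ∘ₗ a) ∘ₗ f) ∘ₗ g = (p ∘ₗ q) ∘ₗ r ∘ₗ a := by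
  rw [LinearMap.comp_assoc f a x, h2, ← LinearMap.comp_assoc, LinearMap.comp_assoc g a, h1,
    ← LinearMap.comp_assoc, key, LinearMap.comp_assoc]

/-- The isomorphism `F_σ(X) ⊗ F_σ(Y) ≅ F_σ(X ⊗ Y)` given by `J_σ`. -/
noncomputable def tensorator (σ : G) (X Y : FdRep k A) :
    tensor ((restrict (S.act σ)).obj X) ((restrict (S.act σ)).obj Y) ≅
      (restrict (S.act σ)).obj (tensor X Y) :=
  mkIso (unitEquiv (op X.ρ Y.ρ) (S.J σ)) fun a => by
    have h : op (X.ρ.comp (S.act σ)) (Y.ρ.comp (S.act σ)) (Δ a) =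
      op X.ρ Y.ρ (Algebra.TensorProduct.map (S.act σ) (S.act σ) (Δ a)) := RepCat.op_comp _ _ _ _ _
    change op X.ρ Y.ρ (S.J σ).val ∘ₗ op (X.ρ.comp (S.act σ)) (Y.ρ.comp (S.act σ)) (Δ a) =
      op X.ρ Y.ρ (Δ (S.act σ a)) ∘ₗ op X.ρ Y.ρ (S.J σ).val
    rw [h, ← Module.End.mul_eq_comp, ← Module.End.mul_eq_comp, ← map_mul, ← map_mul, S.comul_act]

theorem tensorator_val (σ : G) (X Y : FdRep k A) :
    (S.tensorator σ X Y).hom.1 = op X.ρ Y.ρ (S.J σ).val := rfl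

/-- The isomorphism `1 ≅ F_σ(1)`. -/
noncomputable def unitor (σ : G) : (unit : FdRep k A) ≅ (restrict (S.act σ)).obj unit :=
  mkIso (LinearEquiv.refl k k) fun a => by
    change scalarAction ε a = scalarAction ε (S.act σ a)
    simp [scalarAction, S.counit_act]

theorem tensorator_naturality (σ : G) {X X' Y Y' : FdRep k A} (f : X ⟶ X') (g : Y ⟶ Y') :
    tensorMap ((restrict (S.act σ)).map f) ((restrict (S.act σ)).map g) ≫
      (S.tensorator σ X' Y').hom = (S.tensorator σ X Y).hom ≫
        (restrict (S.act σ)).map (tensorMap f g) := by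
  ext : 1
  have := map_comp_op (φ := AlgHom.id k A) (ψ := AlgHom.id k A) f.2 g.2 (S.J σ).val
  rw [Algebra.TensorProduct.map_id] at this
  exact this.symm

set_option maxHeartbeats 1000000 in
theorem tensorator_assoc (σ : G) (X Y Z : FdRep k A) :
    tensorMap (S.tensorator σ X Y).hom (𝟙 ((restrict (S.act σ)).obj Z)) ≫
      (S.tensorator σ (tensor X Y) Z).hom ≫ (restrict (S.act σ)).map (RepCat.associator X Y Z).hom =
    (RepCat.associator _ _ _).hom ≫ tensorMap (𝟙 ((restrict (S.act σ)).obj X)) (S.tensorator σ Y Z).hom ≫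
      (S.tensorator σ X (tensor Y Z)).hom := by
  ext : 1
  set φ : A ⊗[k] (A ⊗[k] A) := (Φ : (A ⊗[k] (A ⊗[k] A))ˣ).val
  set O := op X.ρ (op Y.ρ Z.ρ)
  set a := (TensorProduct.assoc k X.V Y.V Z.V).toLinearMap
  have h1 : a ∘ₗ TensorProduct.map (op X.ρ Y.ρ (S.J σ).val) LinearMap.id =
      O (Algebra.TensorProduct.assoc k k k A A A ((S.J σ).val ⊗ₜ 1)) ∘ₗ a := by
    rw [← assoc_comp_op, op_tmul, map_one]
    rfl
  have h2 : a ∘ₗ op ((op X.ρ Y.ρ).comp Δ) Z.ρ (S.J σ).val =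
      O (splitLeft Δ (S.J σ).val) ∘ₗ a := by
    have := RepCat.op_comp (op X.ρ Y.ρ) Z.ρ Δ (AlgHom.id k A) (S.J σ).val
    rw [AlgHom.comp_id] at this
    rw [this, assoc_comp_op]
    rfl
  set P : A ⊗[k] (A ⊗[k] A) →ₐ[k] Module.End k (X.V ⊗[k] (Y.V ⊗[k] Z.V)) :=
    op (X.ρ.comp (S.act σ)) (op (Y.ρ.comp (S.act σ)) (Z.ρ.comp (S.act σ))) with hP
  have h3 : P φ = O (Algebra.TensorProduct.map (S.act σ)
        (Algebra.TensorProduct.map (S.act σ) (S.act σ)) φ) := by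
    rw [hP, ← RepCat.op_comp]
    congr 2
    exact AlgHom.ext fun t => RepCat.op_comp _ _ _ _ t
  have h4 : op X.ρ ((op Y.ρ Z.ρ).comp Δ) (S.J σ).val = O (onRight Δ (S.J σ).val) := by
    have := RepCat.op_comp X.ρ (op Y.ρ Z.ρ) (AlgHom.id k A) Δ (S.J σ).val
    rw [AlgHom.comp_id] at this
    exact this
  have h5 : TensorProduct.map LinearMap.id (op Y.ρ Z.ρ (S.J σ).val) = O (1 ⊗ₜ (S.J σ).val) := by
    rw [op_tmul, map_one]
    rfl
  have e : Algebra.TensorProduct.assoc k k k A A A ((S.J σ).val ⊗ₜ 1) =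
      onRight Algebra.TensorProduct.includeLeft (S.J σ).val := by
    generalize (S.J σ).val = t
    induction t with
    | zero => simp
    | add a b ha hb => simp only [TensorProduct.add_tmul, map_add, ha, hb]
    | tmul a b => simp
  have key := congrArg O (S.twist σ)
  simp only [map_mul, Module.End.mul_eq_comp] at key
  have e1 : ((restrict (S.act σ)).map (RepCat.associator X Y Z).hom).1 = O φ ∘ₗ a := rfl
  have e2 : (S.tensorator σ (tensor X Y) Z).hom.1 =
      op ((op X.ρ Y.ρ).comp Δ) Z.ρ (S.J σ).val := rfl
  have e3 : (tensorMap (S.tensorator σ X Y).hom (𝟙 ((restrict (S.act σ)).obj Z))).1 =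
      TensorProduct.map (op X.ρ Y.ρ (S.J σ).val) LinearMap.id := rfl
  have e4 : (S.tensorator σ X (tensor Y Z)).hom.1 =
      op X.ρ ((op Y.ρ Z.ρ).comp Δ) (S.J σ).val := rfl
  have e5 : (tensorMap (𝟙 ((restrict (S.act σ)).obj X)) (S.tensorator σ Y Z).hom).1 =
      TensorProduct.map LinearMap.id (op Y.ρ Z.ρ (S.J σ).val) := rfl
  have e6 : (RepCat.associator ((restrict (S.act σ)).obj X) ((restrict (S.act σ)).obj Y)
      ((restrict (S.act σ)).obj Z)).hom.1 = P φ ∘ₗ a := rfl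
  have f1 := congrArg₂ LinearMap.comp (congrArg₂ LinearMap.comp e1 e2) e3
  have f2 := congrArg₂ LinearMap.comp (congrArg₂ LinearMap.comp e4 e5) e6
  rw [← h3, ← h4, ← h5] at key
  rw [e] at h1
  have f3 := comp_eq_of_key h1 h2 key
  exact f1.trans (f3.trans f2.symm)

theorem tensorator_unit_left (σ : G) (X : FdRep k A) :
    (RepCat.leftUnitor ((restrict (S.act σ)).obj X)).hom =
      tensorMap (S.unitor σ).hom (𝟙 ((restrict (S.act σ)).obj X)) ≫
        (S.tensorator σ unit X).hom ≫ (restrict (S.act σ)).map (RepCat.leftUnitor X).hom := by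
  ext : 1
  have h := lid_comp_op (ε : A →ₐ[k] k) X.ρ (S.J σ).val
  rw [S.counit_left, map_one] at h
  change (TensorProduct.lid k X.V).toLinearMap = ((TensorProduct.lid k X.V).toLinearMap ∘ₗ
    op (scalarAction ε) X.ρ (S.J σ).val) ∘ₗ TensorProduct.map LinearMap.id LinearMap.id
  rw [h, TensorProduct.map_id]
  rfl

theorem tensorator_unit_right (σ : G) (X : FdRep k A) :
    (RepCat.rightUnitor ((restrict (S.act σ)).obj X)).hom =
      tensorMap (𝟙 ((restrict (S.act σ)).obj X)) (S.unitor σ).hom ≫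
        (S.tensorator σ X unit).hom ≫ (restrict (S.act σ)).map (RepCat.rightUnitor X).hom := by
  ext : 1
  have h := rid_comp_op (ε : A →ₐ[k] k) X.ρ (S.J σ).val
  rw [S.counit_right, map_one] at h
  change (TensorProduct.rid k X.V).toLinearMap = ((TensorProduct.rid k X.V).toLinearMap ∘ₗ
    op X.ρ (scalarAction ε) (S.J σ).val) ∘ₗ TensorProduct.map LinearMap.id LinearMap.id
  rw [h, TensorProduct.map_id]
  rfl

/-- The functor `F_σ` on `Rep(A)`: restriction along `σ_*`. -/
noncomputable abbrev functor (σ : G) : FdRep k A ⥤ FdRep k A := restrict (S.act σ)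

/-- The tensor functor `(F_σ, J_σ)`. -/
noncomputable instance (σ : G) : (S.functor σ).Monoidal :=
  Functor.CoreMonoidal.toMonoidal
    { εIso := S.unitor σ
      μIso := S.tensorator σ
      μIso_hom_natural_left f X := S.tensorator_naturality σ f (𝟙 X)
      μIso_hom_natural_right X f := S.tensorator_naturality σ (𝟙 X) f
      associativity := S.tensorator_assoc σ
      left_unitality := S.tensorator_unit_left σ
      right_unitality := S.tensorator_unit_right σ }

theorem μ_val (σ : G) (X Y : FdRep k A) :
    (Functor.LaxMonoidal.μ (S.functor σ) X Y).1 = op X.ρ Y.ρ (S.J σ).val := rfl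

theorem ε_val (σ : G) :
    (Functor.LaxMonoidal.ε (S.functor σ)).1 = (LinearMap.id : k →ₗ[k] k) := rfl

end Group

end CrossedSystem

namespace CrossedSystem

open RepCat

variable {k A G : Type u} [Field k] [Ring A] [Algebra k A] [QuasiBialgebra k A]
  [CommGroup G] (S : CrossedSystem k A G) 

theorem θ_inv_mul_act (hS : S.Symmetric) (σ τ : G) (a : A) :
    (↑(S.θ σ τ)⁻¹ : A) * S.act τ (S.act σ a) = S.act (σ * τ) a * ↑(S.θ σ τ)⁻¹ := by
  rw [Units.inv_mul_eq_iff_eq_mul, ← mul_assoc, hS σ τ, mul_comm σ τ, S.θ_mul_act, mul_assoc,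
    Units.mul_inv, mul_one]

theorem θ_inv_assoc (hS : S.Symmetric) (σ τ ν : G) :
    (↑(S.θ σ (τ * ν))⁻¹ : A) * ↑(S.θ τ ν)⁻¹ =
      ↑(S.θ (σ * τ) ν)⁻¹ * S.act ν ↑(S.θ σ τ)⁻¹ := by
  have h : S.θ τ ν * S.θ σ (τ * ν) = Units.map (S.act ν).toMonoidHom (S.θ σ τ) * S.θ (σ * τ) ν := by
    ext
    have := S.cocycle ν τ σ
    rw [hS ν τ, hS (ν * τ) σ, hS τ σ, hS ν (τ * σ), mul_comm ν τ, mul_comm τ σ] at this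
    exact this
  have h' := congrArg (fun x : Aˣ => (↑x⁻¹ : A)) h
  simp only [mul_inv_rev, Units.val_mul, ← map_inv] at h'
  exact h'

theorem θ_inv_comul (hS : S.Symmetric) (σ τ : G) :
    Δ (↑(S.θ σ τ)⁻¹ : A) * ((S.J τ).val *
      Algebra.TensorProduct.map (S.act τ) (S.act τ) (S.J σ : A ⊗[k] A)) =
      (S.J (σ * τ)).val * (↑(S.θ σ τ)⁻¹ : A) ⊗ₜ[k] (↑(S.θ σ τ)⁻¹ : A) := by
  have h := S.comul_θ τ σ
  rw [hS τ σ, mul_comm τ σ] at h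
  have h1 : (S.θ σ τ : A) ⊗ₜ[k] (S.θ σ τ : A) * (↑(S.θ σ τ)⁻¹ : A) ⊗ₜ[k] (↑(S.θ σ τ)⁻¹ : A) = 1 := by
    rw [Algebra.TensorProduct.tmul_mul_tmul, Units.mul_inv, Algebra.TensorProduct.one_def]
  have h2 : Δ (↑(S.θ σ τ)⁻¹ : A) * Δ (S.θ σ τ : A) = (1 : A ⊗[k] A) := by
    rw [← map_mul, Units.inv_mul, map_one]
  calc _ = Δ (↑(S.θ σ τ)⁻¹ : A) * ((S.J τ).val *
      Algebra.TensorProduct.map (S.act τ) (S.act τ) (S.J σ : A ⊗[k] A) *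
      ((S.θ σ τ : A) ⊗ₜ[k] (S.θ σ τ : A) * (↑(S.θ σ τ)⁻¹ : A) ⊗ₜ[k] (↑(S.θ σ τ)⁻¹ : A))) := by
        rw [h1, mul_one]
    _ = Δ (↑(S.θ σ τ)⁻¹ : A) * (Δ (S.θ σ τ : A) * (S.J (σ * τ) : A ⊗[k] A)) *
        (↑(S.θ σ τ)⁻¹ : A) ⊗ₜ[k] (↑(S.θ σ τ)⁻¹ : A) := by rw [h]; simp only [mul_assoc]
    _ = _ := by rw [← mul_assoc, h2, one_mul]

theorem counit_θ_inv (σ τ : G) : (ε (↑(S.θ σ τ)⁻¹ : A) : k) = 1 := by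
  have h : (ε (S.θ σ τ : A) : k) * ε (↑(S.θ σ τ)⁻¹ : A) = 1 := by
    rw [← map_mul, Units.mul_inv, map_one]
  rwa [S.counit_θ, one_mul] at h

/-- The isomorphism `F_σ F_τ ≅ F_{στ}` given by `θ_{σ,τ}⁻¹`. -/
noncomputable def compIso (hS : S.Symmetric) (σ τ : G) :
    S.functor τ ⋙ S.functor σ ≅ S.functor (σ * τ) :=
  NatIso.ofComponents (fun X => mkIso (unitEquiv X.ρ (S.θ σ τ)⁻¹) fun a => by
    change X.ρ ↑(S.θ σ τ)⁻¹ * X.ρ (S.act τ (S.act σ a)) = X.ρ (S.act (σ * τ) a) * X.ρ ↑(S.θ σ τ)⁻¹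
    rw [← map_mul, ← map_mul, S.θ_inv_mul_act hS])
    fun {X Y} f => Subtype.ext (f.2 ↑(S.θ σ τ)⁻¹).symm

theorem compIso_val (hS : S.Symmetric) (σ τ : G) (X : FdRep k A) :
    ((S.compIso hS σ τ).hom.app X).1 = X.ρ ↑(S.θ σ τ)⁻¹ := rfl

/-- The isomorphism `id ≅ F_1`, which is the identity. -/
noncomputable def idIso : 𝟭 (FdRep k A) ≅ S.functor 1 :=
  NatIso.ofComponents (fun X => mkIso (LinearEquiv.refl k X.V) fun a => by
    change X.ρ a = X.ρ (S.act 1 a)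
    rw [S.act_one]
    rfl)
    fun _ => rfl

theorem idIso_val (X : FdRep k A) : (S.idIso.hom.app X).1 = (LinearMap.id : X.V →ₗ[k] X.V) := rfl

/-- The action of `G` on `Rep(A)` given by a symmetric crossed system: `F_σ` is the restriction along
`σ_*`, with tensor structure `J_σ`, and `γ_{σ,τ} = θ_{σ,τ}⁻¹`. -/
noncomputable def action (hS : S.Symmetric) : TensorAction k G (FdRep k A) where
  F := S.functor
  γ := S.compIso hS
  γ_monoidal σ τ :=
    { unit := by
        ext : 1
        change scalarAction (ε : A →ₐ[k] k) (↑(S.θ σ τ)⁻¹ : A) ∘ₗ LinearMap.id ∘ₗ LinearMap.id = LinearMap.id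
        rw [scalarAction, AlgHom.comp_apply, S.counit_θ_inv, map_one]
        rfl
      tensor X Y := by
        ext : 1
        have h : op (X.ρ.comp (S.act τ)) (Y.ρ.comp (S.act τ)) (S.J σ).val =
          op X.ρ Y.ρ (Algebra.TensorProduct.map (S.act τ) (S.act τ) (S.J σ).val) :=
          RepCat.op_comp _ _ _ _ _
        change op X.ρ Y.ρ (Δ ↑(S.θ σ τ)⁻¹) * (op X.ρ Y.ρ (S.J τ).val *
          op (X.ρ.comp (S.act τ)) (Y.ρ.comp (S.act τ)) (S.J σ).val) =
            op X.ρ Y.ρ (S.J (σ * τ)).val * op X.ρ Y.ρ (↑(S.θ σ τ)⁻¹ ⊗ₜ ↑(S.θ σ τ)⁻¹)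
        rw [h, ← map_mul, ← map_mul, ← map_mul, S.θ_inv_comul hS] }
  η := S.idIso
  η_monoidal :=
    { unit := rfl
      tensor X Y := by
        ext : 1
        change LinearMap.id ∘ₗ LinearMap.id = op X.ρ Y.ρ (S.J 1).val ∘ₗ
          TensorProduct.map LinearMap.id LinearMap.id
        rw [S.J_one, Units.val_one, map_one, TensorProduct.map_id]
        rfl }
  assoc σ τ ν X := by
    ext : 1
    have h := eqToHom_val S.act (mul_assoc σ τ ν) X
    have e : ((S.compIso hS σ τ).hom.app ((S.functor ν).obj X) ≫
        (S.compIso hS (σ * τ) ν).hom.app X ≫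
        eqToHom (congrArg (fun g => (S.functor g).obj X) (mul_assoc σ τ ν))).1 =
      (LinearMap.id ∘ₗ X.ρ ↑(S.θ (σ * τ) ν)⁻¹) ∘ₗ X.ρ (S.act ν ↑(S.θ σ τ)⁻¹) :=
      congrArg (fun f => (f ∘ₗ X.ρ ↑(S.θ (σ * τ) ν)⁻¹) ∘ₗ X.ρ (S.act ν ↑(S.θ σ τ)⁻¹)) h
    refine Eq.trans ?_ e.symm
    change X.ρ ↑(S.θ σ (τ * ν))⁻¹ * X.ρ ↑(S.θ τ ν)⁻¹ =
      X.ρ ↑(S.θ (σ * τ) ν)⁻¹ * X.ρ (S.act ν ↑(S.θ σ τ)⁻¹)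
    rw [← map_mul, ← map_mul, S.θ_inv_assoc hS]
  unit_left σ X := by
    ext : 1
    refine Eq.trans ?_ (eqToHom_val S.act (one_mul σ).symm X).symm
    change X.ρ ↑(S.θ 1 σ)⁻¹ ∘ₗ LinearMap.id = LinearMap.id
    rw [S.θ_one_left, inv_one, Units.val_one, map_one]
    rfl
  unit_right σ X := by
    ext : 1
    refine Eq.trans ?_ (eqToHom_val S.act (mul_one σ).symm X).symm
    change X.ρ ↑(S.θ σ 1)⁻¹ ∘ₗ LinearMap.id = LinearMap.id
    rw [S.θ_one_right, inv_one, Units.val_one, map_one]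
    rfl

end CrossedSystem

namespace CrossedSystem

open RepCat

variable {k A G : Type u} [Field k] [Ring A] [Algebra k A] [QuasiBialgebra k A]
  [CommGroup G] (S : CrossedSystem k A G) (hS : S.Symmetric)

section Smash

variable {S hS}

/-- The linear automorphism `u_σ` of an object `(X, u)` of `Rep(A)^G`. -/
def equivariantUnit (X : (S.action hS).Equivariantization) (σ : G) : (Module.End k X.obj.V)ˣ where
  val := (X.v σ).hom.1
  inv := (X.v σ).inv.1
  val_inv := congrArg (fun f : X.obj ⟶ X.obj => f.1) (X.v σ).inv_hom_id
  inv_val := congrArg (fun f : (S.functor σ).obj X.obj ⟶ (S.functor σ).obj X.obj => f.1)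
    (X.v σ).hom_inv_id

/-- The inverse `u_σ⁻¹` of the linear automorphism `u_σ`. -/
def invEnd (X : (S.action hS).Equivariantization) (σ : G) : Module.End k X.obj.V :=
  (equivariantUnit X σ).inv

theorem equivariantUnit_mul (X : (S.action hS).Equivariantization) (σ τ : G) :
    equivariantUnit X (σ * τ) * (Units.map X.obj.ρ.toMonoidHom (S.θ σ τ))⁻¹ =
      equivariantUnit X σ * equivariantUnit X τ := by
  ext : 1
  exact congrArg (fun f : (S.functor σ).obj ((S.functor τ).obj X.obj) ⟶ X.obj => f.1) (X.comm σ τ)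

theorem equivariantUnit_one (X : (S.action hS).Equivariantization) : equivariantUnit X 1 = 1 := by
  have h := equivariantUnit_mul X 1 1
  rw [S.θ_one_left, map_one, inv_one, mul_one, mul_one] at h
  exact (mul_eq_left.mp h.symm)

theorem invEnd_one (X : (S.action hS).Equivariantization) : invEnd X 1 = 1 := by
  have := congrArg (fun x : (Module.End k X.obj.V)ˣ => (↑x⁻¹ : Module.End k X.obj.V))
    (equivariantUnit_one X)
  rw [inv_one] at this
  exact this

theorem equivariantUnit_inv_mul (X : (S.action hS).Equivariantization) (σ τ : G) :
    (equivariantUnit X σ)⁻¹ * (equivariantUnit X τ)⁻¹ =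
      Units.map X.obj.ρ.toMonoidHom (S.θ σ τ) * (equivariantUnit X (σ * τ))⁻¹ := by
  rw [← mul_inv_rev, ← equivariantUnit_mul, mul_inv_rev, inv_inv, mul_comm τ σ, hS τ σ]

theorem invEnd_mul (X : (S.action hS).Equivariantization) (σ : G) (a : A) :
    invEnd X σ * X.obj.ρ a = X.obj.ρ (S.act σ a) * invEnd X σ := (X.v σ).inv.2 a

theorem invEnd_mul_invEnd (X : (S.action hS).Equivariantization) (σ τ : G) :
    invEnd X σ * invEnd X τ = X.obj.ρ (S.θ σ τ) * invEnd X (σ * τ) :=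
  congrArg Units.val (equivariantUnit_inv_mul X σ τ)

/-- The algebra map `A # G → End(X)`, `(a # σ) ↦ a u_σ⁻¹`, for an object `(X, u)` of `Rep(A)^G`. -/
noncomputable def smashAction (X : (S.action hS).Equivariantization) :
    S.toFactorSystem.Crossed →ₐ[k] Module.End k X.obj.V :=
  S.lift X.obj.ρ (invEnd X)
    (invEnd_one X)
    (invEnd_mul X)
    (invEnd_mul_invEnd X)

theorem smashAction_incl (X : (S.action hS).Equivariantization) (σ : G) (a : A) :
    smashAction X (S.incl σ a) = X.obj.ρ a * invEnd X σ := by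
  rw [smashAction, FactorSystem.lift_incl]

theorem smashAction_inclOne (X : (S.action hS).Equivariantization) (a : A) :
    smashAction X (S.inclOne a) = X.obj.ρ a := by
  rw [FactorSystem.inclOne_apply, smashAction_incl, invEnd_one, mul_one]

theorem equivariantUnit_comm {X Y : (S.action hS).Equivariantization} (f : X ⟶ Y) (σ : G) :
    f.hom.1 ∘ₗ invEnd X σ = invEnd Y σ ∘ₗ f.hom.1 := by
  have h : (X.v σ).inv ≫ ((S.action hS).F σ).map f.hom = f.hom ≫ (Y.v σ).inv := by
    rw [Iso.inv_comp_eq, ← Category.assoc, Iso.eq_comp_inv]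
    exact (f.comm σ).symm
  exact congrArg (fun f : X.obj ⟶ ((S.action hS).F σ).obj Y.obj => f.1) h

end Smash

/-- The functor `Rep(A)^G ⥤ Rep(A # G)`: `(X, u)` is sent to `X` with `(a # σ) x = a u_σ⁻¹(x)`. -/
noncomputable def toSmash :
    (S.action hS).Equivariantization ⥤ FdRep k S.toFactorSystem.Crossed where
  obj X := ⟨X.obj.V, smashAction X, X.obj.admits⟩
  map {X Y} f := ⟨f.hom.1, fun z => by
    change f.hom.1 ∘ₗ smashAction X z = smashAction Y z ∘ₗ f.hom.1
    induction z using FactorSystem.induction with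
    | h0 => simp
    | h2 a b ha hb => simp only [map_add, LinearMap.comp_add, LinearMap.add_comp, ha, hb]
    | h1 σ a =>
      rw [smashAction_incl, smashAction_incl]
      have h1 : f.hom.1 ∘ₗ invEnd X σ = invEnd Y σ ∘ₗ f.hom.1 := equivariantUnit_comm f σ
      rw [Module.End.mul_eq_comp, Module.End.mul_eq_comp, ← LinearMap.comp_assoc, f.hom.2,
        LinearMap.comp_assoc, LinearMap.comp_assoc]
      exact congrArg (fun g => Y.obj.ρ a ∘ₗ g) h1⟩

variable {S hS} in
theorem op_smashAction_incl₂ (X Y : (S.action hS).Equivariantization) (σ : G) (t : A ⊗[k] A) :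
    op (smashAction X) (smashAction Y)
        (incl₂ S.toFactorSystem S.toFactorSystem (MonoidHom.id G) σ t) =
      op X.obj.ρ Y.obj.ρ t * TensorProduct.map (invEnd X σ) (invEnd Y σ) := by
  induction t with
  | zero => simp
  | add a b ha hb => simp only [map_add, ha, hb, add_mul]
  | tmul a b =>
    simp only [incl₂, TensorProduct.map_tmul, op_tmul, MonoidHom.id_apply, smashAction_incl]
    exact TensorProduct.map_mul _ _ _ _

variable {S hS} in
theorem op_smashAction_inclOne₃ (X Y Z : (S.action hS).Equivariantization)
    (t : A ⊗[k] (A ⊗[k] A)) :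
    op (smashAction X) (op (smashAction Y) (smashAction Z))
        (inclOne₃ S.toFactorSystem S.toFactorSystem t) =
      op X.obj.ρ (op Y.obj.ρ Z.obj.ρ) t := by
  induction t with
  | zero => simp
  | add a b ha hb => simp only [map_add, ha, hb]
  | tmul a t =>
    induction t with
    | zero => simp
    | add a b ha hb => simp only [TensorProduct.tmul_add, map_add, ha, hb]
    | tmul b c =>
      simp only [inclOne₃, inclOne₂, Algebra.TensorProduct.map_tmul, op_tmul, smashAction_inclOne]

/-- The isomorphism `𝓕(X) ⊗ 𝓕(Y) ≅ 𝓕(X ⊗ Y)`, which is the identity on the vector space `X ⊗ Y`. -/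
noncomputable def toSmashTensor (X Y : (S.action hS).Equivariantization) :
    tensor ((S.toSmash hS).obj X) ((S.toSmash hS).obj Y) ≅ (S.toSmash hS).obj (X ⊗ Y) :=
  mkIso (LinearEquiv.refl k (X.obj.V ⊗[k] Y.obj.V)) fun z => by
    change op (smashAction X) (smashAction Y) (crossedCoact S.isCoactionDatum z) =
      smashAction (X ⊗ Y) z
    induction z using FactorSystem.induction with
    | h0 => rw [map_zero, map_zero]; exact (map_zero _).symm
    | h2 a b ha hb => rw [map_add, map_add, ha, hb]; exact (map_add _ _ _).symm
    | h1 σ a =>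
      rw [smashAction_incl, crossedCoact_incl, op_smashAction_incl₂, map_mul, mul_assoc]
      rfl

/-- The isomorphism `1 ≅ 𝓕(1)`, which is the identity of `k`. -/
noncomputable def toSmashUnit :
    (unit : FdRep k S.toFactorSystem.Crossed) ≅ (S.toSmash hS).obj (𝟙_ _) :=
  mkIso (LinearEquiv.refl k k) fun z => by
    change scalarAction S.counit z = smashAction (𝟙_ ((S.action hS).Equivariantization)) z
    induction z using FactorSystem.induction with
    | h0 => rw [map_zero]; exact (map_zero _).symm
    | h2 a b ha hb => rw [map_add, ha, hb]; exact (map_add _ _ _).symm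
    | h1 σ a =>
      rw [smashAction_incl, scalarAction, AlgHom.comp_apply, S.counit_incl]
      rfl

theorem toSmash_associativity (X Y Z : (S.action hS).Equivariantization) :
    (S.toSmashTensor hS X Y).hom ▷ (S.toSmash hS).obj Z ≫ (S.toSmashTensor hS (X ⊗ Y) Z).hom ≫
        (S.toSmash hS).map (α_ X Y Z).hom =
      (α_ ((S.toSmash hS).obj X) ((S.toSmash hS).obj Y) ((S.toSmash hS).obj Z)).hom ≫
        (S.toSmash hS).obj X ◁ (S.toSmashTensor hS Y Z).hom ≫
          (S.toSmashTensor hS X (Y ⊗ Z)).hom := by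
  have h := op_smashAction_inclOne₃ X Y Z (Φ : (A ⊗[k] (A ⊗[k] A))ˣ).val
  set a := (TensorProduct.assoc k X.obj.V Y.obj.V Z.obj.V).toLinearMap
  have h1 : (α_ X.obj Y.obj Z.obj).hom.1 = op X.obj.ρ (op Y.obj.ρ Z.obj.ρ)
    (Φ : (A ⊗[k] (A ⊗[k] A))ˣ).val ∘ₗ a := rfl
  have h2 : (α_ ((S.toSmash hS).obj X) ((S.toSmash hS).obj Y) ((S.toSmash hS).obj Z)).hom.1 =
    op (smashAction X) (op (smashAction Y) (smashAction Z))
      (inclOne₃ S.toFactorSystem S.toFactorSystem (Φ : (A ⊗[k] (A ⊗[k] A))ˣ).val) ∘ₗ a := rfl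
  rw [h, ← h1] at h2
  apply RepCat.hom_ext
  have e1 : ((S.toSmashTensor hS X Y).hom ▷ (S.toSmash hS).obj Z).1 =
    (LinearMap.id : (X.obj.V ⊗[k] Y.obj.V) ⊗[k] Z.obj.V →ₗ[k] _) := TensorProduct.map_id
  have e2 : ((S.toSmash hS).obj X ◁ (S.toSmashTensor hS Y Z).hom).1 =
    (LinearMap.id : X.obj.V ⊗[k] (Y.obj.V ⊗[k] Z.obj.V) →ₗ[k] _) := TensorProduct.map_id
  have e3 : (α_ X.obj Y.obj Z.obj).hom.1 ∘ₗ
      ((S.toSmashTensor hS X Y).hom ▷ (S.toSmash hS).obj Z).1 =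
    ((S.toSmash hS).obj X ◁ (S.toSmashTensor hS Y Z).hom).1 ∘ₗ
      (α_ ((S.toSmash hS).obj X) ((S.toSmash hS).obj Y) ((S.toSmash hS).obj Z)).hom.1 := by
    rw [e1, e2, h2]
    rfl
  exact e3

theorem toSmash_left_unitality (X : (S.action hS).Equivariantization) :
    (λ_ ((S.toSmash hS).obj X)).hom = (S.toSmashUnit hS).hom ▷ (S.toSmash hS).obj X ≫
      (S.toSmashTensor hS (𝟙_ _) X).hom ≫ (S.toSmash hS).map (λ_ X).hom := by
  apply RepCat.hom_ext
  have e1 : ((S.toSmashUnit hS).hom ▷ (S.toSmash hS).obj X).1 =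
    (LinearMap.id : k ⊗[k] X.obj.V →ₗ[k] _) := TensorProduct.map_id
  have e2 : (λ_ ((S.toSmash hS).obj X)).hom.1 =
    (λ_ X.obj).hom.1 ∘ₗ ((S.toSmashUnit hS).hom ▷ (S.toSmash hS).obj X).1 := by
    rw [e1]
    rfl
  exact e2

theorem toSmash_right_unitality (X : (S.action hS).Equivariantization) :
    (ρ_ ((S.toSmash hS).obj X)).hom = (S.toSmash hS).obj X ◁ (S.toSmashUnit hS).hom ≫
      (S.toSmashTensor hS X (𝟙_ _)).hom ≫ (S.toSmash hS).map (ρ_ X).hom := by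
  apply RepCat.hom_ext
  have e1 : ((S.toSmash hS).obj X ◁ (S.toSmashUnit hS).hom).1 =
    (LinearMap.id : X.obj.V ⊗[k] k →ₗ[k] _) := TensorProduct.map_id
  have e2 : (ρ_ ((S.toSmash hS).obj X)).hom.1 =
    (ρ_ X.obj).hom.1 ∘ₗ ((S.toSmash hS).obj X ◁ (S.toSmashUnit hS).hom).1 := by
    rw [e1]
    rfl
  exact e2

/-- The functor `Rep(A)^G ⥤ Rep(A # G)` is monoidal. -/
noncomputable instance : (S.toSmash hS).Monoidal :=
  Functor.CoreMonoidal.toMonoidal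
    { εIso := S.toSmashUnit hS
      μIso := S.toSmashTensor hS
      μIso_hom_natural_left _ _ := rfl
      μIso_hom_natural_right _ _ := rfl
      associativity := S.toSmash_associativity hS
      left_unitality := S.toSmash_left_unitality hS
      right_unitality := S.toSmash_right_unitality hS }

end CrossedSystem

/-- The action of `Rep(A)^G` on the category of `K # F`-modules: `(X, u)` acts as the representation
of `A # G` which corresponds to it, and `K # F` is an `A # G`-comodule algebra. -/
noncomputable instance ComoduleCrossedSystem.smashModuleCategory {k A K G : Type u} [Field k]
    [Ring A] [Algebra k A] [QuasiBialgebra k A] [CommGroup G] {S : CrossedSystem k A G}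
    {hS : S.Symmetric} [Ring K] [Algebra k K] [ComoduleAlgebra k A K] {F : Subgroup G}
    (T : ComoduleCrossedSystem S K F) (s : ModuleSize) :
    MonoidalLeftAction (S.action hS).Equivariantization (RepCat s k T.toFactorSystem.Crossed) :=
  pullbackAction (S.toSmash hS)

end QuasiHopf

open QuasiHopf

/-! The heart of the matter is that an `F`-equivariant `K`-module and a `K # F`-module are the same
vector space with the same operators. Since `v_σ : U_σ(M) → M` is `K`-linear, `v_σ⁻¹ x = σ̄(x)
v_σ⁻¹`, and this is the relation `(1 # σ)(x # 1) = (σ̄(x) # 1)(1 # σ)`. So `x # σ` should act as `x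
v_σ⁻¹`, and conversely `v_σ` should be the action of `(1 # σ)⁻¹`. Inverting `v_{στ} θ̄_{σ,τ}⁻¹ = v_σ
v_τ` reverses the order of the factors; commutativity of the group and symmetry of `θ̄` restore it,
so that the `v_σ⁻¹` multiply like the `1 # σ`. Both passages keep the vector space, and the unit and
counit of the equivalence (`FactorSystem.crossedEquivalence`) are identities of vector spaces.

The equivalence respects the action of `Rep(A)^G`. Through the coaction of `K # F`, the element `x #
σ` acts on `X ⊗ M` as `λ(x) J̄_σ (u_σ⁻¹ ⊗ v_σ⁻¹)`, which is `λ(x)` times the inverse of `(u_σ ⊗ v_σ)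
c^σ` because `c^σ` is the action of `J̄_σ⁻¹`. Hence the identity of `X ⊗ M` is an isomorphism of the
two structures (`toSmashIso`, `fromSmashIso`). The associators agree since that of `K # F` lives in
degree `1`, where `x # 1` acts as `x`.

The equivariant structure on `K`-modules is a dictionary: each axiom of a compatible crossed system,
applied as an operator on a tensor product of modules, is one of the required diagrams. The twist
identity gives the associativity of `c^σ` (`tensorator_assoc`), the counit condition its unitality,
the formula for `λ(θ̄_{σ,τ})` the linearity of `μ_{σ,τ}` (`J_inv_coact`), and the cocycle identity
the associativity of `μ` (`FactorSystem.θ_inv_assoc`).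

For the module category axioms, kernels and cokernels of modules are those of the underlying vector
spaces, and tensoring over a field is exact (`RepCat.isModuleCategory`). Applied to the
quasi-bialgebra `A # G` and its comodule algebra `K # F`, this gives a `Rep(A # G)`-module category,
which is pulled back along `Rep(A)^G → Rep(A # G)`; the latter is exact, being itself an instance of
the first equivalence. Equivariant modules then inherit the axioms through the equivalence
(`ModuleEquivalence.isModuleCategory`). -/

namespace QuasiHopf

/-! ### Modules of a given size form an abelian category -/

namespace RepCat

open Limits

section Abelian

variable {s : ModuleSize} {k R : Type u} [Field k] [Ring R] [Algebra k R]

theorem admits_submodule {V : Type*} [AddCommGroup V] [Module k V] (h : s.Admits k V)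
    (W : Submodule k V) : s.Admits k W := by
  cases s with
  | all => trivial
  | finite =>
    have : FiniteDimensional k V := h
    exact (inferInstance : FiniteDimensional k W)

theorem admits_quotient {V : Type*} [AddCommGroup V] [Module k V] (h : s.Admits k V)
    (W : Submodule k V) : s.Admits k (V ⧸ W) := by
  cases s with
  | all => trivial
  | finite =>
    have : FiniteDimensional k V := h
    exact (inferInstance : FiniteDimensional k (V ⧸ W))

theorem admits_prod {V W : Type*} [AddCommGroup V] [Module k V] [AddCommGroup W] [Module k W]
    (hV : s.Admits k V) (hW : s.Admits k W) : s.Admits k (V × W) := by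
  cases s with
  | all => trivial
  | finite =>
    have : FiniteDimensional k V := hV
    have : FiniteDimensional k W := hW
    exact (inferInstance : FiniteDimensional k (V × W))

theorem hom_apply {X Y : RepCat s k R} (f : X ⟶ Y) (a : R) (x : X.V) :
    f.1 (X.ρ a x) = Y.ρ a (f.1 x) := LinearMap.congr_fun (f.2 a) x

/-- The submodule carried by a stable subspace. -/
def sub (X : RepCat s k R) (W : Submodule k X.V) (hW : ∀ a, ∀ x ∈ W, X.ρ a x ∈ W) :
    RepCat s k R where
  V := W
  ρ := AlgHom.ofLinearMap
    { toFun a := (X.ρ a).restrict (hW a)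
      map_add' a b := by ext; simp
      map_smul' r a := by ext; simp }
    (by ext; simp) (fun a b => by ext; simp)
  admits := admits_submodule X.admits W

/-- The quotient module by a stable subspace. -/
def quot (X : RepCat s k R) (W : Submodule k X.V) (hW : ∀ a, ∀ x ∈ W, X.ρ a x ∈ W) :
    RepCat s k R where
  V := X.V ⧸ W
  ρ := AlgHom.ofLinearMap
    { toFun a := W.mapQ W (X.ρ a) (hW a)
      map_add' a b := by ext; simp
      map_smul' r a := by ext; simp }
    (by ext; simp) (fun a b => by ext; simp)
  admits := admits_quotient X.admits W

/-- The inclusion of a submodule. -/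
def subι (X : RepCat s k R) (W : Submodule k X.V) (hW : ∀ a, ∀ x ∈ W, X.ρ a x ∈ W) :
    X.sub W hW ⟶ X := ⟨W.subtype, fun _ => rfl⟩

/-- The projection to a quotient module. -/
def quotπ (X : RepCat s k R) (W : Submodule k X.V) (hW : ∀ a, ∀ x ∈ W, X.ρ a x ∈ W) :
    X ⟶ X.quot W hW := ⟨W.mkQ, fun _ => rfl⟩

theorem ker_stable {X Y : RepCat s k R} (f : X ⟶ Y) (a : R) :
    ∀ x ∈ LinearMap.ker f.1, X.ρ a x ∈ LinearMap.ker f.1 := fun x hx => by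
  rw [LinearMap.mem_ker, hom_apply, LinearMap.mem_ker.mp hx, map_zero]

theorem range_stable {X Y : RepCat s k R} (f : X ⟶ Y) (a : R) :
    ∀ y ∈ LinearMap.range f.1, Y.ρ a y ∈ LinearMap.range f.1 := by
  rintro _ ⟨x, rfl⟩
  exact ⟨X.ρ a x, hom_apply f a x⟩

theorem comp_eq_zero {X Y Z : RepCat s k R} {f : X ⟶ Y} {g : Y ⟶ Z}
    (h : Function.Exact f.1 g.1) : f ≫ g = 0 := by
  ext : 1
  exact h.linearMap_comp_eq_zero

theorem apply_eq_zero {X Y Z : RepCat s k R} {f : X ⟶ Y} {g : Y ⟶ Z}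
    (h : f ≫ g = 0) (x : X.V) : g.1 (f.1 x) = 0 :=
  LinearMap.congr_fun (congrArg Subtype.val h) x

/-- An injective map onto the kernel of `f` is a kernel of `f`. -/
noncomputable def isLimitOfExact {X Y Z : RepCat s k R} {i : X ⟶ Y} {f : Y ⟶ Z}
    (h : Function.Exact i.1 f.1) (hi : Function.Injective i.1) :
    IsLimit (KernelFork.ofι i (comp_eq_zero h)) :=
  have key {W : RepCat s k R} (g : W ⟶ Y) (w : g ≫ f = 0) : ∃ l : W ⟶ X, l ≫ i = g := by
    -- Preimages under `i` are chosen point by point. Injectivity of `i` makes them unique, so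
    -- linearity and equivariance of `l` can be checked after applying `i`.
    choose l hl using fun x => (h (g.1 x)).mp (apply_eq_zero w x)
    refine ⟨⟨⟨⟨l, fun x y => hi ?_⟩, fun r x => hi ?_⟩, fun a => ?_⟩, ?_⟩
    · simp [hl]
    · simp [hl]
    · ext x
      apply hi
      change i.1 (l (W.ρ a x)) = i.1 (X.ρ a (l x))
      rw [hl, hom_apply, hom_apply, hl]
    · ext x
      exact hl x
  KernelFork.IsLimit.ofι _ _ (fun g w => (key g w).choose) (fun g w => (key g w).choose_spec)
    (fun g w m hm => by
      ext x
      apply hi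
      have h1 := LinearMap.congr_fun (congrArg Subtype.val hm) x
      have h2 := LinearMap.congr_fun (congrArg Subtype.val (key g w).choose_spec) x
      exact h1.trans h2.symm)

/-- A surjective map whose kernel is the range of `f` is a cokernel of `f`. -/
noncomputable def isColimitOfExact {X Y Z : RepCat s k R} {f : X ⟶ Y} {p : Y ⟶ Z}
    (h : Function.Exact f.1 p.1) (hp : Function.Surjective p.1) :
    IsColimit (CokernelCofork.ofπ p (comp_eq_zero h)) :=
  have key {W : RepCat s k R} (g : Y ⟶ W) (w : f ≫ g = 0) : ∃ l : Z ⟶ W, p ≫ l = g := by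
    -- `g` is constant on the fibres of `p`. Therefore `g ∘ l` is a module map for any set-theoretic
    -- section `l` of `p`, whatever the choice.
    have hg (y y' : Y.V) (e : p.1 y = p.1 y') : g.1 y = g.1 y' := by
      have : p.1 (y - y') = 0 := by rw [map_sub, e, sub_self]
      obtain ⟨x, hx⟩ := (h _).mp this
      have := apply_eq_zero w x
      rw [hx, map_sub] at this
      exact sub_eq_zero.mp this
    choose l hl using hp
    refine ⟨⟨⟨⟨fun z => g.1 (l z), fun x y => ?_⟩, fun r x => ?_⟩, fun a => ?_⟩, ?_⟩
    · rw [← map_add]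
      exact hg _ _ (by simp [hl])
    · rw [RingHom.id_apply, ← map_smul]
      exact hg _ _ (by simp [hl])
    · ext x
      change g.1 (l (Z.ρ a x)) = W.ρ a (g.1 (l x))
      rw [← hom_apply]
      exact hg _ _ (by rw [hl, hom_apply, hl])
    · ext x
      exact hg _ _ (hl _)
  CokernelCofork.IsColimit.ofπ _ _ (fun g w => (key g w).choose)
    (fun g w => (key g w).choose_spec)
    (fun g w m hm => by
      ext z
      obtain ⟨y, rfl⟩ := hp z
      have h1 := LinearMap.congr_fun (congrArg Subtype.val hm) y
      have h2 := LinearMap.congr_fun (congrArg Subtype.val (key g w).choose_spec) y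
      exact h1.trans h2.symm)

theorem exact_subι_ker {X Y : RepCat s k R} (f : X ⟶ Y) :
    Function.Exact (X.subι _ (ker_stable f)).1 f.1 := LinearMap.exact_subtype_ker_map f.1

theorem exact_quotπ_range {X Y : RepCat s k R} (f : X ⟶ Y) :
    Function.Exact f.1 (Y.quotπ _ (range_stable f)).1 := LinearMap.exact_map_mkQ_range f.1

theorem subι_injective (X : RepCat s k R) (W : Submodule k X.V) (hW) :
    Function.Injective (X.subι W hW).1 := W.injective_subtype

theorem quotπ_surjective (X : RepCat s k R) (W : Submodule k X.V) (hW) :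
    Function.Surjective (X.quotπ W hW).1 := W.mkQ_surjective

instance : HasKernels (RepCat s k R) where
  has_limit f := ⟨⟨⟨_, isLimitOfExact (exact_subι_ker f) (subι_injective _ _ _)⟩⟩⟩

instance : HasCokernels (RepCat s k R) where
  has_colimit f := ⟨⟨⟨_, isColimitOfExact (exact_quotπ_range f) (quotπ_surjective _ _ _)⟩⟩⟩

/-- The inclusion of the kernel composes with `f` to zero, so it is zero when `f` can be cancelled.
-/
theorem injective_of_mono {X Y : RepCat s k R} (f : X ⟶ Y) [Mono f] :
    Function.Injective f.1 := by
  have h : X.subι _ (ker_stable f) = 0 :=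
    zero_of_comp_mono f (comp_eq_zero (exact_subι_ker f))
  rw [← LinearMap.ker_eq_bot, Submodule.eq_bot_iff]
  exact fun x hx => LinearMap.congr_fun (congrArg Subtype.val h) ⟨x, hx⟩

/-- Dually, the projection modulo the range is zero, which puts every vector in the range. -/
theorem surjective_of_epi {X Y : RepCat s k R} (f : X ⟶ Y) [Epi f] :
    Function.Surjective f.1 := by
  have h : Y.quotπ _ (range_stable f) = 0 :=
    zero_of_epi_comp f (comp_eq_zero (exact_quotπ_range f))
  intro y
  have := LinearMap.congr_fun (congrArg Subtype.val h) y
  exact (Submodule.Quotient.mk_eq_zero _).mp this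

/-- The zero module. -/
def zero : RepCat s k R where
  V := PUnit
  ρ := AlgHom.ofLinearMap 0 (Subsingleton.elim _ _) (fun _ _ => Subsingleton.elim _ _)
  admits := by
    cases s with
    | all => trivial
    | finite => exact (inferInstance : FiniteDimensional k PUnit)

instance : HasZeroObject (RepCat s k R) where
  zero := ⟨zero, (IsZero.iff_id_eq_zero _).mpr
    (Subtype.ext (LinearMap.ext fun _ => Subsingleton.elim (α := PUnit) _ _))⟩

/-- The direct sum of two modules. -/
def prod (X Y : RepCat s k R) : RepCat s k R where
  V := X.V × Y.V
  ρ := AlgHom.ofLinearMap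
    { toFun a := (X.ρ a).prodMap (Y.ρ a)
      map_add' a b := by ext <;> simp
      map_smul' r a := by ext <;> simp }
    (by ext <;> simp) (fun a b => by ext <;> simp)
  admits := admits_prod X.admits Y.admits

instance : HasBinaryBiproducts (RepCat s k R) where
  has_binary_biproduct X Y := hasBinaryBiproduct_of_total
    { pt := prod X Y
      fst := ⟨LinearMap.fst k X.V Y.V, fun _ => rfl⟩
      snd := ⟨LinearMap.snd k X.V Y.V, fun _ => rfl⟩
      inl := ⟨LinearMap.inl k X.V Y.V, fun a => LinearMap.ext fun x =>
        Prod.ext rfl (map_zero (Y.ρ a)).symm⟩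
      inr := ⟨LinearMap.inr k X.V Y.V, fun a => LinearMap.ext fun x =>
        Prod.ext (map_zero (X.ρ a)).symm rfl⟩ }
    -- The one identity left for a biproduct: the two composites projection followed by inclusion
    -- add up to the identity.
    (by
      ext x
      exact Prod.ext (add_zero _) (zero_add _))

instance : HasFiniteProducts (RepCat s k R) :=
  hasFiniteProducts_of_has_binary_and_terminal

/-- A monomorphism is injective, hence a kernel of the projection modulo its range; an epimorphism
is surjective, hence a cokernel of the inclusion of its kernel. -/
noncomputable instance : Abelian (RepCat s k R) where
  normalMonoOfMono f _ := ⟨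
    { Z := _
      g := quotπ _ _ (range_stable f)
      w := comp_eq_zero (exact_quotπ_range f)
      isLimit := isLimitOfExact (exact_quotπ_range f) (injective_of_mono f) }⟩
  normalEpiOfEpi f _ := ⟨
    { W := _
      g := subι _ _ (ker_stable f)
      w := comp_eq_zero (exact_subι_ker f)
      isColimit := isColimitOfExact (exact_subι_ker f) (surjective_of_epi f) }⟩

end Abelian

/-! ### Exactness of functors, tested on vector spaces -/

section Exact

variable {s s' : ModuleSize} {k R R' : Type u} [Field k] [Ring R] [Algebra k R] [Ring R']
  [Algebra k R'] (F : RepCat s k R ⥤ RepCat s' k R')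

/-- An additive functor out of an abelian category preserves finite limits as soon as it preserves
kernels. This turns exactness into a statement about linear maps, to which the results on tensor
products of vector spaces apply. -/
theorem preservesFiniteLimits_of_exact [F.Additive]
    (h : ∀ {X Y Z : RepCat s k R} (i : X ⟶ Y) (f : Y ⟶ Z), Function.Exact i.1 f.1 →
      Function.Injective i.1 →
        Function.Exact (F.map i).1 (F.map f).1 ∧ Function.Injective (F.map i).1) :
    PreservesFiniteLimits F := by
  have : ∀ {X Y : RepCat s k R} (f : X ⟶ Y), PreservesLimit (parallelPair f 0) F := fun f => by
    have e := exact_subι_ker f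
    obtain ⟨h1, h2⟩ := h _ f e (subι_injective _ _ _)
    -- Preservation may be checked on a single limit cone, here the concrete kernel.
    exact preservesLimit_of_preserves_limit_cone (isLimitOfExact e (subι_injective _ _ _))
      ((KernelFork.isLimitMapConeEquiv _ F).symm (isLimitOfExact h1 h2))
  exact Functor.preservesFiniteLimits_of_preservesKernels F

theorem preservesFiniteColimits_of_exact [F.Additive]
    (h : ∀ {X Y Z : RepCat s k R} (f : X ⟶ Y) (p : Y ⟶ Z), Function.Exact f.1 p.1 →
      Function.Surjective p.1 →
        Function.Exact (F.map f).1 (F.map p).1 ∧ Function.Surjective (F.map p).1) :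
    PreservesFiniteColimits F := by
  have : ∀ {X Y : RepCat s k R} (f : X ⟶ Y), PreservesColimit (parallelPair f 0) F := fun f => by
    have e := exact_quotπ_range f
    obtain ⟨h1, h2⟩ := h f _ e (quotπ_surjective _ _ _)
    exact preservesColimit_of_preserves_colimit_cocone
      (isColimitOfExact e (quotπ_surjective _ _ _))
      ((CokernelCofork.isColimitMapCoconeEquiv _ F).symm (isColimitOfExact h1 h2))
  exact Functor.preservesFiniteColimits_of_preservesCokernels F

end Exact

/-! ### The action of `Rep(A)` is bilinear and exact in each variable -/

section ModuleCategory

open MonoidalLeftAction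

variable (s : ModuleSize) (k A K : Type u) [Field k] [Ring A] [Algebra k A] [QuasiBialgebra k A]
  [Ring K] [Algebra k K] [ComoduleAlgebra k A K]

instance (M : RepCat s k K) : (actionRight (FdRep k A) M).Additive where
  map_add {_ _ f g} := Subtype.ext (TensorProduct.map_add_left f.1 g.1 LinearMap.id)

instance (X : FdRep k A) : (actionLeft (RepCat s k K) X).Additive where
  map_add {_ _ f g} := Subtype.ext (TensorProduct.map_add_right LinearMap.id f.1 g.1)

/-- The category of `K`-modules is a `Rep(A)`-module category. -/
theorem isModuleCategory : IsModuleCategory k (FdRep k A) (RepCat s k K) where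
  -- The abelian structure was built on top of the given additive structure on morphisms, so the two
  -- agree by definition.
  abelian := ⟨inferInstance, rfl⟩
  add_left f g _ := Subtype.ext (TensorProduct.map_add_left f.1 g.1 LinearMap.id)
  smul_left r f _ := Subtype.ext (TensorProduct.map_smul_left r f.1 LinearMap.id)
  add_right _ _ _ f g := Subtype.ext (TensorProduct.map_add_right LinearMap.id f.1 g.1)
  smul_right _ _ _ r f := Subtype.ext (TensorProduct.map_smul_right r LinearMap.id f.1)
  -- Only the underlying linear maps matter: vector spaces are flat, which gives the left exactness,
  -- and tensor products are always right exact.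
  exact_left M :=
    ⟨preservesFiniteLimits_of_exact _ fun i _ h hi =>
      ⟨Module.Flat.rTensor_exact M.V h,
        Module.Flat.rTensor_preserves_injective_linearMap i.1 hi⟩,
    preservesFiniteColimits_of_exact _ fun _ _ h hp =>
      ⟨rTensor_exact M.V h hp, LinearMap.rTensor_surjective M.V hp⟩⟩
  exact_right X :=
    ⟨preservesFiniteLimits_of_exact _ fun i _ h hi =>
      ⟨Module.Flat.lTensor_exact X.V h,
        Module.Flat.lTensor_preserves_injective_linearMap i.1 hi⟩,
    preservesFiniteColimits_of_exact _ fun _ _ h hp =>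
      ⟨lTensor_exact X.V h hp, LinearMap.lTensor_surjective X.V hp⟩⟩

end ModuleCategory

end RepCat

end QuasiHopf

/-! ### Equivariant modules are modules over the crossed product -/

namespace QuasiHopf

namespace FactorSystem

open RepCat

variable {s : ModuleSize} {k R S : Type u} [Field k] [Ring R] [Algebra k R] [CommGroup S]
  (c : FactorSystem k R S)

/-- The products of `1 # σ` with `1 # σ⁻¹` in both orders are `θ_{σ,σ⁻¹} # 1` and `θ_{σ⁻¹,σ} # 1`,
which are invertible. This yields a right inverse and a left inverse, which need not be compared. -/
theorem isUnit_incl (σ : S) : IsUnit (c.incl σ 1) := by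
  have key (τ ν : S) (h : τ * ν = 1) : c.incl τ 1 * c.incl ν 1 = c.inclOne (c.θ τ ν) := by
    rw [incl_mul_incl, map_one, one_mul, one_mul, h, inclOne_apply]
  have hr (τ ν : S) : c.inclOne (c.θ τ ν : R) * c.inclOne (↑(c.θ τ ν)⁻¹ : R) = 1 := by
    rw [← map_mul, Units.mul_inv, map_one]
  have hl (τ ν : S) : c.inclOne (↑(c.θ τ ν)⁻¹ : R) * c.inclOne (c.θ τ ν : R) = 1 := by
    rw [← map_mul, Units.inv_mul, map_one]
  rw [isUnit_iff_exists_and_exists]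
  refine ⟨⟨c.incl σ⁻¹ 1 * c.inclOne ↑(c.θ σ σ⁻¹)⁻¹, ?_⟩,
    ⟨c.inclOne ↑(c.θ σ⁻¹ σ)⁻¹ * c.incl σ⁻¹ 1, ?_⟩⟩
  · rw [← mul_assoc, key _ _ (mul_inv_cancel σ), hr]
  · rw [mul_assoc, key _ _ (inv_mul_cancel σ), hl]

/-- The invertible element `1 # σ`. -/
noncomputable def unitIncl (σ : S) : c.Crossedˣ := (c.isUnit_incl σ).unit

theorem unitIncl_val (σ : S) : (c.unitIncl σ : c.Crossed) = c.incl σ 1 := rfl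

theorem unitIncl_mul_inclOne (σ : S) (x : R) :
    (c.unitIncl σ : c.Crossed) * c.inclOne x = c.inclOne (c.act σ x) * c.unitIncl σ := by
  rw [unitIncl_val, incl_mul_inclOne, inclOne_mul_incl, one_mul, mul_one]

/-- The commutation relation solved for the inverse. It says that `(1 # σ)⁻¹` acts on an `R #
S`-module `N` as an `R`-linear map `U_σ(N) → N`, which is what a structure map `v_σ` has to be. -/
theorem inv_unitIncl_mul_inclOne (σ : S) (x : R) :
    (↑(c.unitIncl σ)⁻¹ : c.Crossed) * c.inclOne (c.act σ x) =
      c.inclOne x * ↑(c.unitIncl σ)⁻¹ := by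
  rw [Units.inv_mul_eq_iff_eq_mul, ← mul_assoc, c.unitIncl_mul_inclOne, mul_assoc, Units.mul_inv,
    mul_one]

theorem unitIncl_mul (σ τ : S) :
    c.unitIncl σ * c.unitIncl τ = Units.map c.inclOne.toMonoidHom (c.θ σ τ) * c.unitIncl (σ * τ) := by
  ext
  change c.incl σ 1 * c.incl τ 1 = c.inclOne (c.θ σ τ) * c.incl (σ * τ) 1
  rw [incl_mul_incl, inclOne_mul_incl, map_one, one_mul, one_mul, mul_one]

/-- This is the equivariance condition `v_{στ} μ_{σ,τ} = v_σ U_σ(v_τ)` for `v_σ = (1 # σ)⁻¹`. It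
comes from inverting the product of `1 # τ` and `1 # σ`, taken in this order; commutativity and the
symmetry of `θ` then exchange `σ` and `τ` on the other side. -/
theorem inv_unitIncl_mul (hc : c.Symmetric) (σ τ : S) :
    (↑(c.unitIncl (σ * τ))⁻¹ : c.Crossed) * c.inclOne (↑(c.θ σ τ)⁻¹ : R) =
      ↑(c.unitIncl σ)⁻¹ * ↑(c.unitIncl τ)⁻¹ := by
  have h := c.unitIncl_mul τ σ
  rw [hc τ σ, mul_comm τ σ] at h
  have h' := congrArg (fun x : c.Crossedˣ => (↑x⁻¹ : c.Crossed)) h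
  simp only [mul_inv_rev, Units.val_mul, ← map_inv] at h'
  exact h'.symm

/-- Restriction is contravariant: on `U_σ U_τ(M)` the element `a` acts as `τ_*(σ_*(a))`, whereas
`θ_{σ,τ}` compares `(στ)_*` with `σ_* τ_*`. Symmetry and commutativity bridge the gap, and make
`θ_{σ,τ}⁻¹` a module map `U_σ U_τ → U_{στ}`. -/
theorem θ_inv_mul_act (hc : c.Symmetric) (σ τ : S) (a : R) :
    (↑(c.θ σ τ)⁻¹ : R) * c.act τ (c.act σ a) = c.act (σ * τ) a * ↑(c.θ σ τ)⁻¹ := by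
  rw [Units.inv_mul_eq_iff_eq_mul, ← mul_assoc, hc σ τ, mul_comm σ τ, c.θ_mul_act, mul_assoc,
    Units.mul_inv, mul_one]

/-- The associativity of `compIso`. For the same contravariance, it is the cocycle identity of the
reversed triple `(ν, τ, σ)`, inverted, with the arguments of each `θ` exchanged. -/
theorem θ_inv_assoc (hc : c.Symmetric) (σ τ ν : S) :
    (↑(c.θ σ (τ * ν))⁻¹ : R) * ↑(c.θ τ ν)⁻¹ =
      ↑(c.θ (σ * τ) ν)⁻¹ * c.act ν ↑(c.θ σ τ)⁻¹ := by
  have h : c.θ τ ν * c.θ σ (τ * ν) = Units.map (c.act ν).toMonoidHom (c.θ σ τ) * c.θ (σ * τ) ν := by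
    ext
    have := c.cocycle ν τ σ
    rw [hc ν τ, hc (ν * τ) σ, hc τ σ, hc ν (τ * σ), mul_comm ν τ, mul_comm τ σ] at this
    exact this
  have h' := congrArg (fun x : Rˣ => (↑x⁻¹ : R)) h
  simp only [mul_inv_rev, Units.val_mul, ← map_inv] at h'
  exact h'

variable (hc : c.Symmetric)

/-- The isomorphism `U_σ U_τ ≅ U_{στ}` given by `θ_{σ,τ}⁻¹`, where `U_σ` is the restriction along
`σ_*`. -/
noncomputable def compIso (σ τ : S) :
    (restrict (c.act τ) : RepCat s k R ⥤ RepCat s k R) ⋙ restrict (c.act σ) ≅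
      restrict (c.act (σ * τ)) :=
  NatIso.ofComponents (fun X => mkIso (unitEquiv X.ρ (c.θ σ τ)⁻¹) fun a => by
    change X.ρ ↑(c.θ σ τ)⁻¹ * X.ρ (c.act τ (c.act σ a)) = X.ρ (c.act (σ * τ) a) * X.ρ ↑(c.θ σ τ)⁻¹
    rw [← map_mul, ← map_mul, c.θ_inv_mul_act hc])
    -- Naturality: a module map commutes with the action of every element of `R`, in particular with
    -- `θ_{σ,τ}⁻¹`.
    fun {X Y} f => Subtype.ext (f.2 ↑(c.θ σ τ)⁻¹).symm

/-- The isomorphism `id ≅ U_1`, which is the identity. -/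
noncomputable def idIso : 𝟭 (RepCat s k R) ≅ restrict (c.act 1) :=
  NatIso.ofComponents (fun X => mkIso (LinearEquiv.refl k X.V) fun a => by
    change X.ρ a = X.ρ (c.act 1 a)
    rw [c.act_one]
    rfl)
    fun _ => rfl

variable (s) in
/-- The category of `R`-modules which are equivariant under the restrictions along the `σ_*`. -/
abbrev EquivariantModule :=
  Equivariant (fun σ : S => (restrict (c.act σ) : RepCat s k R ⥤ RepCat s k R)) (c.compIso hc)

variable {c hc}

/-- The linear automorphism `v_σ` of an equivariant module `(M, v)`. -/
def autUnit (M : c.EquivariantModule s hc) (σ : S) : (Module.End k M.obj.V)ˣ where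
  val := (M.v σ).hom.1
  inv := (M.v σ).inv.1
  val_inv := congrArg (fun f : M.obj ⟶ M.obj => f.1) (M.v σ).inv_hom_id
  inv_val := congrArg (fun f : (restrict (c.act σ)).obj M.obj ⟶ (restrict (c.act σ)).obj M.obj =>
    f.1) (M.v σ).hom_inv_id

/-- The inverse `v_σ⁻¹` of the linear automorphism `v_σ`. -/
def autInv (M : c.EquivariantModule s hc) (σ : S) : Module.End k M.obj.V := (autUnit M σ).inv

/-- The equivariance condition read in the group of units of `End(M)`, where inverting and
cancelling are available. -/
theorem autUnit_mul (M : c.EquivariantModule s hc) (σ τ : S) :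
    autUnit M (σ * τ) * (Units.map M.obj.ρ.toMonoidHom (c.θ σ τ))⁻¹ =
      autUnit M σ * autUnit M τ := by
  ext : 1
  exact congrArg (fun f : (restrict (c.act σ)).obj ((restrict (c.act τ)).obj M.obj) ⟶ M.obj => f.1)
    (M.comm σ τ)

/-- The normalisation `v_1 = id` is not part of the definition of an equivariant object. It follows
from `v_1 = v_1 v_1`, since `θ_{1,1} = 1` and `v_1` is invertible. -/
theorem autInv_one (M : c.EquivariantModule s hc) : autInv M 1 = 1 := by
  have h := autUnit_mul M 1 1
  rw [c.θ_one_left, map_one, inv_one, mul_one, mul_one] at h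
  have := congrArg (fun x : (Module.End k M.obj.V)ˣ => (↑x⁻¹ : Module.End k M.obj.V))
    (mul_eq_left.mp h.symm)
  rw [inv_one] at this
  exact this

/-- The `R`-linearity of `v_σ⁻¹ : M → U_σ(M)`. -/
theorem autInv_mul (M : c.EquivariantModule s hc) (σ : S) (a : R) :
    autInv M σ * M.obj.ρ a = M.obj.ρ (c.act σ a) * autInv M σ := (M.v σ).inv.2 a

/-- Inversion turns `v_τ v_σ` into `v_σ⁻¹ v_τ⁻¹`, and the symmetry of `θ` in the commutative group
`S` makes this the product rule of the elements `1 # σ`. With `autInv_one` and `autInv_mul` it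
completes the hypotheses of `FactorSystem.lift`. -/
theorem autInv_mul_autInv (M : c.EquivariantModule s hc) (σ τ : S) :
    autInv M σ * autInv M τ = M.obj.ρ (c.θ σ τ) * autInv M (σ * τ) := by
  have h : (autUnit M σ)⁻¹ * (autUnit M τ)⁻¹ =
      Units.map M.obj.ρ.toMonoidHom (c.θ σ τ) * (autUnit M (σ * τ))⁻¹ := by
    rw [← mul_inv_rev, ← autUnit_mul, mul_inv_rev, inv_inv, mul_comm τ σ, hc τ σ]
  exact congrArg Units.val h

/-- The algebra map `R # S → End(M)`, `(x # σ) ↦ x v_σ⁻¹`. -/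
noncomputable def crossedAction (M : c.EquivariantModule s hc) :
    c.Crossed →ₐ[k] Module.End k M.obj.V :=
  c.lift M.obj.ρ (autInv M) (autInv_one M) (autInv_mul M) (autInv_mul_autInv M)

theorem crossedAction_incl (M : c.EquivariantModule s hc) (σ : S) (a : R) :
    crossedAction M (c.incl σ a) = M.obj.ρ a * autInv M σ := by
  rw [crossedAction, FactorSystem.lift_incl]

theorem crossedAction_inclOne (M : c.EquivariantModule s hc) (a : R) :
    crossedAction M (c.inclOne a) = M.obj.ρ a := by
  rw [FactorSystem.inclOne_apply, crossedAction_incl, autInv_one, mul_one]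

theorem autInv_comm {M N : c.EquivariantModule s hc} (f : M ⟶ N) (σ : S) :
    f.hom.1 ∘ₗ autInv M σ = autInv N σ ∘ₗ f.hom.1 := by
  have h : (M.v σ).inv ≫ (restrict (c.act σ)).map f.hom = f.hom ≫ (N.v σ).inv := by
    rw [Iso.inv_comp_eq, ← Category.assoc, Iso.eq_comp_inv]
    exact (f.comm σ).symm
  exact congrArg (fun f : M.obj ⟶ (restrict (c.act σ)).obj N.obj => f.1) h

/-- As `1 # σ` acts by `v_σ⁻¹`, its inverse acts by `v_σ`. Hence the structure maps of `(M, v)` are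
recovered from the `R # S`-module. -/
theorem crossedAction_inv_unitIncl (M : c.EquivariantModule s hc) (σ : S) :
    crossedAction M (↑(c.unitIncl σ)⁻¹ : c.Crossed) = (M.v σ).hom.1 := by
  have h : Units.map (crossedAction M).toMonoidHom (c.unitIncl σ) = (autUnit M σ)⁻¹ := by
    ext : 1
    change crossedAction M (c.incl σ 1) = autInv M σ
    rw [crossedAction_incl, map_one, one_mul]
  have h' := congrArg (fun x : (Module.End k M.obj.V)ˣ => (↑x⁻¹ : Module.End k M.obj.V)) h
  simp only [← map_inv, inv_inv] at h'
  exact h'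

variable (c hc) (s)

/-- An equivariant module `(M, v)` is a module over `R # S` through `(x # σ) m = x v_σ⁻¹(m)`. -/
noncomputable def toCrossed : c.EquivariantModule s hc ⥤ RepCat s k c.Crossed where
  obj M := ⟨M.obj.V, crossedAction M, M.obj.admits⟩
  map {M N} f := ⟨f.hom.1, fun z => by
    change f.hom.1 ∘ₗ crossedAction M z = crossedAction N z ∘ₗ f.hom.1
    induction z using FactorSystem.induction with
    | h0 => simp
    | h2 a b ha hb => simp only [map_add, LinearMap.comp_add, LinearMap.add_comp, ha, hb]
    | h1 σ a =>
      rw [crossedAction_incl, crossedAction_incl]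
      have h1 : f.hom.1 ∘ₗ autInv M σ = autInv N σ ∘ₗ f.hom.1 := autInv_comm f σ
      rw [Module.End.mul_eq_comp, Module.End.mul_eq_comp, ← LinearMap.comp_assoc, f.hom.2,
        LinearMap.comp_assoc, LinearMap.comp_assoc]
      exact congrArg (fun g => N.obj.ρ a ∘ₗ g) h1⟩

/-- A module over `R # S` is an equivariant module, with `v_σ` the action of `(1 # σ)⁻¹`. -/
noncomputable def fromCrossed : RepCat s k c.Crossed ⥤ c.EquivariantModule s hc where
  obj N :=
    { obj := (restrict c.inclOne).obj N
      v σ := mkIso (unitEquiv N.ρ (c.unitIncl σ)⁻¹) fun a => by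
        change N.ρ ↑(c.unitIncl σ)⁻¹ * N.ρ (c.inclOne (c.act σ a)) =
          N.ρ (c.inclOne a) * N.ρ ↑(c.unitIncl σ)⁻¹
        rw [← map_mul, ← map_mul, c.inv_unitIncl_mul_inclOne]
      comm σ τ := by
        ext : 1
        change N.ρ ↑(c.unitIncl (σ * τ))⁻¹ * N.ρ (c.inclOne ↑(c.θ σ τ)⁻¹) =
          N.ρ ↑(c.unitIncl σ)⁻¹ * N.ρ ↑(c.unitIncl τ)⁻¹
        rw [← map_mul, ← map_mul, c.inv_unitIncl_mul hc] }
  -- Equivariance of `f` is its linearity with respect to the single element `(1 # σ)⁻¹`.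
  map f := ⟨(restrict c.inclOne).map f, fun σ => Subtype.ext (f.2 ↑(c.unitIncl σ)⁻¹)⟩

/-- The equivariant module obtained from `(M, v)` through `R # S` is `(M, v)`. -/
noncomputable def toCrossedFromCrossed :
    𝟭 (c.EquivariantModule s hc) ≅ c.toCrossed s hc ⋙ c.fromCrossed s hc :=
  NatIso.ofComponents (fun M => Equivariant.mkIso
    (mkIso (LinearEquiv.refl k M.obj.V) fun a => (crossedAction_inclOne M a).symm)
    fun σ => Subtype.ext (crossedAction_inv_unitIncl M σ).symm) fun _ => rfl

/-- The `R # S`-module obtained from `N` through equivariant modules is `N`. -/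
noncomputable def fromCrossedToCrossed :
    𝟭 (RepCat s k c.Crossed) ≅ c.fromCrossed s hc ⋙ c.toCrossed s hc :=
  NatIso.ofComponents (fun N => mkIso (LinearEquiv.refl k N.V) fun z => by
    change N.ρ z = crossedAction ((c.fromCrossed s hc).obj N) z
    induction z using FactorSystem.induction with
    | h0 => rw [map_zero, map_zero]; rfl
    | h2 a b ha hb => rw [map_add, map_add, ha, hb]; rfl
    | h1 σ a =>
      rw [crossedAction_incl]
      -- Here `v_σ` is the action of `(1 # σ)⁻¹`, so `v_σ⁻¹` is by definition the action of `1 # σ`;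
      -- what remains is `a # σ = (a # 1)(1 # σ)`.
      change N.ρ (c.incl σ a) = N.ρ (c.inclOne a) * N.ρ (c.incl σ 1)
      rw [← map_mul, inclOne_mul_incl, mul_one]) fun _ => rfl

/-- Equivariant modules are the same as modules over the crossed product. -/
noncomputable def crossedEquivalence : c.EquivariantModule s hc ≌ RepCat s k c.Crossed :=
  CategoryTheory.Equivalence.mk (c.toCrossed s hc) (c.fromCrossed s hc)
    (c.toCrossedFromCrossed s hc) (c.fromCrossedToCrossed s hc).symm

instance : (c.toCrossed s hc).IsEquivalence := (c.crossedEquivalence s hc).isEquivalence_functor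

end FactorSystem

end QuasiHopf

/-! ### Transfer of module categories along equivalences and monoidal functors -/

namespace QuasiHopf

open Limits MonoidalLeftAction

section Transfer

variable {k C C' D E : Type*} [Field k] [Category* C] [MonoidalCategory C] [Preadditive C]
  [Linear k C] [Category* C'] [MonoidalCategory C'] [Preadditive C'] [Linear k C']
  [Category* D] [Preadditive D] [Linear k D] [MonoidalLeftAction C D]
  [Category* E] [Preadditive E] [Linear k E] [MonoidalLeftAction C E]

/-- A functor which becomes exact after composition with an equivalence is exact. -/
theorem exact_of_comp_equivalence {B D E : Type*} [Category* B] [Category* D] [Category* E]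
    {H : B ⥤ D} (T : D ⥤ E) [T.IsEquivalence] {H' : B ⥤ E} (e : H' ≅ H ⋙ T)
    (h : PreservesFiniteLimits H' ∧ PreservesFiniteColimits H') :
    PreservesFiniteLimits H ∧ PreservesFiniteColimits H := by
  obtain ⟨h1, h2⟩ := h
  have := preservesFiniteLimits_of_natIso e
  have := preservesFiniteColimits_of_natIso e
  -- The composite `H ⋙ T` is exact, being isomorphic to `H'`, and the equivalence `T` reflects
  -- limits and colimits.
  exact ⟨⟨fun J => preservesLimitsOfShape_of_reflects_of_preserves H T⟩,
    ⟨fun J => preservesColimitsOfShape_of_reflects_of_preserves H T⟩⟩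

open Functor.OplaxLeftLinear in
/-- A category with an action of `C` which is equivalent to a module category is a module
category. -/
theorem ModuleEquivalence.isModuleCategory (Θ : ModuleEquivalence k C D E)
    (h : IsModuleCategory k C E) : IsModuleCategory k C D := by
  have : Θ.T.IsEquivalence :=
    (CategoryTheory.Equivalence.mk Θ.T Θ.S Θ.isoD Θ.isoE.symm).isEquivalence_functor
  have := Θ.additive_T
  have := Θ.linear_T
  have := Θ.leftLinear_T
  -- `T` is faithful and `T(X ⊗ M) ≅ X ⊗ T(M)`, so identities between maps into `X ⊗ M` may be
  -- tested in `E`. The naturality of `δₗ` then moves the action across `T`, and each bilinearity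
  -- axiom becomes the same axiom for `E`.
  have inj {X : C} {M : D} {N : D} {f g : N ⟶ X ⊙ₗ M}
      (e : Θ.T.map f ≫ δₗ Θ.T X M = Θ.T.map g ≫ δₗ Θ.T X M) : f = g :=
    Θ.T.map_injective ((cancel_mono _).mp e)
  refine ⟨?_, fun f g M => inj ?_, fun r f M => inj ?_, fun X {M N} f g => inj ?_,
    fun X {M N} r f => inj ?_, fun M => ?_, fun X => ?_⟩
  · obtain ⟨hE, e⟩ := h.abelian
    -- The additive structure of `E` is replaced by the one which underlies its abelian structure,
    -- so that the latter can be used.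
    subst e
    have : HasFiniteProducts D :=
      ⟨fun _ => Adjunction.hasLimitsOfShape_of_equivalence Θ.T⟩
    exact ⟨abelianOfEquivalence Θ.T, rfl⟩
  · simp only [Functor.map_add, Preadditive.add_comp, δₗ_naturality_left, h.add_left,
      Preadditive.comp_add]
  · simp only [Functor.map_smul, Linear.smul_comp, δₗ_naturality_left, h.smul_left,
      Linear.comp_smul]
  · simp only [Functor.map_add, Preadditive.add_comp, δₗ_naturality_right, h.add_right,
      Preadditive.comp_add]
  · simp only [Functor.map_smul, Linear.smul_comp, δₗ_naturality_right, h.smul_right,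
      Linear.comp_smul]
  -- Acting on `M` and then applying `T` is, up to isomorphism, acting on `T(M)`.
  · exact exact_of_comp_equivalence Θ.T
      (NatIso.ofComponents (fun X => Functor.LeftLinear.μₗIso Θ.T X M)
        fun f => Functor.LaxLeftLinear.μₗ_naturality_left Θ.T f M) (h.exact_left (Θ.T.obj M))
  · have := (h.exact_right X).1
    have := (h.exact_right X).2
    -- Acting by `X` and then applying `T` is, up to isomorphism, applying `T` and then acting by
    -- `X`; this is exact because the equivalence `T` is.
    exact exact_of_comp_equivalence (H' := Θ.T ⋙ actionLeft E X) Θ.T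
      (NatIso.ofComponents (fun M => Functor.LeftLinear.μₗIso Θ.T X M)
        fun f => Functor.LaxLeftLinear.μₗ_naturality_right Θ.T X f)
      ⟨inferInstance, inferInstance⟩

/-- A module category over `C'` is a module category over `C` through an exact linear monoidal
functor `C ⥤ C'`. -/
theorem IsModuleCategory.pullback {B : Type*} [Category* B] [Preadditive B] [Linear k B]
    [MonoidalLeftAction C' B] (P : C ⥤ C') [P.Monoidal] [P.Additive] [P.Linear k]
    [PreservesFiniteLimits P] [PreservesFiniteColimits P] (h : IsModuleCategory k C' B) :
    letI : MonoidalLeftAction C B := pullbackAction P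
    IsModuleCategory k C B :=
  letI : MonoidalLeftAction C B := pullbackAction P
  { abelian := h.abelian
    add_left f g M := by
      change P.map (f + g) ⊵ₗ M = P.map f ⊵ₗ M + P.map g ⊵ₗ M
      rw [P.map_add, h.add_left]
    smul_left r f M := by
      change P.map (r • f) ⊵ₗ M = r • P.map f ⊵ₗ M
      rw [P.map_smul, h.smul_left]
    add_right X := h.add_right (P.obj X)
    smul_right X := h.smul_right (P.obj X)
    exact_left M := by
      have := (h.exact_left M).1
      have := (h.exact_left M).2
      -- In the first variable the new action is the old one precomposed with `P`; this is where
      -- exactness of `P` enters.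
      exact ⟨(inferInstance : PreservesFiniteLimits (P ⋙ actionRight C' M)),
        (inferInstance : PreservesFiniteColimits (P ⋙ actionRight C' M))⟩
    exact_right X := h.exact_right (P.obj X) }

end Transfer

end QuasiHopf

/-! ### The `F`-equivariant structure on `K`-modules -/

namespace QuasiHopf

open QuasiHopf.QuasiBialgebra (Δ ε)

/-- Invert the isomorphisms in a square. -/
theorem comp_inv_comp_inv {D : Type*} [Category* D] {a b c d e f : D} {p : a ≅ b} {q : b ≅ c}
    {u : c ⟶ d} {α : a ⟶ e} {r : e ≅ f} {s : f ≅ d}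
    (h : p.hom ≫ q.hom ≫ u = α ≫ r.hom ≫ s.hom) : u ≫ s.inv ≫ r.inv = q.inv ≫ p.inv ≫ α := by
  rw [← Category.assoc, Iso.comp_inv_eq, Iso.comp_inv_eq]
  simp only [Category.assoc]
  rw [Iso.eq_inv_comp, Iso.eq_inv_comp, h]

/-- The isomorphism `f ⊗ g`. -/
noncomputable def RepCat.tensorIso {s : ModuleSize} {k A K : Type u} [Field k] [Ring A]
    [Algebra k A] [QuasiBialgebra k A] [Ring K] [Algebra k K] [ComoduleAlgebra k A K]
    {X Y : FdRep k A} {M N : RepCat s k K} (f : X ≅ Y) (g : M ≅ N) : tensor X M ≅ tensor Y N where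
  hom := tensorMap f.hom g.hom
  inv := tensorMap f.inv g.inv
  hom_inv_id := by rw [← tensorMap_comp, f.hom_inv_id, g.hom_inv_id, tensorMap_id]
  inv_hom_id := by rw [← tensorMap_comp, f.inv_hom_id, g.inv_hom_id, tensorMap_id]

namespace ComoduleCrossedSystem

open RepCat

section Group

variable {s : ModuleSize} {k A K G : Type u} [Field k] [Ring A] [Algebra k A] [QuasiBialgebra k A]
  [Ring K] [Algebra k K] [ComoduleAlgebra k A K] [Group G] {S : CrossedSystem k A G}
  {F : Subgroup G} (T : ComoduleCrossedSystem S K F)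

/-- The isomorphism `F_σ(X) ⊗ U_σ(M) ≅ U_σ(X ⊗ M)` given by `J̄_σ`. -/
noncomputable def tensorator (σ : F) (X : FdRep k A) (M : RepCat s k K) :
    tensor ((restrict (S.act σ)).obj X) ((restrict (T.act σ)).obj M) ≅
      (restrict (T.act σ)).obj (tensor X M) :=
  mkIso (unitEquiv (op X.ρ M.ρ) (T.J σ)) fun x => by
    -- On the restricted modules `λ(x)` acts as `(σ_* ⊗ σ̄)(λ(x))`, so the `K`-linearity of `J̄_σ`
    -- is the relation `coact_act`.
    have h : op (X.ρ.comp (S.act σ)) (M.ρ.comp (T.act σ)) (ComoduleAlgebra.coact x) =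
      op X.ρ M.ρ (Algebra.TensorProduct.map (S.act σ) (T.act σ) (ComoduleAlgebra.coact x)) :=
      RepCat.op_comp _ _ _ _ _
    change op X.ρ M.ρ (T.J σ).val ∘ₗ
        op (X.ρ.comp (S.act σ)) (M.ρ.comp (T.act σ)) (ComoduleAlgebra.coact x) =
      op X.ρ M.ρ (ComoduleAlgebra.coact (T.act σ x)) ∘ₗ op X.ρ M.ρ (T.J σ).val
    rw [h, ← Module.End.mul_eq_comp, ← Module.End.mul_eq_comp, ← map_mul, ← map_mul, T.coact_act]

/-- A tensor product of module maps commutes with the action of all of `A ⊗ K`, hence with `J̄_σ`.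
-/
theorem tensorator_naturality (σ : F) {X X' : FdRep k A} {M M' : RepCat s k K} (f : X ⟶ X')
    (g : M ⟶ M') :
    tensorMap ((restrict (S.act σ)).map f) ((restrict (T.act σ)).map g) ≫
      (T.tensorator σ X' M').hom = (T.tensorator σ X M).hom ≫
        (restrict (T.act σ)).map (tensorMap f g) := by
  ext : 1
  have := map_comp_op (φ := AlgHom.id k A) (ψ := AlgHom.id k K) f.2 g.2 (T.J σ).val
  rw [Algebra.TensorProduct.map_id] at this
  exact this.symm

theorem tensorator_inv_naturality (σ : F) {X X' : FdRep k A} {M M' : RepCat s k K} (f : X ⟶ X')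
    (g : M ⟶ M') :
    (restrict (T.act σ)).map (tensorMap f g) ≫ (T.tensorator σ X' M').inv =
      (T.tensorator σ X M).inv ≫
        tensorMap ((restrict (S.act σ)).map f) ((restrict (T.act σ)).map g) := by
  rw [Iso.comp_inv_eq, Category.assoc, T.tensorator_naturality, Iso.inv_hom_id_assoc]

/-- Once every operator is carried past the rebracketing to `X ⊗ (Y ⊗ M)`, both composites are the
rebracketing followed by an element of `A ⊗ A ⊗ K`. The two elements are the two sides of the twist
identity. -/
theorem tensorator_assoc (σ : F) (X Y : FdRep k A) (M : RepCat s k K) :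
    tensorMap (S.tensorator σ X Y).hom (𝟙 ((restrict (T.act σ)).obj M)) ≫
      (T.tensorator σ (tensor X Y) M).hom ≫
        (restrict (T.act σ)).map (RepCat.associator X Y M).hom =
    (RepCat.associator _ _ _).hom ≫
      tensorMap (𝟙 ((restrict (S.act σ)).obj X)) (T.tensorator σ Y M).hom ≫
      (T.tensorator σ X (tensor Y M)).hom := by
  ext : 1
  set φ : A ⊗[k] (A ⊗[k] K) := (ComoduleAlgebra.assoc : (A ⊗[k] (A ⊗[k] K))ˣ).val
  set O := op X.ρ (op Y.ρ M.ρ)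
  set a := (TensorProduct.assoc k X.V Y.V M.V).toLinearMap
  -- On the left-bracketed side, `J_σ ⊗ 1` and `(Δ ⊗ id)(J̄_σ)` have to be moved past the
  -- rebracketing `a`.
  have h1 : a ∘ₗ TensorProduct.map (op X.ρ Y.ρ (S.J σ).val) LinearMap.id =
      O (Algebra.TensorProduct.assoc k k k A A K ((S.J σ).val ⊗ₜ 1)) ∘ₗ a := by
    rw [← assoc_comp_op, op_tmul, map_one]
    rfl
  have h2 : a ∘ₗ op ((op X.ρ Y.ρ).comp Δ) M.ρ (T.J σ).val =
      O (splitLeft Δ (T.J σ).val) ∘ₗ a := by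
    have := RepCat.op_comp (op X.ρ Y.ρ) M.ρ Δ (AlgHom.id k K) (T.J σ).val
    rw [AlgHom.comp_id] at this
    rw [this, assoc_comp_op]
    rfl
  set P : A ⊗[k] (A ⊗[k] K) →ₐ[k] Module.End k (X.V ⊗[k] (Y.V ⊗[k] M.V)) :=
    op (X.ρ.comp (S.act σ)) (op (Y.ρ.comp (S.act σ)) (M.ρ.comp (T.act σ))) with hP
  -- The associator of the restricted modules is the action of `(σ_* ⊗ σ_* ⊗ σ̄)(Φ_λ)` on the
  -- original ones.
  have h3 : P φ = O (Algebra.TensorProduct.map (S.act σ)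
        (Algebra.TensorProduct.map (S.act σ) (T.act σ)) φ) := by
    rw [hP, ← RepCat.op_comp]
    congr 2
    exact AlgHom.ext fun t => RepCat.op_comp _ _ _ _ t
  have h4 : op X.ρ ((op Y.ρ M.ρ).comp ComoduleAlgebra.coact) (T.J σ).val =
      O (onRight ComoduleAlgebra.coact (T.J σ).val) := by
    have := RepCat.op_comp X.ρ (op Y.ρ M.ρ) (AlgHom.id k A) ComoduleAlgebra.coact (T.J σ).val
    rw [AlgHom.comp_id] at this
    exact this
  have h5 : TensorProduct.map LinearMap.id (op Y.ρ M.ρ (T.J σ).val) = O (1 ⊗ₜ (T.J σ).val) := by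
    rw [op_tmul, map_one]
    rfl
  have e : Algebra.TensorProduct.assoc k k k A A K ((S.J σ).val ⊗ₜ 1) =
      onRight Algebra.TensorProduct.includeLeft (S.J σ).val := by
    generalize (S.J σ).val = t
    induction t with
    | zero => simp
    | add a b ha hb => simp only [TensorProduct.add_tmul, map_add, ha, hb]
    | tmul a b => simp
  have key := congrArg O (T.twist σ)
  simp only [map_mul, Module.End.mul_eq_comp] at key
  have e1 : ((restrict (T.act σ)).map (RepCat.associator X Y M).hom).1 = O φ ∘ₗ a := rfl
  have e2 : (T.tensorator σ (tensor X Y) M).hom.1 =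
      op ((op X.ρ Y.ρ).comp Δ) M.ρ (T.J σ).val := rfl
  have e3 : (tensorMap (S.tensorator σ X Y).hom (𝟙 ((restrict (T.act σ)).obj M))).1 =
      TensorProduct.map (op X.ρ Y.ρ (S.J σ).val) LinearMap.id := rfl
  have e4 : (T.tensorator σ X (tensor Y M)).hom.1 =
      op X.ρ ((op Y.ρ M.ρ).comp ComoduleAlgebra.coact) (T.J σ).val := rfl
  have e5 : (tensorMap (𝟙 ((restrict (S.act σ)).obj X)) (T.tensorator σ Y M).hom).1 =
      TensorProduct.map LinearMap.id (op Y.ρ M.ρ (T.J σ).val) := rfl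
  have e6 : (RepCat.associator ((restrict (S.act σ)).obj X) ((restrict (S.act σ)).obj Y)
      ((restrict (T.act σ)).obj M)).hom.1 = P φ ∘ₗ a := rfl
  -- The two sides of the diagram are assembled from the operators identified above, and
  -- `comp_eq_of_key` reduces their equality to the twist identity `key`.
  have f1 := congrArg₂ LinearMap.comp (congrArg₂ LinearMap.comp e1 e2) e3
  have f2 := congrArg₂ LinearMap.comp (congrArg₂ LinearMap.comp e4 e5) e6
  rw [← h3, ← h4, ← h5] at key
  rw [e] at h1
  have f3 := CrossedSystem.comp_eq_of_key h1 h2 key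
  exact f1.trans (f3.trans f2.symm)

/-- On `k ⊗ M` the element `J̄_σ` acts through `(ε ⊗ id)(J̄_σ) = 1`. -/
theorem tensorator_unit (σ : F) (M : RepCat s k K) :
    (RepCat.leftUnitor (A := A) ((restrict (T.act σ)).obj M)).hom =
      tensorMap (S.unitor σ).hom (𝟙 ((restrict (T.act σ)).obj M)) ≫
        (T.tensorator σ unit M).hom ≫
          (restrict (T.act σ)).map (RepCat.leftUnitor (A := A) M).hom := by
  ext : 1
  have h := lid_comp_op (ε : A →ₐ[k] k) M.ρ (T.J σ).val
  rw [T.counit_left, map_one] at h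
  change (TensorProduct.lid k M.V).toLinearMap = ((TensorProduct.lid k M.V).toLinearMap ∘ₗ
    op (scalarAction ε) M.ρ (T.J σ).val) ∘ₗ TensorProduct.map LinearMap.id LinearMap.id
  rw [h, TensorProduct.map_id]
  rfl

/-- The structure map `c^σ` is the inverse of the action of `J̄_σ`, so the associativity diagram is
needed with these isomorphisms inverted. -/
theorem tensorator_inv_assoc (σ : F) (X Y : FdRep k A) (M : RepCat s k K) :
    (restrict (T.act σ)).map (RepCat.associator X Y M).hom ≫ (T.tensorator σ X (tensor Y M)).inv ≫
        tensorMap (𝟙 ((restrict (S.act σ)).obj X)) (T.tensorator σ Y M).inv =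
      (T.tensorator σ (tensor X Y) M).inv ≫
        tensorMap (S.tensorator σ X Y).inv (𝟙 ((restrict (T.act σ)).obj M)) ≫
          (RepCat.associator _ _ _).hom :=
  comp_inv_comp_inv (p := RepCat.tensorIso (S.tensorator σ X Y) (Iso.refl _))
    (r := RepCat.tensorIso (Iso.refl _) (T.tensorator σ Y M)) (T.tensorator_assoc σ X Y M)

theorem tensorator_inv_unit (σ : F) (M : RepCat s k K) :
    (T.tensorator σ unit M).inv ≫ tensorMap (S.unitor σ).inv (𝟙 ((restrict (T.act σ)).obj M)) ≫
        (RepCat.leftUnitor (A := A) ((restrict (T.act σ)).obj M)).hom =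
      (restrict (T.act σ)).map (RepCat.leftUnitor (A := A) M).hom := by
  rw [Iso.inv_comp_eq]
  exact (Iso.inv_comp_eq (RepCat.tensorIso (S.unitor σ) (Iso.refl _))).mpr (T.tensorator_unit σ M)

end Group

section CommGroup

variable {k A K G : Type u} [Field k] [Ring A] [Algebra k A] [QuasiBialgebra k A]
  [Ring K] [Algebra k K] [ComoduleAlgebra k A K] [CommGroup G] {S : CrossedSystem k A G}
  {F : Subgroup G} (T : ComoduleCrossedSystem S K F)

/-- The compatibility of `μ_{σ,τ}` with the maps `c`, written in `A ⊗ K`. It is the inverse of the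
formula for `λ(θ̄_{τ,σ}) J̄_{τσ}`, with `σ` and `τ` exchanged by symmetry: multiplied on the left by
`λ(θ̄_{σ,τ}) J̄_{στ}`, both sides become `1`. -/
theorem J_inv_coact (hS : S.Symmetric) (hT : T.Symmetric) (σ τ : F) :
    (↑(T.J (σ * τ))⁻¹ : A ⊗[k] K) * ComoduleAlgebra.coact (↑(T.θ σ τ)⁻¹ : K) =
      (↑(S.θ σ τ)⁻¹ : A) ⊗ₜ[k] (↑(T.θ σ τ)⁻¹ : K) *
        (Algebra.TensorProduct.map (S.act τ) (T.act τ) (↑(T.J σ)⁻¹ : A ⊗[k] K) *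
          (↑(T.J τ)⁻¹ : A ⊗[k] K)) := by
  have h := T.coact_θ τ σ
  rw [hT τ σ, mul_comm τ σ, hS τ σ] at h
  have h1 : (S.θ σ τ : A) ⊗ₜ[k] (T.θ σ τ : K) *
      (↑(S.θ σ τ)⁻¹ : A) ⊗ₜ[k] (↑(T.θ σ τ)⁻¹ : K) = 1 := by
    rw [Algebra.TensorProduct.tmul_mul_tmul, Units.mul_inv, Units.mul_inv,
      Algebra.TensorProduct.one_def]
  have h2 : ComoduleAlgebra.coact (T.θ σ τ : K) * ComoduleAlgebra.coact (↑(T.θ σ τ)⁻¹ : K) =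
      (1 : A ⊗[k] K) := by
    rw [← map_mul, Units.mul_inv, map_one]
  have h3 : Algebra.TensorProduct.map (S.act τ) (T.act τ) (T.J σ : A ⊗[k] K) *
      Algebra.TensorProduct.map (S.act τ) (T.act τ) (↑(T.J σ)⁻¹ : A ⊗[k] K) = 1 := by
    rw [← map_mul, Units.mul_inv, map_one]
  have hu : IsUnit (ComoduleAlgebra.coact (T.θ σ τ : K) * (T.J (σ * τ) : A ⊗[k] K)) :=
    ((T.θ σ τ).isUnit.map _).mul (T.J (σ * τ)).isUnit
  refine hu.mul_left_cancel ?_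
  trans 1
  · rw [mul_assoc, ← mul_assoc (T.J (σ * τ) : A ⊗[k] K), Units.mul_inv, one_mul, h2]
  · rw [h, mul_assoc, ← mul_assoc (_ ⊗ₜ[k] _), h1, one_mul, mul_assoc,
      ← mul_assoc (Algebra.TensorProduct.map _ _ _), h3, one_mul, Units.mul_inv]

variable (hS : S.Symmetric) (hT : T.Symmetric) (s : ModuleSize)

/-- The `F`-equivariant structure on the category of `K`-modules. -/
noncomputable def equivariantStructure : EquivariantStructure (S.action hS) F
    (fun σ : F => (restrict (T.act σ) : RepCat s k K ⥤ RepCat s k K)) where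
  c σ X M := (T.tensorator σ X M).symm
  c_naturality σ _ _ _ _ f g := T.tensorator_inv_naturality σ f g
  c_assoc σ X Y M := T.tensorator_inv_assoc σ X Y M
  c_unit σ M := T.tensorator_inv_unit σ M
  μ := T.compIso hT
  μ_linear σ τ X M := by
    ext : 1
    -- The map `c^σ` is taken at `F_τ(X)` and `U_τ(M)`, where `J̄_σ⁻¹` acts as its image under `τ_*
    -- ⊗ τ̄`.
    have h : op (X.ρ.comp (S.act τ)) (M.ρ.comp (T.act τ)) ↑(T.J σ)⁻¹ =
      op X.ρ M.ρ (Algebra.TensorProduct.map (S.act τ) (T.act τ) ↑(T.J σ)⁻¹) :=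
      RepCat.op_comp _ _ _ _ _
    change op X.ρ M.ρ ↑(T.J (σ * τ))⁻¹ * op X.ρ M.ρ (ComoduleAlgebra.coact ↑(T.θ σ τ)⁻¹) =
      op X.ρ M.ρ (↑(S.θ σ τ)⁻¹ ⊗ₜ ↑(T.θ σ τ)⁻¹) *
        (op (X.ρ.comp (S.act τ)) (M.ρ.comp (T.act τ)) ↑(T.J σ)⁻¹ * op X.ρ M.ρ ↑(T.J τ)⁻¹)
    rw [h, ← map_mul, ← map_mul, ← map_mul, T.J_inv_coact hS hT]
  ι := T.idIso
  ι_linear X M := by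
    ext : 1
    change op X.ρ M.ρ ↑(T.J 1)⁻¹ ∘ₗ LinearMap.id = TensorProduct.map LinearMap.id LinearMap.id
    rw [T.J_one, inv_one, Units.val_one, map_one, TensorProduct.map_id]
    rfl
  assoc σ τ ν M := by
    ext : 1
    -- The canonical map between `U_{(στ)ν}(M)` and `U_{σ(τν)}(M)` is the identity of the vector
    -- space, so only the cocycle identity is left.
    have h := eqToHom_val T.act (mul_assoc σ τ ν) M
    have e : ((T.compIso hT σ τ).hom.app ((restrict (T.act ν)).obj M) ≫
        (T.compIso hT (σ * τ) ν).hom.app M ≫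
        eqToHom (congrArg (fun g => (restrict (T.act g)).obj M) (mul_assoc σ τ ν))).1 =
      (LinearMap.id ∘ₗ M.ρ ↑(T.θ (σ * τ) ν)⁻¹) ∘ₗ M.ρ (T.act ν ↑(T.θ σ τ)⁻¹) :=
      congrArg (fun f => (f ∘ₗ M.ρ ↑(T.θ (σ * τ) ν)⁻¹) ∘ₗ M.ρ (T.act ν ↑(T.θ σ τ)⁻¹)) h
    refine Eq.trans ?_ e.symm
    change M.ρ ↑(T.θ σ (τ * ν))⁻¹ * M.ρ ↑(T.θ τ ν)⁻¹ =
      M.ρ ↑(T.θ (σ * τ) ν)⁻¹ * M.ρ (T.act ν ↑(T.θ σ τ)⁻¹)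
    rw [← map_mul, ← map_mul, T.θ_inv_assoc hT]
  unit_left σ M := by
    ext : 1
    refine Eq.trans ?_ (eqToHom_val T.act (one_mul σ).symm M).symm
    change M.ρ ↑(T.θ 1 σ)⁻¹ ∘ₗ LinearMap.id = LinearMap.id
    rw [T.θ_one_left, inv_one, Units.val_one, map_one]
    rfl
  unit_right σ M := by
    ext : 1
    refine Eq.trans ?_ (eqToHom_val T.act (mul_one σ).symm M).symm
    change M.ρ ↑(T.θ σ 1)⁻¹ ∘ₗ LinearMap.id = LinearMap.id
    rw [T.θ_one_right, inv_one, Units.val_one, map_one]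
    rfl

end CommGroup

end ComoduleCrossedSystem

end QuasiHopf

/-! ### The equivalence of `Rep(A)^G`-module categories -/

namespace QuasiHopf

open RepCat MonoidalLeftAction
open QuasiHopf.QuasiBialgebra (Δ ε)

section LeftLinear

variable {C D E : Type*} [Category* C] [MonoidalCategory C] [Category* D] [MonoidalLeftAction C D]
  [Category* E] [MonoidalLeftAction C E]

/-- A functor is linear if there are coherent isomorphisms `X ⊗ T(M) ≅ T(X ⊗ M)`. -/
abbrev leftLinearOfIso (T : D ⥤ E) (e : ∀ (X : C) (M : D), X ⊙ₗ T.obj M ≅ T.obj (X ⊙ₗ M))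
    (left : ∀ {X X' : C} (f : X ⟶ X') (M : D),
      f ⊵ₗ T.obj M ≫ (e X' M).hom = (e X M).hom ≫ T.map (f ⊵ₗ M))
    (right : ∀ (X : C) {M M' : D} (f : M ⟶ M'),
      X ⊴ₗ T.map f ≫ (e X M').hom = (e X M).hom ≫ T.map (X ⊴ₗ f))
    (assoc : ∀ (X Y : C) (M : D), (e (X ⊗ Y) M).hom ≫ T.map (αₗ X Y M).hom =
      (αₗ X Y (T.obj M)).hom ≫ X ⊴ₗ (e Y M).hom ≫ (e X (Y ⊙ₗ M)).hom)
    (unit : ∀ M : D, (λₗ[C] (T.obj M)).hom = (e (𝟙_ C) M).hom ≫ T.map (λₗ M).hom) :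
    T.LeftLinear C where
  μₗ X M := (e X M).hom
  μₗ_naturality_left := left
  μₗ_naturality_right := right
  μₗ_associativity := assoc
  μₗ_unitality := unit
  δₗ X M := (e X M).inv
  δₗ_naturality_left f M := by
    rw [Iso.comp_inv_eq, Category.assoc, left, Iso.inv_hom_id_assoc]
  δₗ_naturality_right X _ _ f := by
    rw [Iso.comp_inv_eq, Category.assoc, right, Iso.inv_hom_id_assoc]
  δₗ_associativity X Y M := by
    have h : X ⊴ₗ (e Y M).hom ≫ X ⊴ₗ (e Y M).inv = 𝟙 _ := by
      rw [← actionHomRight_comp, Iso.hom_inv_id, actionHomRight_id]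
    rw [Iso.inv_comp_eq, ← Category.assoc, assoc]
    simp [h]
  δₗ_unitality_inv M := by
    rw [Iso.eq_comp_inv, Iso.inv_comp_eq, unit, Category.assoc,
      ← Functor.map_comp, Iso.hom_inv_id, CategoryTheory.Functor.map_id, Category.comp_id]
  μₗ_comp_δₗ X M := (e X M).hom_inv_id
  δₗ_comp_μₗ X M := (e X M).inv_hom_id

end LeftLinear

namespace CrossedSystem

variable {k A G : Type u} [Field k] [Ring A] [Algebra k A] [QuasiBialgebra k A]
  [CommGroup G] (S : CrossedSystem k A G) (hS : S.Symmetric)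

/-- `Rep(A)^G → Rep(A # G)` is by definition the functor `toCrossed` for finite-dimensional modules
over the crossed product `A # G`. In particular it is exact, as the pullback of module categories
requires. -/
instance : (S.toSmash hS).IsEquivalence :=
  inferInstanceAs (S.toFactorSystem.toCrossed .finite hS).IsEquivalence

instance : (S.toSmash hS).Additive where
  map_add := rfl

instance : (S.toSmash hS).Linear k where
  map_smul _ _ := rfl

end CrossedSystem

namespace ComoduleCrossedSystem

variable {k A K G : Type u} [Field k] [Ring A] [Algebra k A] [QuasiBialgebra k A]
  [Ring K] [Algebra k K] [ComoduleAlgebra k A K] [CommGroup G] {S : CrossedSystem k A G}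
  {F : Subgroup G} (T : ComoduleCrossedSystem S K F) {hS : S.Symmetric} (hT : T.Symmetric)
  {s : ModuleSize}

/-- The category of `K # F`-modules is a `Rep(A)^G`-module category. -/
theorem isModuleCategory_smash :
    IsModuleCategory k (S.action hS).Equivariantization (RepCat s k T.Smash) :=
  -- Since `A # G` is a quasi-bialgebra and `K # F` a comodule algebra over it, the general result
  -- applies to them with `Rep(A # G)` acting.
  IsModuleCategory.pullback (S.toSmash hS) (RepCat.isModuleCategory s k S.Smash T.Smash)

variable {T}

/-- In both tensor factors `x # σ = (x # 1)(1 # σ)`, so the part of degree `σ` splits off as `u_σ⁻¹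
⊗ (1 # σ)`. Taking `λ(x) J̄_σ` for `t` computes the action of `x # σ` on `X ⊗ N`. -/
theorem op_smashAction_incl₂ (X : (S.action hS).Equivariantization) (N : RepCat s k T.Smash)
    (σ : F) (t : A ⊗[k] K) :
    op (CrossedSystem.smashAction X) N.ρ
        (incl₂ S.toFactorSystem T.toFactorSystem F.subtype σ t) =
      op X.obj.ρ (N.ρ.comp T.inclOne) t *
        TensorProduct.map (CrossedSystem.invEnd X σ) (N.ρ (T.incl σ 1)) := by
  induction t with
  | zero => simp
  | add a b ha hb => simp only [map_add, ha, hb, add_mul]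
  | tmul a x =>
    have h : T.incl σ x = T.inclOne x * T.incl σ 1 := by
      rw [FactorSystem.inclOne_mul_incl, mul_one]
    simp only [incl₂, TensorProduct.map_tmul, op_tmul, CrossedSystem.smashAction_incl, h, map_mul]
    exact TensorProduct.map_mul _ _ _ _

theorem op_smashAction_inclOne₂ (X : (S.action hS).Equivariantization) (N : RepCat s k T.Smash)
    (t : A ⊗[k] K) :
    op (CrossedSystem.smashAction X) N.ρ (inclOne₂ S.toFactorSystem T.toFactorSystem t) =
      op X.obj.ρ (N.ρ.comp T.inclOne) t := by
  induction t with
  | zero => simp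
  | add a b ha hb => simp only [map_add, ha, hb]
  | tmul a x =>
    simp only [inclOne₂, Algebra.TensorProduct.map_tmul, op_tmul,
      CrossedSystem.smashAction_inclOne, AlgHom.comp_apply]

/-- In degree `1` the maps `u_1` are identities. Applied to `Φ_λ`, this shows that the associators
of `K # F`-modules and of `K`-modules are the same operator. -/
theorem op_smashAction_inclOne₃ (X Y : (S.action hS).Equivariantization)
    (N : RepCat s k T.Smash) (t : A ⊗[k] (A ⊗[k] K)) :
    op (CrossedSystem.smashAction X) (op (CrossedSystem.smashAction Y) N.ρ)
        (inclOne₃ S.toFactorSystem T.toFactorSystem t) =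
      op X.obj.ρ (op Y.obj.ρ (N.ρ.comp T.inclOne)) t := by
  induction t with
  | zero => simp
  | add a b ha hb => simp only [map_add, ha, hb]
  | tmul a t =>
    simp only [inclOne₃, Algebra.TensorProduct.map_tmul, op_tmul,
      CrossedSystem.smashAction_inclOne, op_smashAction_inclOne₂]

variable (T) (hS) (s)

/-- The functor from equivariant `K`-modules to `K # F`-modules. -/
noncomputable def toSmash :
    (T.equivariantStructure hS hT s).Equivariantization ⥤ RepCat s k T.Smash :=
  -- The isomorphisms `μ` of `equivariantStructure` are `compIso`, so its equivariant objects are by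
  -- definition those of `EquivariantModule`.
  T.toFactorSystem.toCrossed s hT

/-- The functor from `K # F`-modules to equivariant `K`-modules. -/
noncomputable def fromSmash :
    RepCat s k T.Smash ⥤ (T.equivariantStructure hS hT s).Equivariantization :=
  T.toFactorSystem.fromCrossed s hT

theorem crossedAction_comp_inclOne (M : (T.equivariantStructure hS hT s).Equivariantization) :
    (((T.toSmash hS hT s).obj M).ρ.comp T.inclOne) = M.obj.ρ :=
  AlgHom.ext (FactorSystem.crossedAction_inclOne (c := T.toFactorSystem) (hc := hT) M)

theorem toSmash_ρ_incl (M : (T.equivariantStructure hS hT s).Equivariantization) (σ : F) (x : K) :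
    ((T.toSmash hS hT s).obj M).ρ (T.incl σ x) = M.obj.ρ x * (M.v σ).inv.1 :=
  FactorSystem.crossedAction_incl (c := T.toFactorSystem) (hc := hT) M σ x

/-- The isomorphism `X ⊗ P(M) ≅ P(X ⊗ M)`, with `P` the functor `toSmash`; it is the identity on
the vector space `X ⊗ M`. -/
noncomputable def toSmashIso (X : (S.action hS).Equivariantization)
    (M : (T.equivariantStructure hS hT s).Equivariantization) :
    X ⊙ₗ (T.toSmash hS hT s).obj M ≅ (T.toSmash hS hT s).obj (X ⊙ₗ M) :=
  mkIso (X := tensor ((S.toSmash hS).obj X) ((T.toSmash hS hT s).obj M))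
    (LinearEquiv.refl k (X.obj.V ⊗[k] M.obj.V)) fun z => by
    change op (CrossedSystem.smashAction X) ((T.toSmash hS hT s).obj M).ρ
      (crossedCoact T.isCoactionDatum z) = ((T.toSmash hS hT s).obj (X ⊙ₗ M)).ρ z
    induction z using FactorSystem.induction with
    | h0 => rw [map_zero, map_zero]; exact (map_zero _).symm
    | h2 a b ha hb => rw [map_add, map_add, ha, hb]; exact (map_add _ _ _).symm
    | h1 σ x =>
      -- On the left `x # σ` acts as `λ(x) J̄_σ (u_σ⁻¹ ⊗ v_σ⁻¹)`. On the right it acts as `λ(x)`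
      -- times the inverse of `(u_σ ⊗ v_σ) c^σ`, which is the same operator.
      rw [toSmash_ρ_incl, crossedCoact_incl, op_smashAction_incl₂,
        crossedAction_comp_inclOne, map_mul, mul_assoc, toSmash_ρ_incl, map_one, one_mul]
      rfl

/-- The isomorphism `X ⊗ S(N) ≅ S(X ⊗ N)`, with `S` the functor `fromSmash`; it is the identity on
the vector space `X ⊗ N`. -/
noncomputable def fromSmashIso (X : (S.action hS).Equivariantization) (N : RepCat s k T.Smash) :
    X ⊙ₗ (T.fromSmash hS hT s).obj N ≅ (T.fromSmash hS hT s).obj (X ⊙ₗ N) :=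
  Equivariant.mkIso
    (mkIso (X := tensor X.obj ((restrict T.inclOne).obj N))
      (Y := (restrict T.inclOne).obj (tensor ((S.toSmash hS).obj X) N))
      (LinearEquiv.refl k (X.obj.V ⊗[k] N.V)) fun x => by
      change op X.obj.ρ (N.ρ.comp T.inclOne) (ComoduleAlgebra.coact x) =
        op (CrossedSystem.smashAction X) N.ρ (crossedCoact T.isCoactionDatum (T.inclOne x))
      rw [crossedCoact_inclOne, op_smashAction_inclOne₂])
    fun σ => by
      -- The square is rewritten with the inverses of the structure maps: these are the action of `1
      -- # σ` through the coaction on one side, and `J̄_σ (u_σ⁻¹ ⊗ (1 # σ))` on the other.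
      rw [← Iso.eq_inv_comp, ← Category.assoc, ← Iso.comp_inv_eq]
      ext : 1
      change op (CrossedSystem.smashAction X) N.ρ (crossedCoact T.isCoactionDatum (T.incl σ 1)) =
        op X.obj.ρ (N.ρ.comp T.inclOne) (T.J σ).val *
          TensorProduct.map (CrossedSystem.invEnd X σ) (N.ρ (T.incl σ 1))
      rw [crossedCoact_incl, op_smashAction_incl₂, map_one, one_mul]

/-- The structure isomorphisms are identities of vector spaces, so naturality is immediate. The
associativity diagram says that `Φ_λ # 1` and `Φ_λ` act by the same operator. -/
noncomputable instance : (T.toSmash hS hT s).LeftLinear (S.action hS).Equivariantization :=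
  leftLinearOfIso _ (T.toSmashIso hS hT s) (fun _ _ => rfl) (fun _ _ _ _ => rfl)
    (fun X Y M => by
      ext : 1
      change op X.obj.ρ (op Y.obj.ρ M.obj.ρ)
          (ComoduleAlgebra.assoc : (A ⊗[k] (A ⊗[k] K))ˣ).val ∘ₗ
          (TensorProduct.assoc k X.obj.V Y.obj.V M.obj.V).toLinearMap =
        TensorProduct.map LinearMap.id LinearMap.id ∘ₗ
          (op (CrossedSystem.smashAction X) (op (CrossedSystem.smashAction Y)
            ((T.toSmash hS hT s).obj M).ρ) (inclOne₃ S.toFactorSystem T.toFactorSystem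
              (ComoduleAlgebra.assoc : (A ⊗[k] (A ⊗[k] K))ˣ).val) ∘ₗ
          (TensorProduct.assoc k X.obj.V Y.obj.V M.obj.V).toLinearMap) ∘ₗ
          TensorProduct.map LinearMap.id LinearMap.id
      rw [op_smashAction_inclOne₃, crossedAction_comp_inclOne, TensorProduct.map_id,
        TensorProduct.map_id]
      rfl)
    (fun M => by
      ext : 1
      change (TensorProduct.lid k M.obj.V).toLinearMap ∘ₗ
          TensorProduct.map LinearMap.id LinearMap.id = (TensorProduct.lid k M.obj.V).toLinearMap
      rw [TensorProduct.map_id]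
      rfl)

/-- The same comparison of associators as for `toSmash`, with the two sides exchanged. -/
noncomputable instance : (T.fromSmash hS hT s).LeftLinear (S.action hS).Equivariantization :=
  leftLinearOfIso _ (T.fromSmashIso hS hT s) (fun _ _ => rfl) (fun _ _ _ _ => rfl)
    (fun X Y N => by
      ext : 2
      change (op (CrossedSystem.smashAction X) (op (CrossedSystem.smashAction Y) N.ρ)
            (inclOne₃ S.toFactorSystem T.toFactorSystem
              (ComoduleAlgebra.assoc : (A ⊗[k] (A ⊗[k] K))ˣ).val) ∘ₗ
          (TensorProduct.assoc k X.obj.V Y.obj.V N.V).toLinearMap) ∘ₗ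
          TensorProduct.map LinearMap.id LinearMap.id =
        TensorProduct.map LinearMap.id LinearMap.id ∘ₗ
          op X.obj.ρ (op Y.obj.ρ (N.ρ.comp T.inclOne))
            (ComoduleAlgebra.assoc : (A ⊗[k] (A ⊗[k] K))ˣ).val ∘ₗ
          (TensorProduct.assoc k X.obj.V Y.obj.V N.V).toLinearMap
      rw [op_smashAction_inclOne₃, TensorProduct.map_id, TensorProduct.map_id]
      rfl)
    (fun N => by
      ext : 2
      change (TensorProduct.lid k N.V).toLinearMap = (TensorProduct.lid k N.V).toLinearMap ∘ₗ
          TensorProduct.map LinearMap.id LinearMap.id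
      rw [TensorProduct.map_id]
      rfl)

/-- The equivalence of `Rep(A)^G`-module categories between equivariant `K`-modules and
`K # F`-modules. -/
noncomputable def smashEquivalence : ModuleEquivalence k (S.action hS).Equivariantization
    (T.equivariantStructure hS hT s).Equivariantization (RepCat s k T.Smash) where
  T := T.toSmash hS hT s
  S := T.fromSmash hS hT s
  additive_T := { map_add := rfl }
  additive_S := { map_add := rfl }
  linear_T := { map_smul _ _ := rfl }
  linear_S := { map_smul _ _ := rfl }
  isoD := T.toCrossedFromCrossed s hT
  isoE := T.fromCrossedToCrossed s hT
  -- Every map in the two compatibility conditions is an identity on vector spaces, so they reduce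
  -- to `id ⊗ id = id`.
  isoD_linear _ _ := Equivariant.hom_ext (RepCat.hom_ext TensorProduct.map_id.symm)
  isoE_linear _ _ := RepCat.hom_ext TensorProduct.map_id.symm

end ComoduleCrossedSystem

end QuasiHopf

theorem mainTheorem6 {k A K G : Type u} [Field k] [Ring A] [Algebra k A] [QuasiHopfAlgebra k A]
    [CommGroup G] (S : CrossedSystem k A G) [Ring K] [Algebra k K] [ComoduleAlgebra k A K]
    (F : Subgroup G) (T : ComoduleCrossedSystem S K F)
    (hS : S.Symmetric) (hT : T.Symmetric) (s : ModuleSize) :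
    IsModuleCategory k (FdRep k A) (RepCat s k K) ∧
    ∃ E : EquivariantStructure (S.action hS) F
        (fun σ : F => (RepCat.restrict (T.act σ) : RepCat s k K ⥤ RepCat s k K)),
      (∀ (σ : F) (X : FdRep k A) (M : RepCat s k K) (z : X.V ⊗[k] M.V),
        (E.c σ X M).hom.1 z = RepCat.op X.ρ M.ρ (↑(T.J σ)⁻¹ : A ⊗[k] K) z) ∧
      (∀ (σ τ : F) (M : RepCat s k K) (m : M.V),
        ((E.μ σ τ).hom.app M).1 m = M.ρ (↑(T.θ σ τ)⁻¹ : K) m) ∧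
      IsModuleCategory k (S.action hS).Equivariantization E.Equivariantization ∧
      IsModuleCategory k (S.action hS).Equivariantization (RepCat s k T.Smash) ∧
      Nonempty (ModuleEquivalence k (S.action hS).Equivariantization E.Equivariantization
        (RepCat s k T.Smash)) := by
  refine ⟨RepCat.isModuleCategory s k A K, T.equivariantStructure hS hT s, fun σ X M z => rfl,
    fun σ τ M m => rfl, ?_, T.isModuleCategory_smash, ⟨T.smashEquivalence hS hT s⟩⟩
  -- The abelian structure and the exactness of the action on equivariant modules are not checked
  -- directly: they are carried over from `K # F`-modules.
  exact (T.smashEquivalence hS hT s).isModuleCategory T.isModuleCategory_smash
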